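/- **Conventions.** Hilbert $C^*$-modules are right modules, with inner product $\langle\cdot,\cdot\rangle$ conjugate linear in the first variable. For a Hilbert $C^*$-module $E$ over a $C^*$-algebra $B$, $\mathcal L(E)$ denotes the adjointable operators, $\theta_{\xi,\eta}(\zeta)=\xi\cdot\langle\eta,\zeta\rangle$, and $\mathcal K(E)$ is the closed linear span of the $\theta_{\xi,\eta}$. $E$ is *full* if the inner products span a dense subspace of $B$. Consider pairs $(\phi,E)$ such that $(\ast)$: $B$ is a separable $C^*$-algebra, $E$ is a full and countably generated Hilbert $C^*$-module over $B$, and $\phi\colon B\to\mathcal L(E)$ is an injective $*$-homomorphism with image $\mathcal K(E)$. For such a pair let $E^*=\{\lambda_\xi=\langle\xi,\cdot\rangle : \xi\in E\}$, a Hilbert $C^*$-module over $B$ with $\lambda_\xi\cdot b=\lambda_\xi\circ\phi(b)$ and $\langle\lambda_\xi,\lambda_\eta\rangle=\phi^{-1}(\theta_{\xi,\eta})$, with left action $\phi^*(b)\lambda_\xi=\lambda_{\xi\cdot b^*}$. Let $E^{(n)}$ be the $n$-fold interior tensor power $E^{\widehat\otimes_\phi n}$ for $n>0$, $E^{(0)}=B$,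 $E^{(n)}=(E^*)^{\widehat\otimes_{\phi^*}(-n)}$ for $n<0$, and let $E_\infty=\bigoplus_{n\in\mathbb Z}E^{(n)}$. For $\xi\in E$ let $S_\xi\in\mathcal L(E_\infty)$ be given by $S_\xi(b)=\xi\cdot b$ and $S_\xi(\xi_1\otimes\cdots\otimes\xi_n)=\xi\otimes\xi_1\otimes\cdots\otimes\xi_n$ in degrees $0$ and $n>0$, by $S_\xi(\lambda_{\xi_1})=\phi^{-1}(\theta_{\xi,\xi_1})$ in degree $-1$, and by $S_\xi(\lambda_{\xi_1}\otimes\lambda_{\xi_2}\otimes\cdots)=\phi^*(\phi^{-1}(\theta_{\xi,\xi_1}))\lambda_{\xi_2}\otimes\cdots$ in degrees below $-1$. The *Pimsner algebra* $\mathcal O_E$ is the smallest $C^*$-subalgebra of $\mathcal L(E_\infty)$ that contains all $S_\xi$, $\xi\in E$. **Theorem.** Let $\{\sigma_z\}_{z\in S^1}$ be a strongly continuous action of the circle on a $C^*$-algebra $A$. For $n\in\mathbb Z$ let $$A_{(n)}=\{\xi\in A : \sigma_z(\xi)=z^{-n}\xi\ \text{ for all } z\in S^1\},$$ a right Hilbert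 $C^*$-module over the fixed-point algebra $A_{(0)}$ with right action given by multiplication in $A$ and $\langle\xi,\eta\rangle=\xi^*\eta$, and with left action $\phi(a)\xi=a\xi$ of $A_{(0)}$. Suppose that $A_{(0)}$ is separable and that $A_{(1)}$ and $A_{(-1)}$ are full and countably generated over $A_{(0)}$. Let $d\ge 1$ be an integer, and let $A^{1/d}\subseteq A$ be the closure of $\sum_{n\in\mathbb Z}A_{(nd)}$. Then: 1. The pair $(\phi,A_{(d)})$ and the $d$-fold interior tensor power $(A_{(1)})^{\widehat\otimes_\phi d}$ satisfy $(\ast)$. There is an isomorphism $\psi\colon(A_{(1)})^{\widehat\otimes_\phi d}\to A_{(d)}$ of Hilbert $C^*$-modules that preserves the inner products and commutes with the left actions of $A_{(0)}$, and such that $\psi(x_1\otimes\cdots\otimes x_d)=x_1\cdots x_d$ for all $x_1,\dots,x_d\in A_{(1)}$. 2. There is a $*$-isomorphism $\mathcal O_{(A_{(1)})^{\widehat\otimes_\phi d}}\to\mathcal O_{A_{(d)}}$ with $S_\zeta\mapsto S_{\psi(\zeta)}$ for all $\zeta$. 3. There is a $*$-isomorphism $\mathcal O_{A_{(d)}}\to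 A^{1/d}$ with $S_\xi\mapsto\xi$ for all $\xi\in A_{(d)}$. -/

import Mathlib

open scoped TensorProduct

universe u

noncomputable section

/-! ### Positivity in C*-algebras -/

section Positivity

/-- A self-adjoint `b` has a self-adjoint `N` (its negative part) with `N * b * N` negative, and
this product vanishes only if `b` is positive. -/
theorem exists_neg_conj {B : Type*} [NonUnitalCStarAlgebra B] [PartialOrder B]
    [StarOrderedRing B] (b : B) (hsa : IsSelfAdjoint b) :
    ∃ N R : B, star N * b * N = -(star R * R) ∧ (R = 0 → ∃ c, b = star c * c) := by
  have hN : 0 ≤ b⁻ := CFC.negPart_nonneg b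
  have hNsa : star b⁻ = b⁻ := (IsSelfAdjoint.of_nonneg hN).star_eq
  have key : b⁻ * b * b⁻ = -(b⁻ * b⁻ * b⁻) := by
    have h := CFC.posPart_sub_negPart b hsa
    calc b⁻ * b * b⁻ = b⁻ * (b⁺ - b⁻) * b⁻ := by rw [h]
      _ = _ := by rw [mul_sub, CFC.negPart_mul_posPart]; simp
  have h3 : 0 ≤ b⁻ * b⁻ * b⁻ := by
    have := star_left_conjugate_nonneg hN b⁻
    rwa [hNsa] at this
  obtain ⟨R, hR⟩ := CStarAlgebra.nonneg_iff_eq_star_mul_self.mp h3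
  refine ⟨b⁻, R, by rw [hNsa, key, hR], fun h0 => ?_⟩
  have h5 : b⁻ * b⁻ * b⁻ = 0 := by rw [hR, h0, mul_zero]
  have e1 : star (b⁻ * b⁻) * (b⁻ * b⁻) = 0 := by
    rw [star_mul, hNsa, ← mul_assoc, h5, zero_mul]
  have e2 := (CStarRing.star_mul_self_eq_zero_iff _).mp e1
  have h6 : b⁻ = 0 := by
    rw [← CStarRing.star_mul_self_eq_zero_iff, hNsa, e2]
  apply CStarAlgebra.nonneg_iff_eq_star_mul_self.mp
  rw [← CFC.posPart_sub_negPart b hsa, h6, sub_zero]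
  exact CFC.posPart_nonneg b

/-- An injective `*`-homomorphism of C*-algebras reflects positivity. -/
theorem nonneg_of_map_nonneg {B C : Type*} [NonUnitalCStarAlgebra B] [PartialOrder B]
    [StarOrderedRing B] [NonUnitalCStarAlgebra C] [PartialOrder C] [StarOrderedRing C]
    (φ : B →⋆ₙₐ[ℂ] C) (hφ : Function.Injective φ) {b : B} (hb : 0 ≤ φ b) : 0 ≤ b := by
  have hsa : IsSelfAdjoint b := hφ (by rw [map_star]; exact (IsSelfAdjoint.of_nonneg hb).star_eq)
  obtain ⟨N, R, hNR, h0⟩ := exists_neg_conj b hsa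
  have h4 : 0 ≤ -(star (φ R) * φ R) := by
    have := star_left_conjugate_nonneg hb (φ N)
    rwa [← map_star, ← map_mul, ← map_mul, hNR, map_neg, map_mul, map_star] at this
  have h5 : star (φ R) * φ R = 0 := le_antisymm (neg_nonneg.mp h4) (star_mul_self_nonneg _)
  have h6 : R = 0 := hφ (by rw [map_zero]; exact (CStarRing.star_mul_self_eq_zero_iff _).mp h5)
  obtain ⟨c, rfl⟩ := h0 h6
  exact star_mul_self_nonneg c

/-- A matrix `G` over a C*-algebra such that all diagonal entries of `star N * G * N` are positive,
for every matrix `N`, is of the form `star C * C`. -/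
theorem exists_eq_star_mul_self_of_conj {B : Type*} [NonUnitalCStarAlgebra B] [PartialOrder B]
    [StarOrderedRing B] {ι : Type*} [Fintype ι] (G : CStarMatrix ι ι B)
    (hsa : IsSelfAdjoint G)
    (hG : ∀ (N : CStarMatrix ι ι B) (j : ι), 0 ≤ (star N * G * N) j j) :
    ∃ C : CStarMatrix ι ι B, G = star C * C := by
  obtain ⟨N, R, hNR, h0⟩ := exists_neg_conj G hsa
  refine h0 ?_
  ext k j
  have h1 := hG N j
  rw [hNR] at h1
  have h2 : (star R * R) j j = ∑ k, star (R k j) * R k j := by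
    simp [CStarMatrix.mul_apply, CStarMatrix.star_apply]
  have h3 : (∑ k, star (R k j) * R k j) ≤ 0 := by
    rw [← h2]
    exact neg_nonneg.mp h1
  have h4 : ∑ k, star (R k j) * R k j = 0 :=
    le_antisymm h3 (Finset.sum_nonneg fun _ _ => star_mul_self_nonneg _)
  have h5 := (Finset.sum_eq_zero_iff_of_nonneg
    (fun k _ => star_mul_self_nonneg (R k j))).mp h4 k (Finset.mem_univ k)
  exact (CStarRing.star_mul_self_eq_zero_iff _).mp h5

end Positivity

section Modules

/-- The order of a C*-algebra, whose positive elements are the `star b * b`. -/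
local instance cstarOrder (B : Type*) [NonUnitalCStarAlgebra B] : PartialOrder B :=
  CStarAlgebra.spectralOrder B

local instance cstarOrderedRing (B : Type*) [NonUnitalCStarAlgebra B] : StarOrderedRing B :=
  CStarAlgebra.spectralOrderedRing B

/-! ### Hilbert modules -/

/-- A (right) Hilbert C*-module over `B`: a complex Banach space with a right action of `B`,
written `E.rsmul x b` for `x · b`, and a `B`-valued inner product, linear in the second variable,
whose norm is the given one. The remaining module axioms for the right action follow. (Mathlib's
`CStarModule` is the left-handed version, with `⟨x, b • y⟩ = b * ⟨x, y⟩`.) -/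
structure HilbertModule (B : Type u) [NonUnitalCStarAlgebra B] where
  carrier : Type u
  [normedAddCommGroup : NormedAddCommGroup carrier]
  [normedSpace : NormedSpace ℂ carrier]
  [completeSpace : CompleteSpace carrier]
  rsmul : carrier → B → carrier
  inner : carrier → carrier → B
  inner_add_right : ∀ x y z, inner x (y + z) = inner x y + inner x z
  inner_smul_right : ∀ (c : ℂ) (x y), inner x (c • y) = c • inner x y
  inner_rsmul_right : ∀ x y b, inner x (rsmul y b) = inner x y * b
  star_inner : ∀ x y, star (inner x y) = inner y x
  inner_self_nonneg : ∀ x, 0 ≤ inner x x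
  norm_sq_eq : ∀ x, ‖x‖ ^ 2 = ‖inner x x‖

attribute [instance] HilbertModule.normedAddCommGroup HilbertModule.normedSpace
  HilbertModule.completeSpace

/-- A complex vector space with a right action of `B` and a positive semidefinite `B`-valued inner
product. -/
structure PreHilbertModule (B : Type u) [NonUnitalCStarAlgebra B] where
  carrier : Type u
  [addCommGroup : AddCommGroup carrier]
  [module : Module ℂ carrier]
  rsmul : B → carrier →ₗ[ℂ] carrier
  inner : carrier → carrier → B
  inner_add_right : ∀ x y z, inner x (y + z) = inner x y + inner x z
  inner_smul_right : ∀ (c : ℂ) (x y), inner x (c • y) = c • inner x y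
  inner_rsmul_right : ∀ x y b, inner x (rsmul b y) = inner x y * b
  star_inner : ∀ x y, star (inner x y) = inner y x
  inner_self_nonneg : ∀ x, 0 ≤ inner x x

namespace PreHilbertModule

variable {B : Type u} [NonUnitalCStarAlgebra B] (P : PreHilbertModule B)

local instance instAddCommGroup : AddCommGroup P.carrier := P.addCommGroup

local instance instModule : Module ℂ P.carrier := P.module

theorem inner_add_left (x y z : P.carrier) : P.inner (x + y) z = P.inner x z + P.inner y z := by
  rw [← P.star_inner, P.inner_add_right, star_add, P.star_inner, P.star_inner]

theorem inner_smul_left (c : ℂ) (x y : P.carrier) : P.inner (c • x) y = star c • P.inner x y := by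
  rw [← P.star_inner, P.inner_smul_right, star_smul, P.star_inner]

theorem inner_rsmul_left (x y : P.carrier) (b : B) :
    P.inner (P.rsmul b x) y = star b * P.inner x y := by
  rw [← P.star_inner, P.inner_rsmul_right, star_mul, P.star_inner]

/-- The inner product, additive in both variables. -/
def innerAdd : P.carrier →+ P.carrier →+ B :=
  AddMonoidHom.mk' (fun x => AddMonoidHom.mk' (P.inner x) (P.inner_add_right x))
    (fun x y => by ext z; exact P.inner_add_left x y z)

theorem innerAdd_apply (x y : P.carrier) : P.innerAdd x y = P.inner x y := rfl

theorem inner_sub_left (x y z : P.carrier) : P.inner (x - y) z = P.inner x z - P.inner y z := by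
  simp [← innerAdd_apply]

theorem inner_sub_right (x y z : P.carrier) : P.inner x (y - z) = P.inner x y - P.inner x z := by
  simp [← innerAdd_apply]

/-- The Cauchy-Schwarz inequality. -/
theorem norm_inner_sq_le (x y : P.carrier) :
    ‖P.inner x y‖ ^ 2 ≤ ‖P.inner x x‖ * ‖P.inner y y‖ := by
  set b := P.inner x y with hb
  have hbs : star b = P.inner y x := P.star_inner x y
  have main : ∀ s : ℝ, ‖P.inner x x‖ < s → ‖b‖ ^ 2 ≤ s * ‖P.inner y y‖ := by
    intro s hs
    have hs0 : 0 < s := (norm_nonneg _).trans_lt hs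
    have h1 : 0 ≤ star b * P.inner x x * b - s • (star b * b) - s • (star b * b)
        + s • (s • P.inner y y) := by
      have h := P.inner_self_nonneg (P.rsmul b x - (s : ℂ) • y)
      have e : P.inner (P.rsmul b x - (s : ℂ) • y) (P.rsmul b x - (s : ℂ) • y)
          = star b * P.inner x x * b - s • (star b * b) - s • (star b * b)
            + s • (s • P.inner y y) := by
        simp only [P.inner_sub_left, P.inner_sub_right, P.inner_rsmul_left, P.inner_rsmul_right,
          P.inner_smul_left, P.inner_smul_right, ← hb, ← hbs, mul_assoc, Complex.star_def,
          Complex.conj_ofReal, smul_mul_assoc, mul_smul_comm]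
        simp only [Complex.coe_smul]
        abel
      rwa [e] at h
    have h2 : star b * P.inner x x * b ≤ s • (star b * b) :=
      (CStarAlgebra.star_left_conjugate_le_norm_smul (hb :=
          IsSelfAdjoint.of_nonneg (P.inner_self_nonneg x))).trans
        (smul_le_smul_of_nonneg_right hs.le (star_mul_self_nonneg b))
    have h3 : s • (star b * b) ≤ s • (s • P.inner y y) := by
      have h4 := add_nonneg h1 (sub_nonneg.mpr h2)
      rw [← sub_nonneg]
      convert h4 using 1
      abel
    have h5 : ‖s • (star b * b)‖ ≤ ‖s • (s • P.inner y y)‖ :=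
      CStarAlgebra.norm_le_norm_of_nonneg_of_le
        (smul_nonneg hs0.le (star_mul_self_nonneg b)) h3
    rw [norm_smul, norm_smul, norm_smul, CStarRing.norm_star_mul_self, Real.norm_of_nonneg hs0.le]
      at h5
    rw [sq]
    exact le_of_mul_le_mul_left h5 hs0
  refine le_of_forall_pos_le_add fun ε hε => ?_
  have hM : 0 ≤ ‖P.inner y y‖ := norm_nonneg _
  have hpos : 0 < ‖P.inner y y‖ + 1 := by linarith
  have h := main (‖P.inner x x‖ + ε / (‖P.inner y y‖ + 1))
    (lt_add_of_pos_right _ (div_pos hε hpos))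
  refine h.trans ?_
  rw [add_mul, div_mul_eq_mul_div]
  gcongr
  rw [div_le_iff₀ hpos]
  nlinarith

/-- The seminorm of the inner product. -/
local instance instNorm : Norm P.carrier := ⟨fun x => √‖P.inner x x‖⟩

theorem norm_sq_eq (x : P.carrier) : ‖x‖ ^ 2 = ‖P.inner x x‖ := Real.sq_sqrt (norm_nonneg _)

theorem seminormedSpaceCore : SeminormedSpace.Core ℂ P.carrier where
  norm_nonneg x := Real.sqrt_nonneg _
  norm_smul c x := by
    change √_ = _ * √_
    rw [P.inner_smul_left, P.inner_smul_right, norm_smul, norm_smul, norm_star, ← mul_assoc,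
      Real.sqrt_mul (by positivity), Real.sqrt_mul_self (norm_nonneg _)]
  norm_triangle x y := by
    have hx : 0 ≤ ‖x‖ := Real.sqrt_nonneg _
    have hy : 0 ≤ ‖y‖ := Real.sqrt_nonneg _
    have h0 : 0 ≤ ‖x + y‖ := Real.sqrt_nonneg _
    have hxy : ‖P.inner x y‖ ≤ ‖x‖ * ‖y‖ := by
      refine abs_le_of_sq_le_sq' ?_ (mul_nonneg hx hy) |>.2
      rw [mul_pow, P.norm_sq_eq, P.norm_sq_eq]
      exact P.norm_inner_sq_le x y
    have hyx : ‖P.inner y x‖ ≤ ‖x‖ * ‖y‖ := by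
      rw [← P.star_inner, norm_star]
      exact hxy
    refine abs_le_of_sq_le_sq' ?_ (add_nonneg hx hy) |>.2
    calc ‖x + y‖ ^ 2 = ‖(P.inner x x + P.inner y x) + (P.inner x y + P.inner y y)‖ := by
          rw [P.norm_sq_eq, P.inner_add_right, P.inner_add_left, P.inner_add_left]
      _ ≤ (‖P.inner x x‖ + ‖P.inner y x‖) + (‖P.inner x y‖ + ‖P.inner y y‖) :=
          (norm_add_le _ _).trans (add_le_add (norm_add_le _ _) (norm_add_le _ _))
      _ ≤ (‖x‖ + ‖y‖) ^ 2 := by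
          rw [← P.norm_sq_eq, ← P.norm_sq_eq]
          linarith

instance instSeminormedAddCommGroup : SeminormedAddCommGroup P.carrier :=
  SeminormedAddCommGroup.ofCore P.seminormedSpaceCore

instance instNormedSpace : NormedSpace ℂ P.carrier where
  norm_smul_le c x := (P.seminormedSpaceCore.norm_smul c x).le

theorem norm_inner_le (x y : P.carrier) : ‖P.inner x y‖ ≤ ‖x‖ * ‖y‖ := by
  refine abs_le_of_sq_le_sq' ?_ (mul_nonneg (norm_nonneg _) (norm_nonneg _)) |>.2
  rw [mul_pow, P.norm_sq_eq, P.norm_sq_eq]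
  exact P.norm_inner_sq_le x y

theorem norm_rsmul_le (b : B) (x : P.carrier) : ‖P.rsmul b x‖ ≤ ‖b‖ * ‖x‖ := by
  refine abs_le_of_sq_le_sq' ?_ (mul_nonneg (norm_nonneg _) (norm_nonneg _)) |>.2
  rw [mul_pow, P.norm_sq_eq, P.norm_sq_eq, P.inner_rsmul_left, P.inner_rsmul_right, sq]
  calc _ ≤ ‖star b‖ * (‖P.inner x x‖ * ‖b‖) :=
        (norm_mul_le _ _).trans (by gcongr; exact norm_mul_le _ _)
    _ = _ := by rw [norm_star]; ring

theorem continuous_inner : Continuous fun p : P.carrier × P.carrier => P.inner p.1 p.2 := by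
  rw [continuous_iff_continuousAt]
  rintro ⟨x, y⟩
  rw [ContinuousAt, tendsto_iff_norm_sub_tendsto_zero]
  have hle : ∀ p : P.carrier × P.carrier, ‖P.inner p.1 p.2 - P.inner x y‖
      ≤ ‖p.1‖ * ‖p.2 - y‖ + ‖p.1 - x‖ * ‖y‖ := by
    intro p
    have e : P.inner p.1 p.2 - P.inner x y = P.inner p.1 (p.2 - y) + P.inner (p.1 - x) y := by
      rw [P.inner_sub_left, P.inner_sub_right]
      abel
    rw [e]
    exact (norm_add_le _ _).trans (add_le_add (P.norm_inner_le _ _) (P.norm_inner_le _ _))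
  refine squeeze_zero (fun _ => norm_nonneg _) hle ?_
  have : Continuous fun p : P.carrier × P.carrier => ‖p.1‖ * ‖p.2 - y‖ + ‖p.1 - x‖ * ‖y‖ := by
    fun_prop
  have h := this.tendsto (x, y)
  simpa using h

open UniformSpace

/-- The right action of `b` on the completion. -/
def rsmulCompletion (b : B) : Completion P.carrier →L[ℂ] Completion P.carrier :=
  ((Completion.toComplL (𝕜 := ℂ)).comp
    ((P.rsmul b).mkContinuous ‖b‖ (P.norm_rsmul_le b))).extend (Completion.toComplL (𝕜 := ℂ))

theorem rsmulCompletion_coe (b : B) (x : P.carrier) :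
    P.rsmulCompletion b (x : Completion P.carrier) = (P.rsmul b x : P.carrier) :=
  ContinuousLinearMap.extend_eq (e := Completion.toComplL (𝕜 := ℂ) (E := P.carrier)) _
    Completion.denseRange_coe (Completion.isUniformInducing_coe _) x

/-- The inner product of the completion, the continuous extension of that of `P`. -/
def innerCompletion (x y : Completion P.carrier) : B :=
  ((Completion.isDenseInducing_coe (α := P.carrier)).prodMap
    (Completion.isDenseInducing_coe (α := P.carrier))).extend (fun p => P.inner p.1 p.2) (x, y)

theorem innerCompletion_coe (x y : P.carrier) :
    P.innerCompletion (x : Completion P.carrier) (y : Completion P.carrier) = P.inner x y :=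
  (Completion.isDenseInducing_coe.prodMap Completion.isDenseInducing_coe).extend_eq
    P.continuous_inner (x, y)

theorem continuous_innerCompletion :
    Continuous fun p : Completion P.carrier × Completion P.carrier =>
      P.innerCompletion p.1 p.2 := by
  have : Continuous fun p : P.carrier × P.carrier => P.innerAdd p.1 p.2 := P.continuous_inner
  exact (Completion.isDenseInducing_toCompl P.carrier).extend_Z_bilin
    (Completion.isDenseInducing_toCompl P.carrier) this

/-- The Hilbert module completing (and separating) `P`. -/
def completion : HilbertModule B where
  carrier := Completion P.carrier
  rsmul x b := P.rsmulCompletion b x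
  inner := P.innerCompletion
  inner_add_right x y z := by
    have hc := P.continuous_innerCompletion
    refine Completion.induction_on₃ x y z (isClosed_eq ?_ ?_) fun a b c => ?_
    · exact hc.comp (continuous_fst.prodMk (continuous_snd.fst.add continuous_snd.snd))
    · exact (hc.comp (continuous_fst.prodMk continuous_snd.fst)).add
        (hc.comp (continuous_fst.prodMk continuous_snd.snd))
    · simp only [← Completion.coe_add, innerCompletion_coe, P.inner_add_right]
  inner_smul_right c x y := by
    have hc := P.continuous_innerCompletion
    refine Completion.induction_on₂ x y (isClosed_eq ?_ (hc.const_smul c)) fun a b => ?_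
    · exact hc.comp (continuous_fst.prodMk (continuous_snd.const_smul c))
    · simp only [← Completion.coe_smul, innerCompletion_coe, P.inner_smul_right]
  inner_rsmul_right x y b := by
    have hc := P.continuous_innerCompletion
    refine Completion.induction_on₂ x y (isClosed_eq ?_ ?_) fun a c => ?_
    · exact hc.comp (continuous_fst.prodMk ((P.rsmulCompletion b).continuous.comp continuous_snd))
    · exact hc.mul continuous_const
    · simp only [rsmulCompletion_coe, innerCompletion_coe, P.inner_rsmul_right]
  star_inner x y := by
    have hc := P.continuous_innerCompletion
    refine Completion.induction_on₂ x y (isClosed_eq hc.star ?_) fun a b => ?_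
    · exact hc.comp (continuous_snd.prodMk continuous_fst)
    · simp only [innerCompletion_coe, P.star_inner]
  inner_self_nonneg x := by
    have hc := P.continuous_innerCompletion
    refine Completion.induction_on x ?_ fun a => ?_
    · exact CStarAlgebra.isClosed_nonneg.preimage (hc.comp (continuous_id.prodMk continuous_id))
    · rw [innerCompletion_coe]
      exact P.inner_self_nonneg a
  norm_sq_eq x := by
    have hc := P.continuous_innerCompletion
    refine Completion.induction_on x (isClosed_eq (by fun_prop) ?_) fun a => ?_
    · exact (hc.comp (continuous_id.prodMk continuous_id)).norm
    · rw [innerCompletion_coe, Completion.norm_coe, P.norm_sq_eq]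

end PreHilbertModule

/-! ### Adjointable operators -/

namespace HilbertModule

variable {B : Type u} [NonUnitalCStarAlgebra B] (E F G : HilbertModule B)

theorem ext_inner {x y : E.carrier} (h : ∀ z, E.inner z x = E.inner z y) : x = y := by
  have h0 : E.inner (x - y) (x - y) = 0 := by
    have e : E.inner (x - y) x = E.inner (x - y) (x - y) + E.inner (x - y) y := by
      rw [← E.inner_add_right, sub_add_cancel]
    rw [h (x - y)] at e
    exact left_eq_add.mp (by rw [add_comm]; exact e)
  have h1 := E.norm_sq_eq (x - y)
  rw [h0, norm_zero, sq_eq_zero_iff, norm_eq_zero, sub_eq_zero] at h1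
  exact h1

theorem rsmul_add (x y : E.carrier) (b : B) :
    E.rsmul (x + y) b = E.rsmul x b + E.rsmul y b := by
  refine E.ext_inner fun z => ?_
  rw [E.inner_rsmul_right, E.inner_add_right, E.inner_add_right, E.inner_rsmul_right,
    E.inner_rsmul_right, add_mul]

theorem rsmul_smul (c : ℂ) (x : E.carrier) (b : B) : E.rsmul (c • x) b = c • E.rsmul x b := by
  refine E.ext_inner fun z => ?_
  rw [E.inner_rsmul_right, E.inner_smul_right, E.inner_smul_right, E.inner_rsmul_right,
    smul_mul_assoc]

/-- The right action of `b` as a linear map. -/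
def rsmulₗ (b : B) : E.carrier →ₗ[ℂ] E.carrier where
  toFun x := E.rsmul x b
  map_add' x y := E.rsmul_add x y b
  map_smul' c x := E.rsmul_smul c x b

/-- Forgetting the norm of a Hilbert module. -/
def toPre : PreHilbertModule B where
  carrier := E.carrier
  rsmul := E.rsmulₗ
  inner := E.inner
  inner_add_right := E.inner_add_right
  inner_smul_right := E.inner_smul_right
  inner_rsmul_right := E.inner_rsmul_right
  star_inner := E.star_inner
  inner_self_nonneg := E.inner_self_nonneg

theorem inner_add_left (x y z : E.carrier) : E.inner (x + y) z = E.inner x z + E.inner y z :=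
  E.toPre.inner_add_left x y z

theorem inner_smul_left (c : ℂ) (x y : E.carrier) : E.inner (c • x) y = star c • E.inner x y :=
  E.toPre.inner_smul_left c x y

theorem inner_rsmul_left (x y : E.carrier) (b : B) :
    E.inner (E.rsmul x b) y = star b * E.inner x y :=
  E.toPre.inner_rsmul_left x y b

/-- The inner product with `x`, as a linear map. -/
def innerₗ (x : E.carrier) : E.carrier →ₗ[ℂ] B where
  toFun y := E.inner x y
  map_add' := E.inner_add_right x
  map_smul' c := E.inner_smul_right c x

theorem inner_zero_right (x : E.carrier) : E.inner x 0 = 0 := (E.innerₗ x).map_zero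

theorem inner_zero_left (x : E.carrier) : E.inner 0 x = 0 := by
  rw [← E.star_inner, E.inner_zero_right, star_zero]

theorem inner_sum_right {ι : Type*} (s : Finset ι) (x : E.carrier) (f : ι → E.carrier) :
    E.inner x (∑ i ∈ s, f i) = ∑ i ∈ s, E.inner x (f i) :=
  map_sum (E.innerₗ x) f s

theorem inner_sum_left {ι : Type*} (s : Finset ι) (f : ι → E.carrier) (x : E.carrier) :
    E.inner (∑ i ∈ s, f i) x = ∑ i ∈ s, E.inner (f i) x := by
  rw [← E.star_inner, E.inner_sum_right, star_sum]
  exact Finset.sum_congr rfl fun i _ => E.star_inner _ _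

theorem norm_inner_le (x y : E.carrier) : ‖E.inner x y‖ ≤ ‖x‖ * ‖y‖ := by
  refine abs_le_of_sq_le_sq' ?_ (mul_nonneg (norm_nonneg _) (norm_nonneg _)) |>.2
  rw [mul_pow, E.norm_sq_eq, E.norm_sq_eq]
  exact E.toPre.norm_inner_sq_le x y

theorem norm_rsmul_le (x : E.carrier) (b : B) : ‖E.rsmul x b‖ ≤ ‖x‖ * ‖b‖ := by
  refine abs_le_of_sq_le_sq' ?_ (mul_nonneg (norm_nonneg _) (norm_nonneg _)) |>.2
  rw [mul_pow, E.norm_sq_eq, E.norm_sq_eq, E.inner_rsmul_left, E.inner_rsmul_right, sq]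
  calc _ ≤ ‖star b‖ * (‖E.inner x x‖ * ‖b‖) :=
        (norm_mul_le _ _).trans (by gcongr; exact norm_mul_le _ _)
    _ = _ := by rw [norm_star]; ring

/-- The inner product with `x`, as a bounded operator. -/
def innerL (x : E.carrier) : E.carrier →L[ℂ] B :=
  (E.innerₗ x).mkContinuous ‖x‖ (E.norm_inner_le x)

theorem continuous_inner : Continuous fun p : E.carrier × E.carrier => E.inner p.1 p.2 := by
  rw [continuous_iff_continuousAt]
  rintro ⟨x, y⟩
  rw [ContinuousAt, tendsto_iff_norm_sub_tendsto_zero]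
  have hle : ∀ p : E.carrier × E.carrier, ‖E.inner p.1 p.2 - E.inner x y‖
      ≤ ‖p.1‖ * ‖p.2 - y‖ + ‖p.1 - x‖ * ‖y‖ := by
    intro p
    have e : E.inner p.1 p.2 - E.inner x y = E.inner p.1 (p.2 - y) + E.inner (p.1 - x) y := by
      have e1 := E.inner_add_right p.1 (p.2 - y) y
      have e2 := E.inner_add_left (p.1 - x) x y
      rw [sub_add_cancel] at e1 e2
      rw [e1, e2]
      abel
    rw [e]
    exact (norm_add_le _ _).trans (add_le_add (E.norm_inner_le _ _) (E.norm_inner_le _ _))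
  refine squeeze_zero (fun _ => norm_nonneg _) hle ?_
  have : Continuous fun p : E.carrier × E.carrier => ‖p.1‖ * ‖p.2 - y‖ + ‖p.1 - x‖ * ‖y‖ := by
    fun_prop
  have h := this.tendsto (x, y)
  simpa using h

variable {E F G}

/-- `S` is an adjoint of `T`. -/
def IsAdjoint (T : E.carrier →L[ℂ] F.carrier) (S : F.carrier →L[ℂ] E.carrier) : Prop :=
  ∀ x y, E.inner (S y) x = F.inner y (T x)

theorem IsAdjoint.symm {T : E.carrier →L[ℂ] F.carrier} {S : F.carrier →L[ℂ] E.carrier}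
    (h : IsAdjoint T S) : IsAdjoint S T := fun y x => by
  rw [← F.star_inner, ← h, E.star_inner]

theorem IsAdjoint.comp {T : E.carrier →L[ℂ] F.carrier} {S : F.carrier →L[ℂ] E.carrier}
    {T' : F.carrier →L[ℂ] G.carrier} {S' : G.carrier →L[ℂ] F.carrier}
    (h' : IsAdjoint T' S') (h : IsAdjoint T S) : IsAdjoint (T'.comp T) (S.comp S') := fun x y => by
  simp only [ContinuousLinearMap.comp_apply]
  rw [h, h']

theorem IsAdjoint.unique {T : E.carrier →L[ℂ] F.carrier} {S S' : F.carrier →L[ℂ] E.carrier}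
    (h : IsAdjoint T S) (h' : IsAdjoint T S') : S = S' := by
  ext y
  refine E.ext_inner fun z => ?_
  rw [← E.star_inner, h, ← h', E.star_inner]

theorem IsAdjoint.norm_le {T : E.carrier →L[ℂ] F.carrier} {S : F.carrier →L[ℂ] E.carrier}
    (h : IsAdjoint T S) : ‖S‖ ≤ ‖T‖ := by
  refine S.opNorm_le_bound (norm_nonneg _) fun y => ?_
  have h1 : ‖S y‖ * ‖S y‖ ≤ ‖T‖ * ‖y‖ * ‖S y‖ := by
    rw [← sq, E.norm_sq_eq, h]
    calc _ ≤ ‖y‖ * ‖T (S y)‖ := F.norm_inner_le _ _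
      _ ≤ ‖y‖ * (‖T‖ * ‖S y‖) := by gcongr; exact T.le_opNorm _
      _ = _ := by ring
  rcases (norm_nonneg (S y)).eq_or_lt with h0 | h0
  · rw [← h0]
    positivity
  · exact le_of_mul_le_mul_right h1 h0

theorem IsAdjoint.norm_eq {T : E.carrier →L[ℂ] F.carrier} {S : F.carrier →L[ℂ] E.carrier}
    (h : IsAdjoint T S) : ‖S‖ = ‖T‖ :=
  le_antisymm h.norm_le h.symm.norm_le

variable (E)

/-- The algebra of adjointable operators on `E`, with the operator norm. -/
def adjointable : Subalgebra ℂ (E.carrier →L[ℂ] E.carrier) where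
  carrier := {T | ∃ S : E.carrier →L[ℂ] E.carrier, IsAdjoint T S}
  mul_mem' := by
    rintro T T' ⟨S, h⟩ ⟨S', h'⟩
    exact ⟨S'.comp S, h.comp h'⟩
  add_mem' := by
    rintro T T' ⟨S, h⟩ ⟨S', h'⟩
    refine ⟨S + S', fun x y => ?_⟩
    simp only [add_apply]
    rw [E.inner_add_left, E.inner_add_right, h, h']
  algebraMap_mem' c := by
    refine ⟨algebraMap ℂ _ (star c), fun x y => ?_⟩
    simp only [ContinuousLinearMap.algebraMap_apply]
    rw [E.inner_smul_left, E.inner_smul_right, star_star]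

/-- The C*-algebra of adjointable operators on `E`. -/
abbrev Adjointable : Type u := ↥E.adjointable

variable {E}

/-- An adjointable operator from an operator and its adjoint. -/
def IsAdjoint.op {T S : E.carrier →L[ℂ] E.carrier} (h : IsAdjoint T S) : E.Adjointable :=
  ⟨T, S, h⟩

instance : Star E.Adjointable :=
  ⟨fun T => ⟨T.2.choose, T.1, T.2.choose_spec.symm⟩⟩

theorem isAdjoint_star (T : E.Adjointable) : IsAdjoint T.1 (star T).1 := T.2.choose_spec

theorem star_eq_of_isAdjoint {T S : E.Adjointable} (h : IsAdjoint T.1 S.1) : star T = S :=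
  Subtype.ext ((isAdjoint_star T).unique h)

theorem inner_star_left (T : E.Adjointable) (x y : E.carrier) :
    E.inner ((star T).1 y) x = E.inner y (T.1 x) := isAdjoint_star T x y

instance : StarRing E.Adjointable where
  star_involutive T := star_eq_of_isAdjoint (isAdjoint_star T).symm
  star_mul T T' := star_eq_of_isAdjoint ((isAdjoint_star T).comp (isAdjoint_star T'))
  star_add T T' := star_eq_of_isAdjoint fun x y => by
    change E.inner ((star T).1 y + (star T').1 y) x = E.inner y (T.1 x + T'.1 x)
    rw [E.inner_add_left, E.inner_add_right, inner_star_left, inner_star_left]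

instance : StarModule ℂ E.Adjointable where
  star_smul c T := star_eq_of_isAdjoint fun x y => by
    change E.inner (star c • (star T).1 y) x = E.inner y (c • T.1 x)
    rw [E.inner_smul_left, E.inner_smul_right, star_star, inner_star_left]

theorem norm_star_adjointable (T : E.Adjointable) : ‖star T‖ = ‖T‖ := (isAdjoint_star T).norm_eq

instance : CStarRing E.Adjointable where
  norm_mul_self_le T := by
    have h : ‖T‖ ≤ √‖star T * T‖ := by
      refine T.1.opNorm_le_bound (Real.sqrt_nonneg _) fun x => ?_
      refine abs_le_of_sq_le_sq' ?_ (by positivity) |>.2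
      rw [mul_pow, Real.sq_sqrt (norm_nonneg (star T * T)), E.norm_sq_eq, ← inner_star_left]
      calc _ ≤ ‖(star T).1 (T.1 x)‖ * ‖x‖ := E.norm_inner_le _ _
        _ = ‖(star T * T).1 x‖ * ‖x‖ := rfl
        _ ≤ (‖(star T * T).1‖ * ‖x‖) * ‖x‖ := by
            gcongr
            exact ContinuousLinearMap.le_opNorm _ _
        _ = _ := by rw [sq, mul_assoc]; rfl
    calc ‖T‖ * ‖T‖ ≤ √‖star T * T‖ * √‖star T * T‖ := by gcongr
      _ = _ := Real.mul_self_sqrt (norm_nonneg _)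

theorem isClosed_adjointable : IsClosed (E.adjointable : Set (E.carrier →L[ℂ] E.carrier)) := by
  rw [← isSeqClosed_iff_isClosed]
  intro T T₀ hT hlim
  let T' : ℕ → E.Adjointable := fun n => ⟨T n, hT n⟩
  have hc : CauchySeq fun n => (star (T' n)).1 := by
    have h1 : CauchySeq T := hlim.cauchySeq
    rw [Metric.cauchySeq_iff] at h1 ⊢
    intro ε hε
    obtain ⟨N, hN⟩ := h1 ε hε
    refine ⟨N, fun m hm n hn => ?_⟩
    have e : dist (star (T' m)).1 (star (T' n)).1 = dist (T m) (T n) := by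
      rw [dist_eq_norm, dist_eq_norm]
      have e2 : star (T' m) - star (T' n) = star (T' m - T' n) := (star_sub _ _).symm
      calc ‖(star (T' m)).1 - (star (T' n)).1‖ = ‖star (T' m) - star (T' n)‖ := rfl
        _ = ‖T' m - T' n‖ := by rw [e2, norm_star_adjointable]
        _ = _ := rfl
    rw [e]
    exact hN m hm n hn
  obtain ⟨S, hS⟩ := cauchySeq_tendsto_of_complete hc
  refine ⟨S, fun x y => ?_⟩
  have hx : Filter.Tendsto (fun n => T n x) Filter.atTop (nhds (T₀ x)) :=
    ((ContinuousLinearMap.apply ℂ E.carrier x).continuous.tendsto T₀).comp hlim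
  have hy : Filter.Tendsto (fun n => (star (T' n)).1 y) Filter.atTop (nhds (S y)) :=
    ((ContinuousLinearMap.apply ℂ E.carrier y).continuous.tendsto S).comp hS
  have h1 := (E.continuous_inner.tendsto (S y, x)).comp (hy.prodMk_nhds tendsto_const_nhds)
  have h2 := (E.continuous_inner.tendsto (y, T₀ x)).comp
    ((tendsto_const_nhds (x := y)).prodMk_nhds hx)
  refine tendsto_nhds_unique h1 (h2.congr fun n => ?_)
  exact (inner_star_left (T' n) x y).symm

instance : CompleteSpace E.Adjointable := isClosed_adjointable.completeSpace_coe

instance : CStarAlgebra E.Adjointable where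

theorem inner_self_le_of_isAdjoint {T : E.carrier →L[ℂ] F.carrier}
    {S : F.carrier →L[ℂ] E.carrier} (h : IsAdjoint T S) (x : E.carrier) :
    F.inner (T x) (T x) ≤ (‖T‖ ^ 2) • E.inner x x := by
  have hR : IsAdjoint (S.comp T) (S.comp T) := h.symm.comp h
  have hRsa : IsSelfAdjoint hR.op := star_eq_of_isAdjoint hR
  have h0 : 0 ≤ algebraMap ℝ E.Adjointable ‖hR.op‖ - hR.op :=
    sub_nonneg.mpr hRsa.le_algebraMap_norm_self
  obtain ⟨c, hc⟩ := CStarAlgebra.nonneg_iff_eq_star_mul_self.mp h0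
  have h1 : 0 ≤ E.inner x ((algebraMap ℝ E.Adjointable ‖hR.op‖ - hR.op).1 x) := by
    rw [hc]
    change 0 ≤ E.inner x ((star c).1 (c.1 x))
    rw [← E.star_inner, inner_star_left, E.star_inner]
    exact E.inner_self_nonneg _
  have h2 : (algebraMap ℝ E.Adjointable ‖hR.op‖ - hR.op).1 x
      = ((‖hR.op‖ : ℝ) : ℂ) • x - S (T x) := by
    rfl
  have h3 : ‖hR.op‖ ≤ ‖T‖ ^ 2 := by
    calc ‖hR.op‖ = ‖S.comp T‖ := rfl
      _ ≤ ‖S‖ * ‖T‖ := ContinuousLinearMap.opNorm_comp_le _ _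
      _ = _ := by rw [h.norm_eq, sq]
  have h4 : E.inner x (S (T x)) = F.inner (T x) (T x) := by
    rw [← E.star_inner, h, F.star_inner]
  have h5 : E.inner x (((‖hR.op‖ : ℝ) : ℂ) • x - S (T x))
      = ‖hR.op‖ • E.inner x x - F.inner (T x) (T x) := by
    rw [← h4]
    have := E.toPre.inner_sub_right x (((‖hR.op‖ : ℝ) : ℂ) • x) (S (T x))
    refine this.trans ?_
    congr 1
    exact (E.inner_smul_right _ x x).trans (Complex.coe_smul _ _)
  rw [h2, h5] at h1
  exact (sub_nonneg.mp h1).trans (smul_le_smul_of_nonneg_right h3 (E.inner_self_nonneg x))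

end HilbertModule

/-! ### Operators on completions -/

namespace PreHilbertModule

variable {B : Type u} [NonUnitalCStarAlgebra B] (P : PreHilbertModule B)

/-- The canonical map of `P` to its completion. -/
def toCompletion : P.carrier →L[ℂ] P.completion.carrier :=
  UniformSpace.Completion.toComplL (𝕜 := ℂ)

theorem inner_toCompletion (x y : P.carrier) :
    P.completion.inner (P.toCompletion x) (P.toCompletion y) = P.inner x y :=
  P.innerCompletion_coe x y

theorem rsmul_toCompletion (x : P.carrier) (b : B) :
    P.completion.rsmul (P.toCompletion x) b = P.toCompletion (P.rsmul b x) :=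
  P.rsmulCompletion_coe b x

theorem denseRange_toCompletion : DenseRange P.toCompletion :=
  UniformSpace.Completion.denseRange_coe

theorem isUniformInducing_toCompletion : IsUniformInducing P.toCompletion :=
  UniformSpace.Completion.isUniformInducing_coe _

/-- The continuous extension of a bounded operator to the completion. -/
def extend {F : Type*} [NormedAddCommGroup F] [NormedSpace ℂ F] [CompleteSpace F]
    (f : P.carrier →L[ℂ] F) : P.completion.carrier →L[ℂ] F :=
  f.extend P.toCompletion

theorem extend_toCompletion {F : Type*} [NormedAddCommGroup F] [NormedSpace ℂ F] [CompleteSpace F]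
    (f : P.carrier →L[ℂ] F) (x : P.carrier) : P.extend f (P.toCompletion x) = f x :=
  ContinuousLinearMap.extend_eq _ P.denseRange_toCompletion P.isUniformInducing_toCompletion x

theorem ext_completion {F : Type*} [NormedAddCommGroup F] [NormedSpace ℂ F]
    {f g : P.completion.carrier →L[ℂ] F}
    (h : ∀ x, f (P.toCompletion x) = g (P.toCompletion x)) : f = g :=
  ContinuousLinearMap.coeFn_injective
    (P.denseRange_toCompletion.equalizer f.continuous g.continuous (funext h))

theorem isAdjoint_of_dense {F : HilbertModule B} {T : P.completion.carrier →L[ℂ] F.carrier}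
    {S : F.carrier →L[ℂ] P.completion.carrier}
    (h : ∀ x y, P.completion.inner (S y) (P.toCompletion x) = F.inner y (T (P.toCompletion x))) :
    HilbertModule.IsAdjoint T S := fun x y => by
  have hc : IsClosed {x | P.completion.inner (S y) x = F.inner y (T x)} :=
    isClosed_eq (P.completion.continuous_inner.comp (continuous_const.prodMk continuous_id))
      (F.continuous_inner.comp (continuous_const.prodMk T.continuous))
  have hs : Set.range P.toCompletion ⊆ {x | P.completion.inner (S y) x = F.inner y (T x)} := by
    rintro _ ⟨x, rfl⟩
    exact h x y
  exact (hc.closure_subset_iff.mpr hs) (P.denseRange_toCompletion x)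

theorem isAdjoint_of_dense₂ {Q : PreHilbertModule B}
    {T : P.completion.carrier →L[ℂ] Q.completion.carrier}
    {S : Q.completion.carrier →L[ℂ] P.completion.carrier}
    (h : ∀ x y, P.completion.inner (S (Q.toCompletion y)) (P.toCompletion x)
      = Q.completion.inner (Q.toCompletion y) (T (P.toCompletion x))) :
    HilbertModule.IsAdjoint T S := by
  refine P.isAdjoint_of_dense fun x y => ?_
  have hc : IsClosed {y | P.completion.inner (S y) (P.toCompletion x)
      = Q.completion.inner y (T (P.toCompletion x))} :=
    isClosed_eq (P.completion.continuous_inner.comp (S.continuous.prodMk continuous_const))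
      (Q.completion.continuous_inner.comp (continuous_id.prodMk continuous_const))
  have hs : Set.range Q.toCompletion ⊆ {y | P.completion.inner (S y) (P.toCompletion x)
      = Q.completion.inner y (T (P.toCompletion x))} := by
    rintro _ ⟨y, rfl⟩
    exact h x y
  exact (hc.closure_subset_iff.mpr hs) (Q.denseRange_toCompletion y)

end PreHilbertModule

/-! ### Correspondences and interior tensor products -/

/-- The `*`-homomorphisms of `B` to the adjointable operators on `E`. -/
abbrev HilbertModule.LeftAction {B : Type u} [NonUnitalCStarAlgebra B] (E : HilbertModule B) :
    Type u :=
  B →⋆ₙₐ[ℂ] E.Adjointable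

/-- A Hilbert C*-module `E` over `B` with a `*`-homomorphism `φ` of `B` to the adjointable
operators on `E`. -/
structure Correspondence (B : Type u) [NonUnitalCStarAlgebra B] extends HilbertModule B where
  φ : toHilbertModule.LeftAction

namespace HilbertModule

variable {B : Type u} [NonUnitalCStarAlgebra B] (E : HilbertModule B)

/-- A `*`-homomorphism to the adjointable operators from its action on vectors. -/
def mkAction (l : B → E.carrier →L[ℂ] E.carrier)
    (hadd : ∀ a b x, l (a + b) x = l a x + l b x) (hsmul : ∀ (c : ℂ) a x, l (c • a) x = c • l a x)
    (hmul : ∀ a b x, l (a * b) x = l a (l b x)) (hstar : ∀ a, IsAdjoint (l a) (l (star a))) :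
    B →⋆ₙₐ[ℂ] E.Adjointable where
  toFun a := (hstar a).op
  map_smul' c a := Subtype.ext (ContinuousLinearMap.ext (hsmul c a))
  map_zero' := Subtype.ext (ContinuousLinearMap.ext fun x => by
    have := hsmul 0 0 x
    rw [zero_smul, zero_smul] at this
    exact this)
  map_add' a b := Subtype.ext (ContinuousLinearMap.ext (hadd a b))
  map_mul' a b := Subtype.ext (ContinuousLinearMap.ext (hmul a b))
  map_star' a := (star_eq_of_isAdjoint (T := (hstar a).op) (S := (hstar (star a)).op)
    (hstar a)).symm

end HilbertModule

/-- `B` as a Hilbert module over itself, with inner product `star x * y` and left multiplication. -/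
def Correspondence.self (B : Type u) [NonUnitalCStarAlgebra B] : Correspondence B :=
  let E : HilbertModule B :=
    { carrier := B
      rsmul := fun x b => x * b
      inner := fun x y => star x * y
      inner_add_right := fun x y z => mul_add _ _ _
      inner_smul_right := fun c x y => mul_smul_comm _ _ _
      inner_rsmul_right := fun x y b => (mul_assoc _ _ _).symm
      star_inner := fun x y => by rw [star_mul, star_star]
      inner_self_nonneg := fun x => star_mul_self_nonneg x
      norm_sq_eq := fun x => by rw [CStarRing.norm_star_mul_self, sq] }
  { toHilbertModule := E
    φ := E.mkAction (fun b => ContinuousLinearMap.mul ℂ B b) (fun a b x => add_mul a b x)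
      (fun c a x => smul_mul_assoc c a x) (fun a b x => mul_assoc a b x)
      (fun a x y => by
        change star (star a * y) * x = star y * (a * x)
        rw [star_mul, star_star, mul_assoc]) }

namespace Correspondence

open HilbertModule

variable {B : Type u} [NonUnitalCStarAlgebra B]

section Tensor

variable (E : HilbertModule B) (X : Correspondence B)

/-- The left action of `B` on `X` as a bilinear map. -/
def actₗ : B →ₗ[ℂ] X.carrier →ₗ[ℂ] X.carrier where
  toFun b := (X.φ b).1.toLinearMap
  map_add' a b := by rw [map_add]; rfl
  map_smul' c a := by rw [map_smul]; rfl

theorem inner_act_left (b : B) (x y : X.carrier) :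
    X.inner (X.actₗ b x) y = X.inner x (X.actₗ (star b) y) := by
  change X.inner ((X.φ b).1 x) y = X.inner x ((X.φ (star b)).1 y)
  rw [map_star, ← inner_star_left, star_star]

theorem actₗ_mul (a b : B) (x : X.carrier) : X.actₗ (a * b) x = X.actₗ a (X.actₗ b x) := by
  change (X.φ (a * b)).1 x = (X.φ a).1 ((X.φ b).1 x)
  rw [map_mul]
  rfl

/-- The map `ξ₁ ⊗ η ↦ φ(⟨ξ, ξ₁⟩) η` on the algebraic tensor product. -/
def annih (ξ : E.carrier) : E.carrier ⊗[ℂ] X.carrier →ₗ[ℂ] X.carrier :=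
  TensorProduct.lift (X.actₗ ∘ₗ E.innerₗ ξ)

/-- The `B`-valued inner product of the algebraic tensor product, with
`⟨ξ₁ ⊗ η₁, ξ₂ ⊗ η₂⟩ = ⟨η₁, φ(⟨ξ₁, ξ₂⟩) η₂⟩`. -/
def tensorInner :
    E.carrier ⊗[ℂ] X.carrier →ₗ⋆[ℂ] E.carrier ⊗[ℂ] X.carrier →ₗ[ℂ] B :=
  TensorProduct.lift (LinearMap.mk₂'ₛₗ (starRingEnd ℂ) (starRingEnd ℂ)
    (fun ξ η => X.innerₗ η ∘ₗ annih E X ξ)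
    (fun ξ ξ' η => by
      ext x y
      change X.inner η (X.actₗ (E.inner (ξ + ξ') x) y) = X.inner η (X.actₗ (E.inner ξ x) y)
        + X.inner η (X.actₗ (E.inner ξ' x) y)
      rw [E.inner_add_left, map_add, LinearMap.add_apply, X.inner_add_right])
    (fun c ξ η => by
      ext x y
      change X.inner η (X.actₗ (E.inner (c • ξ) x) y)
        = star c • X.inner η (X.actₗ (E.inner ξ x) y)
      rw [E.inner_smul_left, map_smul, LinearMap.smul_apply, X.inner_smul_right])
    (fun ξ η η' => by
      ext x y
      change X.inner (η + η') (X.actₗ (E.inner ξ x) y) = _ + _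
      rw [X.inner_add_left]
      rfl)
    (fun c ξ η => by
      ext x y
      change X.inner (c • η) (X.actₗ (E.inner ξ x) y) = _
      rw [X.inner_smul_left]
      rfl))

theorem tensorInner_tmul (ξ : E.carrier) (η : X.carrier) (ζ : E.carrier ⊗[ℂ] X.carrier) :
    tensorInner E X (ξ ⊗ₜ η) ζ = X.inner η (annih E X ξ ζ) := rfl

theorem tensorInner_tmul_tmul (ξ ξ' : E.carrier) (η η' : X.carrier) :
    tensorInner E X (ξ ⊗ₜ η) (ξ' ⊗ₜ η') = X.inner η (X.actₗ (E.inner ξ ξ') η') := rfl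

theorem star_tensorInner (ζ ζ' : E.carrier ⊗[ℂ] X.carrier) :
    star (tensorInner E X ζ ζ') = tensorInner E X ζ' ζ := by
  induction ζ with
  | zero => simp
  | add a b ha hb => simp [ha, hb]
  | tmul ξ η =>
    induction ζ' with
    | zero => simp
    | add a b ha hb => simp [ha, hb]
    | tmul ξ' η' =>
      rw [tensorInner_tmul_tmul, tensorInner_tmul_tmul, X.star_inner, inner_act_left,
        E.star_inner]

theorem tensorInner_self_nonneg (ζ : E.carrier ⊗[ℂ] X.carrier) : 0 ≤ tensorInner E X ζ ζ := by
  classical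
  obtain ⟨s, rfl⟩ := TensorProduct.exists_finset ζ
  let G : CStarMatrix s s B := CStarMatrix.ofMatrix (fun i j => E.inner i.1.1 j.1.1)
  have hGsa : IsSelfAdjoint G := by
    ext i j
    exact E.star_inner _ _
  obtain ⟨C, hC⟩ := exists_eq_star_mul_self_of_conj G hGsa fun N j => by
    have e : (star N * G * N) j j = E.inner (∑ i, E.rsmul i.1.1 (N i j))
        (∑ i, E.rsmul i.1.1 (N i j)) := by
      rw [E.inner_sum_right, CStarMatrix.mul_apply]
      refine Finset.sum_congr rfl fun i _ => ?_
      rw [E.inner_rsmul_right, E.inner_sum_left, CStarMatrix.mul_apply]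
      congr 1
      refine Finset.sum_congr rfl fun k _ => ?_
      rw [E.inner_rsmul_left]
      rfl
    rw [e]
    exact E.inner_self_nonneg _
  have hG : ∀ i j : s, E.inner i.1.1 j.1.1 = ∑ k, star (C k i) * C k j := fun i j => by
    have := congrArg (fun M : CStarMatrix s s B => M i j) hC
    exact this.trans (by rw [CStarMatrix.mul_apply]; rfl)
  have e : tensorInner E X (∑ i ∈ s, i.1 ⊗ₜ[ℂ] i.2) (∑ i ∈ s, i.1 ⊗ₜ[ℂ] i.2)
      = ∑ k, X.inner (∑ i : s, X.actₗ (C k i) i.1.2) (∑ i : s, X.actₗ (C k i) i.1.2) := by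
    calc _ = ∑ i : s, ∑ j : s, tensorInner E X (i.1.1 ⊗ₜ i.1.2) (j.1.1 ⊗ₜ j.1.2) := by
          rw [← Finset.sum_coe_sort s fun i => i.1 ⊗ₜ[ℂ] i.2, map_sum, Finset.sum_comm]
          refine Finset.sum_congr rfl fun j _ => ?_
          rw [map_sum]
          exact LinearMap.sum_apply _ _ _
      _ = ∑ i : s, ∑ j : s, ∑ k, X.inner (X.actₗ (C k i) i.1.2) (X.actₗ (C k j) j.1.2) := by
          refine Finset.sum_congr rfl fun i _ => Finset.sum_congr rfl fun j _ => ?_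
          rw [tensorInner_tmul_tmul, hG, map_sum]
          refine (congrArg (X.inner i.1.2) (LinearMap.sum_apply _ _ _)).trans ?_
          rw [X.inner_sum_right]
          refine Finset.sum_congr rfl fun k _ => ?_
          rw [inner_act_left, ← actₗ_mul]
      _ = _ := by
          simp_rw [X.inner_sum_left, X.inner_sum_right]
          exact (Finset.sum_congr rfl fun i _ => Finset.sum_comm).trans Finset.sum_comm
  rw [e]
  exact Finset.sum_nonneg fun k _ => X.inner_self_nonneg _

/-- The algebraic tensor product of `E` and `X` with its semidefinite inner product and the right
action `(ξ ⊗ η) b = ξ ⊗ (η b)`. -/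
def preTensor : PreHilbertModule B where
  carrier := E.carrier ⊗[ℂ] X.carrier
  rsmul b := LinearMap.lTensor E.carrier (X.rsmulₗ b)
  inner ζ ζ' := tensorInner E X ζ ζ'
  inner_add_right ζ := map_add (tensorInner E X ζ)
  inner_smul_right c ζ := map_smul (tensorInner E X ζ) c
  inner_rsmul_right ζ ζ' b := by
    induction ζ with
    | zero => simp
    | add ζ₁ ζ₂ h₁ h₂ => rw [map_add, LinearMap.add_apply, h₁, h₂, LinearMap.add_apply, add_mul]
    | tmul ξ η =>
      induction ζ' with
      | zero => simp
      | add a c ha hc => rw [map_add, map_add, ha, hc, map_add, add_mul]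
      | tmul ξ' η' =>
        rw [LinearMap.lTensor_tmul, tensorInner_tmul_tmul, tensorInner_tmul_tmul]
        change X.inner η (X.actₗ (E.inner ξ ξ') (X.rsmul η' b)) = _
        have := inner_act_left X (star (E.inner ξ ξ')) η (X.rsmul η' b)
        rw [star_star] at this
        rw [← this, X.inner_rsmul_right, inner_act_left, star_star]
  star_inner := star_tensorInner E X
  inner_self_nonneg := tensorInner_self_nonneg E X

/-- The interior tensor product `E ⊗_φ X` as a Hilbert module. -/
abbrev tensorModule : HilbertModule B := (preTensor E X).completion

/-- The elementary tensor `ξ ⊗ η`. -/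
def tmul (ξ : E.carrier) (η : X.carrier) : (tensorModule E X).carrier :=
  (preTensor E X).toCompletion (ξ ⊗ₜ[ℂ] η : E.carrier ⊗[ℂ] X.carrier)

theorem inner_tmul (ξ ξ' : E.carrier) (η η' : X.carrier) :
    (tensorModule E X).inner (tmul E X ξ η) (tmul E X ξ' η')
      = X.inner η ((X.φ (E.inner ξ ξ')).1 η') :=
  (preTensor E X).inner_toCompletion _ _

theorem tensorInner_rTensor (T : E.Adjointable) (ζ ζ' : E.carrier ⊗[ℂ] X.carrier) :
    tensorInner E X (LinearMap.rTensor X.carrier (star T).1.toLinearMap ζ) ζ'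
      = tensorInner E X ζ (LinearMap.rTensor X.carrier T.1.toLinearMap ζ') := by
  induction ζ with
  | zero => simp
  | add a b ha hb => simp only [map_add, LinearMap.add_apply, ha, hb]
  | tmul ξ η =>
    induction ζ' with
    | zero => simp
    | add a b ha hb => simp only [map_add, ha, hb]
    | tmul ξ' η' =>
      rw [LinearMap.rTensor_tmul, LinearMap.rTensor_tmul, tensorInner_tmul_tmul,
        tensorInner_tmul_tmul]
      exact congrArg (fun b => X.inner η (X.actₗ b η')) (inner_star_left T ξ' ξ)

theorem norm_tensorInner_rTensor_le (T : E.Adjointable) (ζ : E.carrier ⊗[ℂ] X.carrier) :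
    ‖tensorInner E X (LinearMap.rTensor X.carrier T.1.toLinearMap ζ)
      (LinearMap.rTensor X.carrier T.1.toLinearMap ζ)‖ ≤ ‖T‖ ^ 2 * ‖tensorInner E X ζ ζ‖ := by
  have hsa : IsSelfAdjoint (star T * T) := IsSelfAdjoint.star_mul_self T
  have h0 : 0 ≤ algebraMap ℝ E.Adjointable ‖star T * T‖ - star T * T :=
    sub_nonneg.mpr hsa.le_algebraMap_norm_self
  obtain ⟨c, hc⟩ := CStarAlgebra.nonneg_iff_eq_star_mul_self.mp h0
  have hmul : ∀ R : E.Adjointable, tensorInner E X (LinearMap.rTensor X.carrier R.1.toLinearMap ζ)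
      (LinearMap.rTensor X.carrier R.1.toLinearMap ζ)
      = tensorInner E X ζ (LinearMap.rTensor X.carrier (star R * R).1.toLinearMap ζ) := fun R => by
    have h := tensorInner_rTensor E X (star R) ζ (LinearMap.rTensor X.carrier R.1.toLinearMap ζ)
    rw [star_star] at h
    have h' : LinearMap.rTensor X.carrier (star R * R).1.toLinearMap
        = LinearMap.rTensor X.carrier (star R).1.toLinearMap
          ∘ₗ LinearMap.rTensor X.carrier R.1.toLinearMap :=
      LinearMap.rTensor_comp X.carrier (star R).1.toLinearMap R.1.toLinearMap
    rw [h, h']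
    rfl
  have h1 : 0 ≤ tensorInner E X ζ (LinearMap.rTensor X.carrier (star c * c).1.toLinearMap ζ) := by
    rw [← hmul]
    exact tensorInner_self_nonneg E X _
  have h2 : (star c * c).1.toLinearMap
      = ((‖star T * T‖ : ℝ) : ℂ) • LinearMap.id - (star T * T).1.toLinearMap := by
    rw [← hc]
    rfl
  rw [h2, LinearMap.rTensor_sub, LinearMap.rTensor_smul, LinearMap.sub_apply, map_sub, ← hmul,
    LinearMap.smul_apply, LinearMap.rTensor_id, LinearMap.id_apply, map_smul, Complex.coe_smul,
    sub_nonneg] at h1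
  have h3 := CStarAlgebra.norm_le_norm_of_nonneg_of_le (tensorInner_self_nonneg E X _) h1
  rw [norm_smul, norm_norm, CStarRing.norm_star_mul_self] at h3
  rwa [sq]

/-- The operator `T ⊗ 1` on the algebraic tensor product. -/
def preAmpl (T : E.Adjointable) : (preTensor E X).carrier →ₗ[ℂ] (preTensor E X).carrier :=
  LinearMap.rTensor X.carrier T.1.toLinearMap

theorem norm_preAmpl_le (T : E.Adjointable) (ζ : (preTensor E X).carrier) :
    ‖preAmpl E X T ζ‖ ≤ ‖T‖ * ‖ζ‖ := by
  refine abs_le_of_sq_le_sq' ?_ (mul_nonneg (norm_nonneg _) (norm_nonneg _)) |>.2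
  rw [mul_pow, PreHilbertModule.norm_sq_eq, PreHilbertModule.norm_sq_eq]
  exact norm_tensorInner_rTensor_le E X T ζ

/-- The operator `T ⊗ 1` on `E ⊗_φ X`. -/
def ampl (T : E.Adjointable) : (tensorModule E X).carrier →L[ℂ] (tensorModule E X).carrier :=
  (preTensor E X).extend ((preTensor E X).toCompletion.comp
    ((preAmpl E X T).mkContinuous ‖T‖ (norm_preAmpl_le E X T)))

theorem ampl_toCompletion (T : E.Adjointable) (ζ : (preTensor E X).carrier) :
    ampl E X T ((preTensor E X).toCompletion ζ)
      = (preTensor E X).toCompletion (preAmpl E X T ζ) :=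
  (preTensor E X).extend_toCompletion _ _

theorem ampl_tmul (T : E.Adjointable) (ξ : E.carrier) (η : X.carrier) :
    ampl E X T (tmul E X ξ η) = tmul E X (T.1 ξ) η :=
  ampl_toCompletion E X T _

theorem ampl_add (T T' : E.Adjointable) : ampl E X (T + T') = ampl E X T + ampl E X T' :=
  (preTensor E X).ext_completion fun ζ => by
    have h : preAmpl E X (T + T') ζ = preAmpl E X T ζ + preAmpl E X T' ζ :=
      LinearMap.congr_fun (LinearMap.rTensor_add X.carrier T.1.toLinearMap T'.1.toLinearMap) ζ
    rw [add_apply, ampl_toCompletion, ampl_toCompletion, ampl_toCompletion, h,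
      map_add]

theorem ampl_smul (c : ℂ) (T : E.Adjointable) : ampl E X (c • T) = c • ampl E X T :=
  (preTensor E X).ext_completion fun ζ => by
    have h : preAmpl E X (c • T) ζ = c • preAmpl E X T ζ :=
      LinearMap.congr_fun (LinearMap.rTensor_smul X.carrier c T.1.toLinearMap) ζ
    rw [smul_apply, ampl_toCompletion, ampl_toCompletion, h, map_smul]

theorem ampl_mul (T T' : E.Adjointable) : ampl E X (T * T') = (ampl E X T).comp (ampl E X T') :=
  (preTensor E X).ext_completion fun ζ => by
    have h : preAmpl E X (T * T') ζ = preAmpl E X T (preAmpl E X T' ζ) :=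
      LinearMap.congr_fun (LinearMap.rTensor_comp X.carrier T.1.toLinearMap T'.1.toLinearMap) ζ
    rw [ContinuousLinearMap.comp_apply, ampl_toCompletion, ampl_toCompletion, ampl_toCompletion, h]

theorem isAdjoint_ampl (T : E.Adjointable) :
    IsAdjoint (ampl E X T) (ampl E X (star T)) :=
  (preTensor E X).isAdjoint_of_dense₂ fun ζ ζ' => by
    rw [ampl_toCompletion, ampl_toCompletion, PreHilbertModule.inner_toCompletion,
      PreHilbertModule.inner_toCompletion]
    exact tensorInner_rTensor E X T ζ' ζ

theorem norm_tmul_le (ξ : E.carrier) (η : X.carrier) : ‖tmul E X ξ η‖ ≤ ‖ξ‖ * ‖η‖ := by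
  refine abs_le_of_sq_le_sq' ?_ (mul_nonneg (norm_nonneg _) (norm_nonneg _)) |>.2
  rw [(tensorModule E X).norm_sq_eq, inner_tmul, mul_pow, E.norm_sq_eq]
  have h1 : ‖(X.φ (E.inner ξ ξ)).1 η‖ ≤ ‖E.inner ξ ξ‖ * ‖η‖ :=
    (ContinuousLinearMap.le_opNorm _ _).trans
      (mul_le_mul_of_nonneg_right (NonUnitalStarAlgHom.norm_apply_le X.φ _) (norm_nonneg _))
  calc _ ≤ ‖η‖ * (‖E.inner ξ ξ‖ * ‖η‖) :=
        (X.norm_inner_le _ _).trans (mul_le_mul_of_nonneg_left h1 (norm_nonneg _))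
    _ = _ := by ring

/-- The creation operator `X → E ⊗_φ X`, `η ↦ ξ ⊗ η`. -/
def creation (ξ : E.carrier) : X.carrier →L[ℂ] (tensorModule E X).carrier :=
  LinearMap.mkContinuous
    ((preTensor E X).toCompletion.toLinearMap ∘ₗ
      (TensorProduct.mk ℂ E.carrier X.carrier ξ : X.carrier →ₗ[ℂ] (preTensor E X).carrier)) ‖ξ‖
    (norm_tmul_le E X ξ)

theorem creation_apply (ξ : E.carrier) (η : X.carrier) : creation E X ξ η = tmul E X ξ η := rfl

theorem tensorInner_tmul_right (ξ : E.carrier) (η : X.carrier) (ζ : E.carrier ⊗[ℂ] X.carrier) :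
    X.inner (annih E X ξ ζ) η = tensorInner E X ζ (ξ ⊗ₜ η) := by
  rw [← star_tensorInner, tensorInner_tmul, X.star_inner]

/-- The map `ξ₁ ⊗ η ↦ φ(⟨ξ, ξ₁⟩) η` on the algebraic tensor product. -/
def preAnnih (ξ : E.carrier) : (preTensor E X).carrier →ₗ[ℂ] X.carrier := annih E X ξ

theorem norm_preAnnih_le (ξ : E.carrier) (ζ : (preTensor E X).carrier) :
    ‖preAnnih E X ξ ζ‖ ≤ ‖ξ‖ * ‖ζ‖ := by
  have h : ‖preAnnih E X ξ ζ‖ ^ 2 ≤ ‖ξ‖ * ‖ζ‖ * ‖preAnnih E X ξ ζ‖ := by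
    have e : X.inner (preAnnih E X ξ ζ) (preAnnih E X ξ ζ)
        = (tensorModule E X).inner ((preTensor E X).toCompletion ζ)
          (tmul E X ξ (preAnnih E X ξ ζ)) :=
      (tensorInner_tmul_right E X ξ _ ζ).trans ((preTensor E X).inner_toCompletion _ _).symm
    rw [X.norm_sq_eq, e]
    calc _ ≤ ‖(preTensor E X).toCompletion ζ‖ * (‖ξ‖ * ‖preAnnih E X ξ ζ‖) :=
          ((tensorModule E X).norm_inner_le _ _).trans
            (mul_le_mul_of_nonneg_left (norm_tmul_le E X _ _) (norm_nonneg _))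
      _ = _ := by
          have : ‖(preTensor E X).toCompletion ζ‖ = ‖ζ‖ := UniformSpace.Completion.norm_coe ζ
          rw [this]
          ring
  rcases (norm_nonneg (preAnnih E X ξ ζ)).eq_or_lt with h0 | h0
  · rw [← h0]
    positivity
  · rw [sq] at h
    exact le_of_mul_le_mul_right h h0

/-- The annihilation operator `E ⊗_φ X → X`, `ξ₁ ⊗ η ↦ φ(⟨ξ, ξ₁⟩) η`. -/
def annihilation (ξ : E.carrier) : (tensorModule E X).carrier →L[ℂ] X.carrier :=
  (preTensor E X).extend ((preAnnih E X ξ).mkContinuous ‖ξ‖ (norm_preAnnih_le E X ξ))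

theorem annihilation_toCompletion (ξ : E.carrier) (ζ : (preTensor E X).carrier) :
    annihilation E X ξ ((preTensor E X).toCompletion ζ) = preAnnih E X ξ ζ :=
  (preTensor E X).extend_toCompletion _ _

theorem annihilation_tmul (ξ ξ₁ : E.carrier) (η : X.carrier) :
    annihilation E X ξ (tmul E X ξ₁ η) = (X.φ (E.inner ξ ξ₁)).1 η :=
  annihilation_toCompletion E X ξ _

theorem isAdjoint_creation (ξ : E.carrier) :
    IsAdjoint (creation E X ξ) (annihilation E X ξ) :=
  IsAdjoint.symm ((preTensor E X).isAdjoint_of_dense fun ζ η => by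
    rw [annihilation_toCompletion]
    exact ((preTensor E X).inner_toCompletion _ _).trans (tensorInner_tmul E X ξ η ζ))

end Tensor

/-- The interior tensor product `E ⊗_φ X` of correspondences, with left action `φ(b) ⊗ 1`. -/
def tensor (E X : Correspondence B) : Correspondence B where
  toHilbertModule := tensorModule E.toHilbertModule X
  φ := (tensorModule E.toHilbertModule X).mkAction (fun b => ampl E.toHilbertModule X (E.φ b))
    (fun a b x => by rw [map_add, ampl_add]; rfl)
    (fun c a x => by rw [map_smul, ampl_smul]; rfl)
    (fun a b x => by rw [map_mul, ampl_mul]; rfl)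
    (fun a => by
      rw [map_star]
      exact isAdjoint_ampl E.toHilbertModule X (E.φ a))

end Correspondence

/-! ### Compact operators and the dual module -/

namespace HilbertModule

variable {B : Type u} [NonUnitalCStarAlgebra B] (E : HilbertModule B)

/-- The right multiplication `b ↦ ξ · b`. -/
def rsmulL (ξ : E.carrier) : B →L[ℂ] E.carrier :=
  LinearMap.mkContinuous
    { toFun := fun b => E.rsmul ξ b
      map_add' := fun a b => E.ext_inner fun z => by
        rw [E.inner_rsmul_right, E.inner_add_right, E.inner_rsmul_right, E.inner_rsmul_right,
          mul_add]
      map_smul' := fun c a => E.ext_inner fun z => by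
        rw [E.inner_rsmul_right, RingHom.id_apply, E.inner_smul_right, E.inner_rsmul_right,
          mul_smul_comm] }
    ‖ξ‖ (E.norm_rsmul_le ξ)

theorem rsmulL_apply (ξ : E.carrier) (b : B) : E.rsmulL ξ b = E.rsmul ξ b := rfl

theorem rsmul_mul (ξ : E.carrier) (a b : B) : E.rsmul ξ (a * b) = E.rsmul (E.rsmul ξ a) b :=
  E.ext_inner fun z => by
    rw [E.inner_rsmul_right, E.inner_rsmul_right, E.inner_rsmul_right, mul_assoc]

theorem isAdjoint_theta (ξ η : E.carrier) :
    IsAdjoint ((E.rsmulL ξ).comp (E.innerL η)) ((E.rsmulL η).comp (E.innerL ξ)) := fun x y => by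
  change E.inner (E.rsmul η (E.inner ξ y)) x = E.inner y (E.rsmul ξ (E.inner η x))
  rw [E.inner_rsmul_left, E.inner_rsmul_right, E.star_inner]

/-- The rank one operator `θ_{ξ,η} : ζ ↦ ξ · ⟨η, ζ⟩`. -/
def theta (ξ η : E.carrier) : E.Adjointable := (E.isAdjoint_theta ξ η).op

theorem theta_apply (ξ η ζ : E.carrier) : (E.theta ξ η).1 ζ = E.rsmul ξ (E.inner η ζ) := rfl

theorem star_theta (ξ η : E.carrier) : star (E.theta ξ η) = E.theta η ξ :=
  star_eq_of_isAdjoint (E.isAdjoint_theta ξ η)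

/-- The compact operators on `E`, the closed linear span of the rank one operators. -/
def compacts : Submodule ℂ E.Adjointable :=
  (Submodule.span ℂ (Set.range fun p : E.carrier × E.carrier => E.theta p.1 p.2)).topologicalClosure

theorem theta_mem_compacts (ξ η : E.carrier) : E.theta ξ η ∈ E.compacts :=
  Submodule.le_topologicalClosure _ (Submodule.subset_span ⟨(ξ, η), rfl⟩)

/-- `E` is full: the inner products span a dense subspace of `B`. -/
def IsFull : Prop :=
  Dense (Submodule.span ℂ (Set.range fun p : E.carrier × E.carrier => E.inner p.1 p.2) : Set B)

/-- `E` is countably generated: for some countable `s`, the submodule spanned by the `ξ · b` with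
`ξ ∈ s` and `b ∈ B` is dense. -/
def IsCountablyGenerated : Prop :=
  ∃ s : Set E.carrier, s.Countable ∧
    Dense (Submodule.span ℂ {x | ∃ ξ ∈ s, ∃ b : B, x = E.rsmul ξ b} : Set E.carrier)

variable {E}

theorem nonneg_of_inner_nonneg {T : E.Adjointable} (hT : IsSelfAdjoint T)
    (h : ∀ x, 0 ≤ E.inner x (T.1 x)) : 0 ≤ T := by
  obtain ⟨N, R, hNR, h0⟩ := exists_neg_conj T hT
  have hR : R = 0 := by
    refine Subtype.ext (ContinuousLinearMap.ext fun x => ?_)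
    have h1 : E.inner x ((star N * T * N).1 x) = E.inner (N.1 x) (T.1 (N.1 x)) := by
      change E.inner x ((star N).1 (T.1 (N.1 x))) = _
      rw [← E.star_inner, inner_star_left, E.star_inner]
    have h2 : E.inner x ((-(star R * R)).1 x) = -E.inner (R.1 x) (R.1 x) := by
      have e : (-(star R * R)).1 x = (-1 : ℂ) • (star R).1 (R.1 x) := (neg_one_smul ℂ _).symm
      rw [e, E.inner_smul_right, ← E.star_inner, inner_star_left, E.star_inner, neg_one_smul]
    have h3 : E.inner (R.1 x) (R.1 x) = 0 := by
      refine le_antisymm ?_ (E.inner_self_nonneg _)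
      rw [← neg_nonneg, ← h2, ← hNR, h1]
      exact h _
    have h4 := E.norm_sq_eq (R.1 x)
    rw [h3, norm_zero, sq_eq_zero_iff, norm_eq_zero] at h4
    exact h4
  obtain ⟨c, rfl⟩ := h0 hR
  exact star_mul_self_nonneg c

theorem norm_theta_self (ξ : E.carrier) : ‖E.theta ξ ξ‖ = ‖ξ‖ ^ 2 := by
  apply le_antisymm
  · refine ContinuousLinearMap.opNorm_le_bound _ (by positivity) fun x => ?_
    change ‖E.rsmul ξ (E.inner ξ x)‖ ≤ _
    calc _ ≤ ‖ξ‖ * (‖ξ‖ * ‖x‖) := (E.norm_rsmul_le _ _).trans (by gcongr; exact E.norm_inner_le _ _)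
      _ = _ := by ring
  · have h1 : ‖E.inner ξ ξ‖ ^ 2 = ‖E.inner ξ ((E.theta ξ ξ).1 ξ)‖ := by
      rw [theta_apply, E.inner_rsmul_right, sq, ← CStarRing.norm_star_mul_self, E.star_inner]
    have h2 : ‖E.inner ξ ((E.theta ξ ξ).1 ξ)‖ ≤ ‖ξ‖ * (‖E.theta ξ ξ‖ * ‖ξ‖) :=
      (E.norm_inner_le _ _).trans
        (mul_le_mul_of_nonneg_left (ContinuousLinearMap.le_opNorm _ _) (norm_nonneg _))
    rw [← h1, ← E.norm_sq_eq] at h2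
    rcases (norm_nonneg ξ).eq_or_lt with h0 | h0
    · rw [← h0, sq, zero_mul]
      exact norm_nonneg _
    · have h3 : ‖ξ‖ ^ 2 * ‖ξ‖ ^ 2 ≤ ‖E.theta ξ ξ‖ * ‖ξ‖ ^ 2 := by
        calc _ = (‖ξ‖ ^ 2) ^ 2 := by ring
          _ ≤ _ := h2
          _ = _ := by ring
      exact le_of_mul_le_mul_right h3 (by positivity)

end HilbertModule

namespace Correspondence

open HilbertModule

variable {B : Type u} [NonUnitalCStarAlgebra B]

/-- The pairs `(φ, E)` that have a Pimsner algebra: `B` is separable, `E` is countably generated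
and full, and `φ` is an isomorphism of `B` with the compact operators on `E`. -/
structure IsPimsnerPair (E : Correspondence B) : Prop where
  separable : TopologicalSpace.SeparableSpace B
  countablyGenerated : E.IsCountablyGenerated
  full : E.IsFull
  injective : Function.Injective E.φ
  range_eq : Set.range E.φ = (E.compacts : Set E.Adjointable)

theorem exists_φ_eq_theta (E : Correspondence B) (h : E.IsPimsnerPair) (ξ η : E.carrier) : ∃ b, E.φ b = E.theta ξ η := by
  have : E.theta ξ η ∈ Set.range E.φ := by
    rw [h.range_eq]
    exact E.theta_mem_compacts ξ η
  exact this

variable (E : Correspondence B) (h : E.IsPimsnerPair)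

/-- The element `φ⁻¹(θ_{ξ,η})` of `B`. -/
def leftInner (ξ η : E.carrier) : B := (exists_φ_eq_theta E h ξ η).choose

theorem φ_leftInner (ξ η : E.carrier) : E.φ (leftInner E h ξ η) = E.theta ξ η :=
  (exists_φ_eq_theta E h ξ η).choose_spec

/-- The dual `E* = {λ_ξ | ξ ∈ E}`, where `λ_ξ = ⟨ξ, ·⟩`. As `ξ ↦ λ_ξ` is a conjugate linear
bijection, it is realised on `E` with the conjugate scalar multiplication. -/
def DualSpace : Type u := E.carrier

/-- The map `ξ ↦ λ_ξ`. -/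
def toDual (ξ : E.carrier) : E.DualSpace := ξ

/-- The map `λ_ξ ↦ ξ`. -/
def ofDual (l : E.DualSpace) : E.carrier := l

instance : NormedAddCommGroup E.DualSpace := inferInstanceAs (NormedAddCommGroup E.carrier)

instance : CompleteSpace E.DualSpace := inferInstanceAs (CompleteSpace E.carrier)

instance : Module ℂ E.DualSpace where
  smul c l := E.toDual (star c • E.ofDual l)
  one_smul l := by
    change star (1 : ℂ) • E.ofDual l = l
    rw [star_one, one_smul]
    rfl
  mul_smul a b l := by
    change star (a * b) • E.ofDual l = star a • star b • E.ofDual l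
    rw [smul_smul, star_mul']
  smul_zero a := smul_zero (star a) (A := E.carrier)
  smul_add a x y := smul_add (star a) (E.ofDual x) (E.ofDual y)
  add_smul a b x := by
    change star (a + b) • E.ofDual x = star a • E.ofDual x + star b • E.ofDual x
    rw [star_add, add_smul]
  zero_smul x := by
    change star (0 : ℂ) • E.ofDual x = (0 : E.carrier)
    rw [star_zero, zero_smul]

theorem ofDual_smul (c : ℂ) (l : E.DualSpace) : E.ofDual (c • l) = star c • E.ofDual l := rfl

theorem ofDual_add (l m : E.DualSpace) : E.ofDual (l + m) = E.ofDual l + E.ofDual m := rfl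

instance : NormedSpace ℂ E.DualSpace where
  norm_smul_le c l := by
    change ‖star c • E.ofDual l‖ ≤ ‖c‖ * ‖E.ofDual l‖
    rw [norm_smul, norm_star]

theorem theta_add_right (ξ η η' : E.carrier) :
    E.theta ξ (η + η') = E.theta ξ η + E.theta ξ η' :=
  Subtype.ext (ContinuousLinearMap.ext fun ζ => by
    change E.rsmul ξ (E.inner (η + η') ζ) = E.rsmul ξ (E.inner η ζ) + E.rsmul ξ (E.inner η' ζ)
    rw [E.inner_add_left]
    exact map_add (E.rsmulL ξ) _ _)

theorem theta_smul_right (c : ℂ) (ξ η : E.carrier) :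
    E.theta ξ (c • η) = star c • E.theta ξ η :=
  Subtype.ext (ContinuousLinearMap.ext fun ζ => by
    change E.rsmul ξ (E.inner (c • η) ζ) = star c • E.rsmul ξ (E.inner η ζ)
    rw [E.inner_smul_left]
    exact map_smul (E.rsmulL ξ) _ _)

theorem theta_act_right (T : E.Adjointable) (ξ η : E.carrier) :
    E.theta ξ ((star T).1 η) = E.theta ξ η * T :=
  Subtype.ext (ContinuousLinearMap.ext fun ζ => by
    change E.rsmul ξ (E.inner ((star T).1 η) ζ) = E.rsmul ξ (E.inner η (T.1 ζ))
    rw [inner_star_left])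

theorem theta_rsmul (a : B) (ξ η : E.carrier) :
    E.theta (E.rsmul ξ a) η = E.theta ξ (E.rsmul η (star a)) :=
  Subtype.ext (ContinuousLinearMap.ext fun ζ => by
    rw [theta_apply, theta_apply, E.inner_rsmul_left, star_star, E.rsmul_mul])

/-- The Hilbert module structure of `E*`, with `λ_ξ · b = λ_ξ ∘ φ(b) = λ_{φ(b*) ξ}` and
`⟨λ_ξ, λ_η⟩ = φ⁻¹(θ_{ξ,η})`. -/
def dualModule : HilbertModule B where
  carrier := E.DualSpace
  rsmul l b := E.toDual ((E.φ (star b)).1 (E.ofDual l))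
  inner l m := leftInner E h (E.ofDual l) (E.ofDual m)
  inner_add_right l m m' := h.injective (by
    rw [map_add, φ_leftInner, φ_leftInner, φ_leftInner, ofDual_add, theta_add_right])
  inner_smul_right c l m := h.injective (by
    rw [map_smul, φ_leftInner, φ_leftInner, ofDual_smul, theta_smul_right, star_star])
  inner_rsmul_right l m b := h.injective (by
    rw [map_mul, φ_leftInner, φ_leftInner, map_star]
    exact theta_act_right E (E.φ b) _ _)
  star_inner l m := h.injective (by rw [map_star, φ_leftInner, φ_leftInner, star_theta])
  inner_self_nonneg l := by
    refine nonneg_of_map_nonneg E.φ h.injective ?_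
    rw [φ_leftInner]
    refine nonneg_of_inner_nonneg (E.star_theta _ _) fun x => ?_
    rw [theta_apply, E.inner_rsmul_right, ← E.star_inner]
    exact star_mul_self_nonneg _
  norm_sq_eq l := by
    rw [← NonUnitalStarAlgHom.norm_map E.φ h.injective, φ_leftInner, norm_theta_self]
    rfl

/-- The action `φ*(b) λ_ξ = λ_{ξ · b*}` on the dual. -/
def dualAct (b : B) : E.DualSpace →L[ℂ] E.DualSpace :=
  LinearMap.mkContinuous
    { toFun := fun l => E.toDual (E.rsmul (E.ofDual l) (star b))
      map_add' := fun l m => E.rsmul_add (E.ofDual l) (E.ofDual m) (star b)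
      map_smul' := fun c l => E.rsmul_smul (star c) (E.ofDual l) (star b) }
    ‖b‖ fun l => by
      have := E.norm_rsmul_le (E.ofDual l) (star b)
      rwa [norm_star, mul_comm] at this

/-- The pair `(φ*, E*)` dual to `(φ, E)`. -/
def dual : Correspondence B where
  toHilbertModule := dualModule E h
  φ := (dualModule E h).mkAction E.dualAct
    (fun a b l => by
      change E.rsmul (E.ofDual l) (star (a + b))
        = E.rsmul (E.ofDual l) (star a) + E.rsmul (E.ofDual l) (star b)
      rw [star_add]
      exact map_add (E.rsmulL (E.ofDual l)) _ _)
    (fun c a l => by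
      change E.rsmul (E.ofDual l) (star (c • a)) = star c • E.rsmul (E.ofDual l) (star a)
      rw [star_smul]
      exact map_smul (E.rsmulL (E.ofDual l)) _ _)
    (fun a b l => by
      change E.rsmul (E.ofDual l) (star (a * b)) = E.rsmul (E.rsmul (E.ofDual l) (star b)) (star a)
      rw [star_mul, E.rsmul_mul])
    (fun a l m => by
      change leftInner E h (E.rsmul (E.ofDual m) (star (star a))) (E.ofDual l)
        = leftInner E h (E.ofDual m) (E.rsmul (E.ofDual l) (star a))
      apply h.injective
      rw [φ_leftInner, φ_leftInner, star_star, theta_rsmul])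

/-! ### Tensor powers -/

/-- The interior tensor power with `n + 1` factors. -/
def tpowSucc (E : Correspondence B) : ℕ → Correspondence B
  | 0 => E
  | n + 1 => tensor E (tpowSucc E n)

/-- The interior tensor power `E ⊗_φ ⋯ ⊗_φ E` with `n` factors; it is `B` for `n = 0`. -/
def tpow (E : Correspondence B) : ℕ → Correspondence B
  | 0 => self B
  | n + 1 => tpowSucc E n

/-- The elementary tensor `x₀ ⊗ ⋯ ⊗ xₙ`. -/
def tprodSucc (E : Correspondence B) : (n : ℕ) → (Fin (n + 1) → E.carrier) →
    (tpowSucc E n).carrier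
  | 0, x => x 0
  | n + 1, x => tmul E.toHilbertModule (tpowSucc E n) (x 0) (tprodSucc E n (Fin.tail x))

/-- The elementary tensor `x₁ ⊗ ⋯ ⊗ xₙ` in the `n`-th tensor power for `n ≥ 1` (there is none for
`n = 0`, where `B` need not have a unit; the value `0` there plays no role). -/
def tprod (E : Correspondence B) : (n : ℕ) → (Fin n → E.carrier) → (tpow E n).carrier
  | 0, _ => 0
  | n + 1, x => tprodSucc E n x

/-- The operator `η ↦ ξ ⊗ η` from the `n`-th to the `n + 1`-st tensor power, which is `b ↦ ξ · b`
for `n = 0`. -/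
def raise (E : Correspondence B) (ξ : E.carrier) :
    (n : ℕ) → (tpow E n).carrier →L[ℂ] (tpow E (n + 1)).carrier
  | 0 => E.rsmulL ξ
  | n + 1 => creation E.toHilbertModule (tpowSucc E n) ξ

/-- The operator `ξ₁ ⊗ η ↦ φ(⟨ξ, ξ₁⟩) η` from the `n + 1`-st to the `n`-th tensor power, which is
`ξ₁ ↦ ⟨ξ, ξ₁⟩` for `n = 0`. -/
def lower (E : Correspondence B) (ξ : E.carrier) :
    (n : ℕ) → (tpow E (n + 1)).carrier →L[ℂ] (tpow E n).carrier
  | 0 => E.innerL ξ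
  | n + 1 => annihilation E.toHilbertModule (tpowSucc E n) ξ

theorem isAdjoint_raise (E : Correspondence B) (ξ : E.carrier) (n : ℕ) :
    IsAdjoint (E := (tpow E n).toHilbertModule) (F := (tpow E (n + 1)).toHilbertModule)
      (raise E ξ n) (lower E ξ n) := by
  cases n with
  | zero =>
    intro b x
    have e : ∀ (c : B) (z : E.carrier), star (E.inner ξ z) * c = E.inner z (E.rsmul ξ c) :=
      fun c z => by rw [E.star_inner, E.inner_rsmul_right]
    exact e b x
  | succ n => exact isAdjoint_creation E.toHilbertModule (tpowSucc E n) ξ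

theorem norm_raise_le (E : Correspondence B) (ξ : E.carrier) (n : ℕ) : ‖raise E ξ n‖ ≤ ‖ξ‖ := by
  cases n with
  | zero => exact LinearMap.mkContinuous_norm_le _ (norm_nonneg _) (E.norm_rsmul_le ξ)
  | succ n =>
    exact LinearMap.mkContinuous_norm_le _ (norm_nonneg _)
      (norm_tmul_le E.toHilbertModule (tpowSucc E n) ξ)

theorem norm_lower_le (E : Correspondence B) (ξ : E.carrier) (n : ℕ) : ‖lower E ξ n‖ ≤ ‖ξ‖ :=
  (isAdjoint_raise E ξ n).norm_le.trans (norm_raise_le E ξ n)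

/-- The modules `E^(n)`, `n ∈ ℤ`: tensor powers of `E` for `n > 0`, `B` for `n = 0`, and tensor
powers of `E*` for `n < 0`. -/
def zpow : ℤ → Correspondence B
  | Int.ofNat n => tpow E n
  | Int.negSucc n => tpow (dual E h) (n + 1)

/-- The component `E^(n) → E^(n + 1)` of `S_ξ`. -/
def shift (ξ : E.carrier) : (n : ℤ) → (zpow E h n).carrier →L[ℂ] (zpow E h (n + 1)).carrier
  | Int.ofNat n => raise E ξ n
  | Int.negSucc 0 => lower (dual E h) (E.toDual ξ) 0
  | Int.negSucc (n + 1) => lower (dual E h) (E.toDual ξ) (n + 1)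

/-- The component `E^(n + 1) → E^(n)` of the adjoint of `S_ξ`. -/
def unshift (ξ : E.carrier) : (n : ℤ) → (zpow E h (n + 1)).carrier →L[ℂ] (zpow E h n).carrier
  | Int.ofNat n => lower E ξ n
  | Int.negSucc 0 => raise (dual E h) (E.toDual ξ) 0
  | Int.negSucc (n + 1) => raise (dual E h) (E.toDual ξ) (n + 1)

theorem isAdjoint_shift (ξ : E.carrier) (n : ℤ) :
    IsAdjoint (E := (zpow E h n).toHilbertModule) (F := (zpow E h (n + 1)).toHilbertModule)
      (shift E h ξ n) (unshift E h ξ n) :=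
  match n with
  | Int.ofNat n => isAdjoint_raise E ξ n
  | Int.negSucc 0 => (isAdjoint_raise (dual E h) (E.toDual ξ) 0).symm
  | Int.negSucc (n + 1) => (isAdjoint_raise (dual E h) (E.toDual ξ) (n + 1)).symm

theorem norm_shift_le (ξ : E.carrier) (n : ℤ) : ‖shift E h ξ n‖ ≤ ‖ξ‖ :=
  match n with
  | Int.ofNat n => norm_raise_le E ξ n
  | Int.negSucc 0 => norm_lower_le (dual E h) (E.toDual ξ) 0
  | Int.negSucc (n + 1) => norm_lower_le (dual E h) (E.toDual ξ) (n + 1)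

end Correspondence

/-! ### Direct sums -/

namespace HilbertModule

variable {B : Type u} [NonUnitalCStarAlgebra B] (F : ℤ → HilbertModule B)

open scoped Classical in
/-- The inner product `∑ ⟨xₙ, yₙ⟩` (a finite sum) of the algebraic direct sum. -/
def sumInner (x y : Π₀ n, (F n).carrier) : B := ∑ n ∈ x.support, (F n).inner (x n) (y n)

open scoped Classical in
theorem sumInner_eq_left (x y : Π₀ n, (F n).carrier) (s : Finset ℤ) (hs : x.support ⊆ s) :
    sumInner F x y = ∑ n ∈ s, (F n).inner (x n) (y n) := by
  refine Finset.sum_subset hs fun n _ hn => ?_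
  rw [DFinsupp.notMem_support_iff.mp hn, (F n).inner_zero_left]

open scoped Classical in
theorem sumInner_eq_right (x y : Π₀ n, (F n).carrier) (s : Finset ℤ) (hs : y.support ⊆ s) :
    sumInner F x y = ∑ n ∈ s, (F n).inner (x n) (y n) := by
  rw [sumInner_eq_left F x y (x.support ∪ s) Finset.subset_union_left]
  refine (Finset.sum_subset Finset.subset_union_right fun n _ hn => ?_).symm
  rw [DFinsupp.notMem_support_iff.mp (fun hn' => hn (hs hn')), (F n).inner_zero_right]

theorem sumInner_add_right (x y z : Π₀ n, (F n).carrier) :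
    sumInner F x (y + z) = sumInner F x y + sumInner F x z := by
  simp only [sumInner, DFinsupp.add_apply, (F _).inner_add_right, Finset.sum_add_distrib]

theorem star_sumInner (x y : Π₀ n, (F n).carrier) :
    star (sumInner F x y) = sumInner F y x := by
  classical
  rw [sumInner_eq_left F x y _ subset_rfl, sumInner_eq_right F y x _ subset_rfl, star_sum]
  exact Finset.sum_congr rfl fun n _ => (F n).star_inner _ _

/-- The algebraic direct sum, with the componentwise right action. -/
def preSum : PreHilbertModule B where
  carrier := Π₀ n, (F n).carrier
  rsmul b := DFinsupp.mapRange.linearMap fun n => (F n).rsmulₗ b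
  inner := sumInner F
  inner_add_right := sumInner_add_right F
  inner_smul_right c x y := by
    simp only [sumInner, DFinsupp.smul_apply, (F _).inner_smul_right, Finset.smul_sum]
  inner_rsmul_right x y b := by
    simp only [sumInner, DFinsupp.mapRange.linearMap_apply, DFinsupp.mapRange_apply, Finset.sum_mul]
    exact Finset.sum_congr rfl fun n _ => (F n).inner_rsmul_right _ _ _
  star_inner := star_sumInner F
  inner_self_nonneg x := Finset.sum_nonneg fun n _ => (F n).inner_self_nonneg _

/-- The Hilbert module direct sum, the completion of the algebraic direct sum. -/
abbrev directSum : HilbertModule B := (preSum F).completion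

/-- The element of the direct sum concentrated in degree `n`. -/
def directSumOf (n : ℤ) (x : (F n).carrier) : (directSum F).carrier :=
  (preSum F).toCompletion (DFinsupp.single n x : Π₀ n, (F n).carrier)

variable {F}

/-- The operator of degree one with components `s n`, on the algebraic direct sum. -/
def sumShift (s : ∀ n, (F n).carrier →L[ℂ] (F (n + 1)).carrier) :
    (Π₀ n, (F n).carrier) →ₗ[ℂ] Π₀ n, (F n).carrier :=
  DFinsupp.lsum ℕ fun n =>
    DFinsupp.lsingle (R := ℂ) (M := fun n => (F n).carrier) (n + 1) ∘ₗ (s n).toLinearMap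

/-- The operator of degree minus one with components `t n`, on the algebraic direct sum. -/
def sumUnshift (t : ∀ n, (F (n + 1)).carrier →L[ℂ] (F n).carrier) :
    (Π₀ n, (F n).carrier) →ₗ[ℂ] Π₀ n, (F n).carrier :=
  (DFinsupp.mapRange.linearMap fun n => (t n).toLinearMap) ∘ₗ
    { toFun := fun y : Π₀ n, (F n).carrier =>
        DFinsupp.comapDomain (fun n : ℤ => n + 1) (add_left_injective 1) y
      map_add' := fun x y => DFinsupp.comapDomain_add _ _ x y
      map_smul' := fun c x => DFinsupp.comapDomain_smul _ _ c x }

variable {s : ∀ n, (F n).carrier →L[ℂ] (F (n + 1)).carrier}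
  {t : ∀ n, (F (n + 1)).carrier →L[ℂ] (F n).carrier}

theorem sumShift_single (n : ℤ) (x : (F n).carrier) :
    sumShift s (DFinsupp.single n x) = DFinsupp.single (n + 1) (s n x) := by
  simp [sumShift]

theorem sumUnshift_apply (y : Π₀ n, (F n).carrier) (n : ℤ) :
    sumUnshift t y n = t n (y (n + 1)) := by
  simp [sumUnshift]

theorem sumInner_unshift (hst : ∀ n, IsAdjoint (s n) (t n)) (x y : Π₀ n, (F n).carrier) :
    sumInner F (sumUnshift t y) x = sumInner F y (sumShift s x) := by
  classical
  induction x using DFinsupp.induction with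
  | h0 =>
    rw [map_zero, sumInner_eq_right F _ _ ∅ (by simp), sumInner_eq_right F _ _ ∅ (by simp),
      Finset.sum_empty, Finset.sum_empty]
  | ha n x f _ _ hf =>
    rw [map_add, sumInner_add_right, sumInner_add_right, hf, sumShift_single, sumInner_eq_right F _ _ {n} DFinsupp.support_single_subset,
      sumInner_eq_right F _ _ {n + 1} DFinsupp.support_single_subset, Finset.sum_singleton,
      Finset.sum_singleton, sumUnshift_apply, DFinsupp.single_eq_same, DFinsupp.single_eq_same,
      hst]

theorem sumInner_unshift_le (hst : ∀ n, IsAdjoint (s n) (t n)) {C : ℝ} (hC : ∀ n, ‖s n‖ ≤ C)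
    (y : Π₀ n, (F n).carrier) :
    sumInner F (sumUnshift t y) (sumUnshift t y) ≤ (C ^ 2) • sumInner F y y := by
  classical
  let u := (sumUnshift t y).support
  let v := u.map ⟨fun n : ℤ => n + 1, add_left_injective 1⟩
  calc sumInner F (sumUnshift t y) (sumUnshift t y)
      = ∑ n ∈ u, (F n).inner (t n (y (n + 1))) (t n (y (n + 1))) := by
        refine Finset.sum_congr rfl fun n _ => ?_
        rw [sumUnshift_apply]
    _ ≤ ∑ n ∈ u, (C ^ 2) • (F (n + 1)).inner (y (n + 1)) (y (n + 1)) := by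
        refine Finset.sum_le_sum fun n _ => ?_
        refine (inner_self_le_of_isAdjoint (hst n).symm (y (n + 1))).trans ?_
        refine smul_le_smul_of_nonneg_right ?_ ((F _).inner_self_nonneg _)
        exact pow_le_pow_left₀ (norm_nonneg _) ((hst n).norm_le.trans (hC n)) 2
    _ = (C ^ 2) • ∑ m ∈ v, (F m).inner (y m) (y m) := by
        rw [Finset.sum_map, Finset.smul_sum]
        rfl
    _ ≤ (C ^ 2) • ∑ m ∈ y.support ∪ v, (F m).inner (y m) (y m) := by
        refine smul_le_smul_of_nonneg_left ?_ (sq_nonneg C)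
        exact Finset.sum_le_sum_of_subset_of_nonneg Finset.subset_union_right
          fun m _ _ => (F m).inner_self_nonneg _
    _ = _ := by rw [← sumInner_eq_left F y y _ Finset.subset_union_left]

/-- `sumShift` as an operator on the pre-Hilbert module. -/
def preShift (s : ∀ n, (F n).carrier →L[ℂ] (F (n + 1)).carrier) :
    (preSum F).carrier →ₗ[ℂ] (preSum F).carrier := sumShift s

/-- `sumUnshift` as an operator on the pre-Hilbert module. -/
def preUnshift (t : ∀ n, (F (n + 1)).carrier →L[ℂ] (F n).carrier) :
    (preSum F).carrier →ₗ[ℂ] (preSum F).carrier := sumUnshift t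

theorem inner_preUnshift (hst : ∀ n, IsAdjoint (s n) (t n)) (x y : (preSum F).carrier) :
    (preSum F).inner (preUnshift t y) x = (preSum F).inner y (preShift s x) :=
  sumInner_unshift hst x y

theorem norm_preUnshift_le (hst : ∀ n, IsAdjoint (s n) (t n)) {C : ℝ} (hC : ∀ n, ‖s n‖ ≤ C)
    (y : (preSum F).carrier) : ‖preUnshift t y‖ ≤ C * ‖y‖ := by
  have hC0 : 0 ≤ C := (norm_nonneg _).trans (hC 0)
  refine abs_le_of_sq_le_sq' ?_ (mul_nonneg hC0 (norm_nonneg _)) |>.2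
  rw [mul_pow, PreHilbertModule.norm_sq_eq, PreHilbertModule.norm_sq_eq]
  have h1 := CStarAlgebra.norm_le_norm_of_nonneg_of_le
    ((preSum F).inner_self_nonneg (preUnshift t y)) (sumInner_unshift_le hst hC y)
  rwa [norm_smul, Real.norm_of_nonneg (sq_nonneg C)] at h1

theorem norm_preShift_le (hst : ∀ n, IsAdjoint (s n) (t n)) {C : ℝ} (hC : ∀ n, ‖s n‖ ≤ C)
    (x : (preSum F).carrier) : ‖preShift s x‖ ≤ C * ‖x‖ := by
  have hC0 : 0 ≤ C := (norm_nonneg _).trans (hC 0)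
  have h : ‖preShift s x‖ * ‖preShift s x‖ ≤ C * ‖x‖ * ‖preShift s x‖ := by
    rw [← sq, PreHilbertModule.norm_sq_eq, ← inner_preUnshift hst]
    calc _ ≤ ‖preUnshift t (preShift s x)‖ * ‖x‖ := (preSum F).norm_inner_le _ _
      _ ≤ C * ‖preShift s x‖ * ‖x‖ := by
          gcongr
          exact norm_preUnshift_le hst hC _
      _ = _ := by ring
  rcases (norm_nonneg (preShift s x)).eq_or_lt with h0 | h0
  · rw [← h0]
    positivity
  · exact le_of_mul_le_mul_right h h0

/-- The operator of degree one on the direct sum with components `s n`, which have adjoints `t n`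
and are uniformly bounded. -/
def shiftOp (hst : ∀ n, IsAdjoint (s n) (t n)) {C : ℝ} (hC : ∀ n, ‖s n‖ ≤ C) :
    (directSum F).Adjointable :=
  IsAdjoint.op (E := directSum F)
    (T := (preSum F).extend ((preSum F).toCompletion.comp
      ((preShift s).mkContinuous C (norm_preShift_le hst hC))))
    (S := (preSum F).extend ((preSum F).toCompletion.comp
      ((preUnshift t).mkContinuous C (norm_preUnshift_le hst hC))))
    ((preSum F).isAdjoint_of_dense₂ fun x y => by
      rw [PreHilbertModule.extend_toCompletion, PreHilbertModule.extend_toCompletion]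
      simp only [ContinuousLinearMap.comp_apply, LinearMap.mkContinuous_apply,
        PreHilbertModule.inner_toCompletion]
      exact inner_preUnshift hst x y)

theorem shiftOp_of (hst : ∀ n, IsAdjoint (s n) (t n)) {C : ℝ} (hC : ∀ n, ‖s n‖ ≤ C) (n : ℤ)
    (x : (F n).carrier) :
    (shiftOp hst hC).1 (directSumOf F n x) = directSumOf F (n + 1) (s n x) := by
  refine ((preSum F).extend_toCompletion _ _).trans ?_
  exact congrArg (preSum F).toCompletion (sumShift_single n x)

end HilbertModule

/-! ### The Pimsner algebra -/

namespace Correspondence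

open HilbertModule

variable {B : Type u} [NonUnitalCStarAlgebra B] (E : Correspondence B) (h : E.IsPimsnerPair)

/-- The Hilbert module `E_∞ = ⨁ E^(n)`, `n ∈ ℤ`. -/
abbrev infinity : HilbertModule B := directSum fun n => (zpow E h n).toHilbertModule

/-- The operator `S_ξ` on `E_∞`. -/
def S (ξ : E.carrier) : (infinity E h).Adjointable :=
  shiftOp (F := fun n => (zpow E h n).toHilbertModule) (isAdjoint_shift E h ξ) (norm_shift_le E h ξ)

/-- The smallest C*-subalgebra of the adjointable operators on `E_∞` that contains all `S_ξ`. -/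
def pimsnerSubalgebra : NonUnitalStarSubalgebra ℂ (infinity E h).Adjointable :=
  (NonUnitalStarAlgebra.adjoin ℂ (Set.range (S E h))).topologicalClosure

/-- The Pimsner algebra of `(φ, E)`: the smallest C*-subalgebra of the adjointable operators on
`E_∞` that contains all `S_ξ`. -/
def PimsnerAlgebra : Type u := pimsnerSubalgebra E h

instance : NonUnitalCStarAlgebra (PimsnerAlgebra E h) :=
  NonUnitalStarSubalgebra.nonUnitalCStarAlgebra (pimsnerSubalgebra E h)
    (h_closed := NonUnitalStarSubalgebra.isClosed_topologicalClosure _)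

/-- The operator `S_ξ` as an element of the Pimsner algebra. -/
def pimsnerS (ξ : E.carrier) : PimsnerAlgebra E h :=
  (⟨S E h ξ, NonUnitalStarSubalgebra.le_topologicalClosure _
    (NonUnitalStarAlgebra.subset_adjoin ℂ _ ⟨ξ, rfl⟩)⟩ : pimsnerSubalgebra E h)

/-- A unitary isomorphism of correspondences: a linear bijection that preserves the inner products
and the left action (hence also the right action). -/
structure Unitary (E F : Correspondence B) where
  toEquiv : E.carrier ≃ₗ[ℂ] F.carrier
  inner_map : ∀ x y, F.inner (toEquiv x) (toEquiv y) = E.inner x y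
  map_act : ∀ b x, toEquiv ((E.φ b).1 x) = (F.φ b).1 (toEquiv x)

end Correspondence

/-! ### Circle actions -/

theorem nonneg_of_map_eq {B C : Type*} [NonUnitalCStarAlgebra B] [NonUnitalCStarAlgebra C]
    (φ : B →⋆ₙₐ[ℂ] C) (hφ : Function.Injective φ) {b : B} {c : C} (h : φ b = star c * c) :
    0 ≤ b :=
  nonneg_of_map_nonneg φ hφ (h ▸ star_mul_self_nonneg c)

namespace CircleAction

open HilbertModule

variable {A : Type u} [NonUnitalCStarAlgebra A] (σ : Circle →* (A ≃⋆ₐ[ℂ] A))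

/-- The spectral subspace `{ξ | σ_z(ξ) = z⁻ⁿ ξ for all z}`. -/
def spectralSubspace (n : ℤ) : Submodule ℂ A where
  carrier := {ξ | ∀ z : Circle, σ z ξ = ((z ^ (-n) : Circle) : ℂ) • ξ}
  zero_mem' z := by rw [map_zero, smul_zero]
  add_mem' hx hy z := by rw [map_add, hx z, hy z, smul_add]
  smul_mem' c x hx z := by rw [map_smul, hx z, smul_comm]

theorem mem_spectralSubspace {n : ℤ} {ξ : A} :
    ξ ∈ spectralSubspace σ n ↔ ∀ z : Circle, σ z ξ = ((z ^ (-n) : Circle) : ℂ) • ξ := Iff.rfl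

variable {σ}

theorem mul_mem_spectralSubspace {m n : ℤ} {x y : A} (hx : x ∈ spectralSubspace σ m)
    (hy : y ∈ spectralSubspace σ n) : x * y ∈ spectralSubspace σ (m + n) := fun z => by
  rw [map_mul, hx z, hy z, smul_mul_smul_comm, neg_add, zpow_add, Circle.coe_mul]

theorem star_mem_spectralSubspace {n : ℤ} {x : A} (hx : x ∈ spectralSubspace σ n) :
    star x ∈ spectralSubspace σ (-n) := fun z => by
  rw [map_star, hx z, star_smul, zpow_neg z (-n), Circle.coe_inv_eq_conj]
  rfl

variable (σ)

theorem isClosed_spectralSubspace (n : ℤ) : IsClosed (spectralSubspace σ n : Set A) := by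
  have : (spectralSubspace σ n : Set A)
      = ⋂ z : Circle, {ξ | σ z ξ = ((z ^ (-n) : Circle) : ℂ) • ξ} := by
    ext ξ
    simp [mem_spectralSubspace]
  rw [this]
  refine isClosed_iInter fun z => isClosed_eq ?_ (continuous_const_smul _)
  exact (NonUnitalStarAlgHom.isometry (σ z) (σ z).injective).continuous

/-- The fixed-point algebra `A_(0)`. -/
def fixedPoints : NonUnitalStarSubalgebra ℂ A where
  carrier := spectralSubspace σ 0
  zero_mem' := zero_mem _
  add_mem' hx hy := add_mem hx hy
  mul_mem' hx hy := mul_mem_spectralSubspace hx hy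
  smul_mem' c _ hx := Submodule.smul_mem _ c hx
  star_mem' hx := star_mem_spectralSubspace hx

instance : IsClosed (fixedPoints σ : Set A) := isClosed_spectralSubspace σ 0

instance (n : ℤ) : CompleteSpace (spectralSubspace σ n) :=
  (isClosed_spectralSubspace σ n).completeSpace_coe

/-- The spectral subspace `A_(n)` as a right Hilbert module over `A_(0)`, with the multiplication of
`A` as the right action and `⟨ξ, η⟩ = ξ* η`. -/
def spectralModule (n : ℤ) : HilbertModule (fixedPoints σ) where
  carrier := spectralSubspace σ n
  rsmul ξ b := ⟨ξ.1 * b.1, by simpa using mul_mem_spectralSubspace ξ.2 b.2⟩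
  inner ξ η := ⟨star ξ.1 * η.1, by
    have := mul_mem_spectralSubspace (star_mem_spectralSubspace ξ.2) η.2
    rwa [neg_add_cancel] at this⟩
  inner_add_right ξ η ζ := Subtype.ext (mul_add _ _ _)
  inner_smul_right c ξ η := Subtype.ext (mul_smul_comm _ _ _)
  inner_rsmul_right ξ η b := Subtype.ext (mul_assoc _ _ _).symm
  star_inner ξ η := Subtype.ext (by
    change star (star ξ.1 * η.1) = star η.1 * ξ.1
    rw [star_mul, star_star])
  inner_self_nonneg ξ :=
    nonneg_of_map_eq (NonUnitalStarSubalgebraClass.subtype (fixedPoints σ))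
      Subtype.val_injective (c := ξ.1) rfl
  norm_sq_eq ξ := by
    change ‖ξ.1‖ ^ 2 = ‖star ξ.1 * ξ.1‖
    rw [CStarRing.norm_star_mul_self, sq]

/-- Left multiplication by an element of `A_(0)` on `A_(n)`. -/
def leftMul (n : ℤ) (a : fixedPoints σ) : spectralSubspace σ n →L[ℂ] spectralSubspace σ n :=
  LinearMap.mkContinuous
    { toFun := fun ξ => ⟨a.1 * ξ.1, by simpa using mul_mem_spectralSubspace a.2 ξ.2⟩
      map_add' := fun ξ η => Subtype.ext (mul_add _ _ _)
      map_smul' := fun c ξ => Subtype.ext (mul_smul_comm _ _ _) }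
    ‖a‖ fun ξ => norm_mul_le a.1 ξ.1

/-- The pair `(φ, A_(n))` over `A_(0)`, with `φ(a) ξ = a ξ`. -/
def spectralCorrespondence (n : ℤ) : Correspondence (fixedPoints σ) where
  toHilbertModule := spectralModule σ n
  φ := (spectralModule σ n).mkAction (fun a => leftMul σ n a)
    (fun a b ξ => Subtype.ext (add_mul _ _ _))
    (fun c a ξ => Subtype.ext (smul_mul_assoc _ _ _))
    (fun a b ξ => Subtype.ext (mul_assoc _ _ _))
    (fun a (ξ η : spectralSubspace σ n) => Subtype.ext (by
      change star (star a.1 * η.1) * ξ.1 = star η.1 * (a.1 * ξ.1)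
      rw [star_mul, star_star, mul_assoc]))

/-- The inclusion of `A_(n)` in `A`. -/
def incl (n : ℤ) (ξ : (spectralCorrespondence σ n).carrier) : A :=
  (show spectralSubspace σ n from ξ).1

/-- The algebraic sum of the spectral subspaces `A_(n d)`, `n ∈ ℤ`. -/
def gradedPart (d : ℕ) : NonUnitalStarSubalgebra ℂ A where
  carrier := (⨆ n : ℤ, spectralSubspace σ (n * d) : Submodule ℂ A)
  zero_mem' := zero_mem _
  add_mem' hx hy := add_mem hx hy
  smul_mem' c _ hx := Submodule.smul_mem _ c hx
  mul_mem' {x y} hx hy := by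
    refine Submodule.iSup_induction _ (motive := fun x =>
      x * y ∈ (⨆ n : ℤ, spectralSubspace σ (n * d) : Submodule ℂ A)) hx ?_ ?_ ?_
    · intro m x hx
      refine Submodule.iSup_induction _ (motive := fun y =>
        x * y ∈ (⨆ n : ℤ, spectralSubspace σ (n * d) : Submodule ℂ A)) hy ?_ ?_ ?_
      · intro n y hy
        refine Submodule.mem_iSup_of_mem (m + n) ?_
        rw [add_mul]
        exact mul_mem_spectralSubspace hx hy
      · rw [mul_zero]
        exact zero_mem _
      · intro y y' h h'
        rw [mul_add]
        exact add_mem h h'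
    · rw [zero_mul]
      exact zero_mem _
    · intro x x' h h'
      rw [add_mul]
      exact add_mem h h'
  star_mem' {x} hx := by
    refine Submodule.iSup_induction _ (motive := fun x =>
      star x ∈ (⨆ n : ℤ, spectralSubspace σ (n * d) : Submodule ℂ A)) hx ?_ ?_ ?_
    · intro n x hx
      refine Submodule.mem_iSup_of_mem (-n) ?_
      rw [neg_mul]
      exact star_mem_spectralSubspace hx
    · rw [star_zero]
      exact zero_mem _
    · intro x x' h h'
      rw [star_add]
      exact add_mem h h'

/-- The C*-subalgebra `A^{1/d}` of `A`, the closure of the sum of the `A_(n d)`. -/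
def rootAlgebra (d : ℕ) : NonUnitalStarSubalgebra ℂ A := (gradedPart σ d).topologicalClosure

/-- The product `x₀ ⋯ xₙ` in `A`. -/
def prodSucc {A : Type u} [Mul A] : (n : ℕ) → (Fin (n + 1) → A) → A
  | 0, x => x 0
  | n + 1, x => x 0 * prodSucc n (Fin.tail x)

/-- The product `x₁ ⋯ xₙ` in `A` for `n ≥ 1` (the value `0` for `n = 0` plays no role). -/
def prod {A : Type u} [NonUnitalCStarAlgebra A] : (n : ℕ) → (Fin n → A) → A
  | 0, _ => 0
  | n + 1, x => prodSucc n x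

end CircleAction

end Modules

end

/-! Everything is computed by multiplication in `A`. An approximate unit of $A_{(0)}$ shows that
fullness passes from $A_{(\pm1)}$ to $A_{(\pm d)}$ (`FullAt.nsmul`), and that $A_{(\pm d)}A_{(m)}$
then spans a dense subspace of $A_{(\pm d+m)}$ for every $m$ (`FullAt.le_closedProd`). Since
$(xy)^*(x'y')=y^*(x^*x')y'$, multiplication preserves the inner product of the interior tensor
product, so it identifies $A_{(k)}\widehat\otimes A_{(l)}$ with $A_{(k+l)}$ when $A_{(-k)}$ is full;
and $\lambda_\xi\mapsto\xi^*$ identifies the dual of $A_{(k)}$ with $A_{(-k)}$. A `Realization`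
records such an identification of a correspondence with a spectral subspace.

Both $(A_{(1)})^{\widehat\otimes d}$ and $A_{(d)}$ are realized as $A_{(d)}$, which gives $\psi$.
For any $E$ realized as $A_{(d)}$, one has $\phi(xy^*)=\theta_{x,y}$, so fullness of $A_{(-d)}$
identifies the image of $\phi$ with the compact operators; this and separability give $(\ast)$.
Moreover $E^{(n)}$ is realized as $A_{(nd)}$, and $S_\xi$ becomes left multiplication by $\xi$ in
all degrees (`zpow_map_shift`).

It remains to see that $S_\xi\mapsto\xi$ extends to an isomorphism $\mathcal O_E\cong A^{1/d}$.
Consider pairs $(a,T)$ in $A\times\mathcal L(E_\infty)$ in which $T$ acts as left multiplication by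
the homogeneous element $a$. The $*$-algebra generated by the $(\xi,S_\xi)$ consists of finite sums
of such pairs, and it suffices that $\|T\|=\|a\|$ on it. In degree zero $a$ determines $T$, and an
injective $*$-homomorphism of C*-algebras is isometric, so $\|T\|\le\|a\|$; the C*-identity extends
this to all degrees. For a sum with degrees in $[-M,M]$, each component $a_n$ is bounded by $\|a\|$,
by averaging over roots of unity (`norm_component_le`), and by $\|T\|$, by applying $T$ to the
vector $a_n^*$ (`norm_fst_le_norm_sum_snd`). Hence the two norms agree up to a factor $2M+1$.
Replacing the pair by the powers $(c^*c)^{2^j}$ makes this factor grow only linearly in $2^j$, while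
the norms are exact $2^j$-th powers, so the factor disappears (`norm_snd_eq_of_mem_bounded`). -/

noncomputable section

section Modules

attribute [local instance] cstarOrder cstarOrderedRing

attribute [local instance] PreHilbertModule.instAddCommGroup PreHilbertModule.instModule

/-! ### Closed products of spectral subspaces, and fullness -/

namespace CircleAction

open HilbertModule Filter Topology

variable {A : Type u} [NonUnitalCStarAlgebra A] {σ : Circle →* (A ≃⋆ₐ[ℂ] A)}

/-- A continuous linear map that sends `s` to a closed submodule sends its closed span there. -/
theorem map_mem_of_mem_closure_span {V W : Type*} [NormedAddCommGroup V] [NormedSpace ℂ V]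
    [NormedAddCommGroup W] [NormedSpace ℂ W] (f : V →L[ℂ] W) {s : Set V} {K : Submodule ℂ W}
    (hK : IsClosed (K : Set W)) (h : ∀ x ∈ s, f x ∈ K) {x : V}
    (hx : x ∈ (Submodule.span ℂ s).topologicalClosure) : f x ∈ K := by
  have h1 : (Submodule.span ℂ s).topologicalClosure ≤ K.comap f.toLinearMap :=
    Submodule.topologicalClosure_minimal _ (Submodule.span_le.mpr h) (hK.preimage f.continuous)
  exact h1 hx

variable (σ) in
/-- The closed span of the products `x * y` with `x ∈ A_(k)` and `y ∈ A_(l)`. -/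
def closedProd (k l : ℤ) : Submodule ℂ A :=
  (Submodule.span ℂ (Set.image2 (· * ·) (spectralSubspace σ k : Set A)
    (spectralSubspace σ l : Set A))).topologicalClosure

theorem isClosed_closedProd (k l : ℤ) : IsClosed (closedProd σ k l : Set A) :=
  Submodule.isClosed_topologicalClosure _

theorem mul_mem_closedProd {k l : ℤ} {x y : A} (hx : x ∈ spectralSubspace σ k)
    (hy : y ∈ spectralSubspace σ l) : x * y ∈ closedProd σ k l :=
  Submodule.le_topologicalClosure _ (Submodule.subset_span ⟨x, hx, y, hy, rfl⟩)

/-- This is how fullness is used: an element of $A_{(0)}$ is replaced by a product, and `f` is a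
multiplication operator or the identity. -/
theorem map_mem_of_mem_closedProd {k l : ℤ} (f : A →L[ℂ] A) {K : Submodule ℂ A}
    (hK : IsClosed (K : Set A))
    (h : ∀ x ∈ spectralSubspace σ k, ∀ y ∈ spectralSubspace σ l, f (x * y) ∈ K) {x : A}
    (hx : x ∈ closedProd σ k l) : f x ∈ K :=
  map_mem_of_mem_closure_span f hK (by rintro _ ⟨x, hx, y, hy, rfl⟩; exact h x hx y hy) hx

/-- An element of `A_(m)` is a limit of elements `b * w` with `b ∈ A_(0)`. -/
theorem mem_closure_mul_left {m : ℤ} {w : A} (hw : w ∈ spectralSubspace σ m) :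
    w ∈ closure ((fun b => b * w) '' (spectralSubspace σ 0 : Set A)) := by
  have hh : w * star w ∈ spectralSubspace σ 0 := by
    have := mul_mem_spectralSubspace hw (star_mem_spectralSubspace hw)
    rwa [add_neg_cancel] at this
  let h : fixedPoints σ := ⟨w * star w, hh⟩
  let _ : PartialOrder (fixedPoints σ) := cstarOrder _
  have _ : StarOrderedRing (fixedPoints σ) := cstarOrderedRing _
  have hu := CStarAlgebra.increasingApproximateUnit (fixedPoints σ)
  have hl := hu.toIsApproximateUnit
  have := hl.neBot
  refine mem_closure_of_tendsto (f := fun e : fixedPoints σ => (e : A) * w)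
    (b := CStarAlgebra.approximateUnit (fixedPoints σ)) ?_
    (Eventually.of_forall fun e => ⟨e, e.2, rfl⟩)
  rw [tendsto_iff_norm_sub_tendsto_zero]
  have h1 : Tendsto (fun e : fixedPoints σ => 2 * ‖e * h - h‖)
      (CStarAlgebra.approximateUnit (fixedPoints σ)) (𝓝 0) := by
    have := (tendsto_iff_norm_sub_tendsto_zero.mp (hl.tendsto_mul_right h)).const_mul 2
    rwa [mul_zero] at this
  have h2 : Tendsto (fun e : fixedPoints σ => ‖(e : A) * w - w‖ ^ 2)
      (CStarAlgebra.approximateUnit (fixedPoints σ)) (𝓝 0) := by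
    refine squeeze_zero' (Eventually.of_forall fun _ => sq_nonneg _) ?_ h1
    filter_upwards [hu.eventually_norm, hu.eventually_star_eq] with e he hs
    -- With $h=ww^*$, the C*-identity turns the convergence $eh\to h$ in $A_{(0)}$ into $ew\to w$,
    -- although $w$ itself is not in $A_{(0)}$.
    have e1 : ((e : A) * w - w) * star ((e : A) * w - w)
        = (((e * h - h) * e - (e * h - h) : fixedPoints σ) : A) := by
      have hs' : star (e : A) = e := congrArg Subtype.val hs
      change _ = ((e : A) * (w * star w) - w * star w) * e - (e * (w * star w) - w * star w)
      rw [star_sub, star_mul, hs']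
      noncomm_ring
    rw [sq, ← CStarRing.norm_self_mul_star, e1]
    calc ‖(e * h - h) * e - (e * h - h)‖ ≤ ‖e * h - h‖ * ‖e‖ + ‖e * h - h‖ :=
          (norm_sub_le _ _).trans (by gcongr; exact norm_mul_le _ _)
      _ ≤ ‖e * h - h‖ * 1 + ‖e * h - h‖ := by gcongr
      _ = _ := by ring
  have h3 := h2.sqrt
  simpa [Real.sqrt_sq] using h3

/-- An element of `A_(m)` is a limit of elements `w * b` with `b ∈ A_(0)`. -/
theorem mem_closure_mul_right {m : ℤ} {w : A} (hw : w ∈ spectralSubspace σ m) :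
    w ∈ closure ((fun b => w * b) '' (spectralSubspace σ 0 : Set A)) := by
  have h := mem_closure_mul_left (star_mem_spectralSubspace hw)
  have h2 := map_mem_closure (f := star) continuous_star h
    (t := (fun b => w * b) '' (spectralSubspace σ 0 : Set A)) (by
      rintro _ ⟨b, hb, rfl⟩
      refine ⟨star b, by simpa using star_mem_spectralSubspace hb, ?_⟩
      simp)
  simpa using h2

/-- The approximate unit supplies a factor from $A_{(0)}$, which fullness can then split. -/
theorem mem_of_mul_left_mem {m : ℤ} {w : A} (hw : w ∈ spectralSubspace σ m) {K : Submodule ℂ A}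
    (hK : IsClosed (K : Set A)) (h : ∀ b ∈ spectralSubspace σ 0, b * w ∈ K) : w ∈ K :=
  closure_minimal (by rintro _ ⟨b, hb, rfl⟩; exact h b hb) hK (mem_closure_mul_left hw)

variable (σ) in
/-- `A_(k)* A_(k)` spans a dense subspace of `A_(0)`. -/
def FullAt (k : ℤ) : Prop := spectralSubspace σ 0 ≤ closedProd σ (-k) k

/-- Approximate $w$ by $bw$ and $b\in A_{(0)}$ by sums of products $xy$ with $x\in A_{(k)}$, $y\in
A_{(-k)}$; then $(xy)w=x(yw)$ with $yw\in A_{(m)}$. -/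
theorem FullAt.le_closedProd {k : ℤ} (h : FullAt σ (-k)) (m : ℤ) :
    spectralSubspace σ (k + m) ≤ closedProd σ k m := by
  intro w hw
  refine mem_of_mul_left_mem hw (isClosed_closedProd _ _) fun b hb => ?_
  have hb' := h hb
  rw [neg_neg] at hb'
  refine map_mem_of_mem_closedProd (((ContinuousLinearMap.mul ℂ A).flip) w)
    (isClosed_closedProd _ _) (fun x hx y hy => ?_) hb'
  change x * y * w ∈ _
  rw [mul_assoc]
  refine mul_mem_closedProd hx ?_
  have := mul_mem_spectralSubspace hy hw
  rwa [neg_add_cancel_left] at this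

theorem fullAt_zero : FullAt σ 0 := fun w hw =>
  mem_of_mul_left_mem hw (isClosed_closedProd _ _) fun b hb =>
    mul_mem_closedProd (by simpa using hb) hw

/-- In a product $xy$ with $x\in A_{(-k)}$ and $y\in A_{(k)}$, insert an approximate unit,
approximated in turn by sums of products $x'y'$ with $x'\in A_{(-l)}$ and $y'\in A_{(l)}$, and
regroup as $(xx')(y'y)$. -/
theorem FullAt.add {k l : ℤ} (hk : FullAt σ k) (hl : FullAt σ l) : FullAt σ (l + k) := by
  intro b hb
  refine map_mem_of_mem_closedProd (ContinuousLinearMap.id ℂ A) (isClosed_closedProd _ _)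
    (fun x hx y hy => ?_) (hk hb)
  have hmem : ∀ c ∈ spectralSubspace σ 0, x * (c * y) ∈ closedProd σ (-(l + k)) (l + k) := by
    intro c hc
    refine map_mem_of_mem_closedProd ((ContinuousLinearMap.mul ℂ A x).comp
      ((ContinuousLinearMap.mul ℂ A).flip y)) (isClosed_closedProd _ _) (fun x' hx' y' hy' => ?_)
      (hl hc)
    change x * (x' * y' * y) ∈ _
    rw [mul_assoc, ← mul_assoc x]
    refine mul_mem_closedProd ?_ (mul_mem_spectralSubspace hy' hy)
    rw [neg_add_rev]
    exact mul_mem_spectralSubspace hx hx'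
  exact closure_minimal (by rintro _ ⟨b, hb, rfl⟩; exact hmem b hb)
    ((isClosed_closedProd _ _).preimage (continuous_const_mul x)) (mem_closure_mul_left hy)

theorem FullAt.nsmul {k : ℤ} (h : FullAt σ k) (n : ℕ) : FullAt σ (n * k) := by
  induction n with
  | zero => simpa using fullAt_zero
  | succ n ih =>
    have := h.add ih
    rwa [Nat.cast_succ, add_mul, one_mul]

theorem fullAt_of_isFull {k : ℤ} (h : (spectralModule σ k).IsFull) : FullAt σ k := by
  intro b hb
  have hb' : (⟨b, hb⟩ : fixedPoints σ) ∈ closure _ := h ⟨b, hb⟩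
  refine map_mem_of_mem_closure_span (fixedPoints σ).toNonUnitalSubalgebra.toSubmodule.subtypeL
    (isClosed_closedProd _ _) ?_ hb'
  rintro _ ⟨⟨x, y⟩, rfl⟩
  exact mul_mem_closedProd (star_mem_spectralSubspace x.2) y.2

end CircleAction

/-! ### Correspondences realized as spectral subspaces -/

namespace CircleAction

open HilbertModule Filter Topology Correspondence

variable {A : Type u} [NonUnitalCStarAlgebra A] {σ : Circle →* (A ≃⋆ₐ[ℂ] A)}

variable (σ) in
/-- An identification of a correspondence over `A_(0)` with the spectral subspace `A_(k)`. -/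
structure Realization (E : Correspondence (fixedPoints σ)) (k : ℤ) where
  map : E.carrier →ₗ[ℂ] A
  range_map : LinearMap.range map = spectralSubspace σ k
  star_map_mul_map : ∀ x y, star (map x) * map y = (E.inner x y : A)
  map_act : ∀ b x, map ((E.φ b).1 x) = (b : A) * map x

namespace Realization

variable {E X : Correspondence (fixedPoints σ)} {k l : ℤ}

/-- Rewriting the degree. -/
def cast (R : Realization σ E k) (h : k = l) : Realization σ E l where
  map := R.map
  range_map := h ▸ R.range_map
  star_map_mul_map := R.star_map_mul_map
  map_act := R.map_act

variable (σ k) in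
/-- The spectral subspace itself. -/
def spectral : Realization σ (spectralCorrespondence σ k) k where
  map := (spectralSubspace σ k).subtype
  range_map := Submodule.range_subtype _
  star_map_mul_map _ _ := rfl
  map_act _ _ := rfl

variable (σ) in
/-- `A_(0)` as a correspondence over itself. -/
def self : Realization σ (Correspondence.self (fixedPoints σ)) 0 where
  map := (spectralSubspace σ 0).subtype
  range_map := Submodule.range_subtype _
  star_map_mul_map _ _ := rfl
  map_act _ _ := rfl

variable (R : Realization σ E k) (R' : Realization σ X l)

theorem map_mem (x : E.carrier) : R.map x ∈ spectralSubspace σ k :=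
  R.range_map ▸ LinearMap.mem_range_self R.map x

theorem exists_map_eq {y : A} (hy : y ∈ spectralSubspace σ k) : ∃ x, R.map x = y := by
  rw [← R.range_map] at hy
  exact hy

theorem norm_map (x : E.carrier) : ‖R.map x‖ = ‖x‖ := by
  have h : ‖R.map x‖ ^ 2 = ‖x‖ ^ 2 := by
    rw [sq, ← CStarRing.norm_star_mul_self, R.star_map_mul_map, E.norm_sq_eq]
    rfl
  exact (pow_left_inj₀ (norm_nonneg _) (norm_nonneg _) two_ne_zero).mp h

theorem isometry_map : Isometry R.map := AddMonoidHomClass.isometry_of_norm R.map R.norm_map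

theorem map_injective : Function.Injective R.map := R.isometry_map.injective

/-- Nondegeneracy of the inner product, read in `A`. It yields compatibility with right actions and
with adjoints, which the definition of `Realization` does not ask for. -/
theorem eq_of_star_mul {x : E.carrier} {y : A} (hy : y ∈ spectralSubspace σ k)
    (h : ∀ z, (E.inner z x : A) = star (R.map z) * y) : R.map x = y := by
  obtain ⟨y, rfl⟩ := R.exists_map_eq hy
  refine congrArg R.map (E.ext_inner fun z => Subtype.ext ?_)
  rw [h, R.star_map_mul_map]

theorem map_rsmul (x : E.carrier) (b : fixedPoints σ) : R.map (E.rsmul x b) = R.map x * b := by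
  refine R.eq_of_star_mul (by simpa using mul_mem_spectralSubspace (R.map_mem x) b.2) fun z => ?_
  rw [E.inner_rsmul_right, ← mul_assoc, R.star_map_mul_map]
  rfl

/-- Since $(az)^*y=z^*(a^*y)$, the adjoint of left multiplication by $a$ can only be left
multiplication by $a^*$. -/
theorem map_of_isAdjoint {T : E.carrier →L[ℂ] X.carrier} {S : X.carrier →L[ℂ] E.carrier}
    (hTS : IsAdjoint (E := E.toHilbertModule) (F := X.toHilbertModule) T S) {a : A}
    {m : ℤ} (ha : a ∈ spectralSubspace σ m) (hm : m + k = l)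
    (hT : ∀ x, R'.map (T x) = a * R.map x) (y : X.carrier) :
    R.map (S y) = star a * R'.map y := by
  refine R.eq_of_star_mul ?_ fun z => ?_
  · have := mul_mem_spectralSubspace (star_mem_spectralSubspace ha) (R'.map_mem y)
    rwa [show -m + l = k by rw [← hm, neg_add_cancel_left]] at this
  · rw [← mul_assoc, ← star_mul, ← hT, R'.star_map_mul_map, hTS.symm]

theorem map_mul_star_map_mem (x y : E.carrier) :
    R.map x * star (R.map y) ∈ spectralSubspace σ 0 := by
  have := mul_mem_spectralSubspace (R.map_mem x) (star_mem_spectralSubspace (R.map_mem y))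
  rwa [add_neg_cancel] at this

/-- This is associativity, $(xy^*)z=x(y^*z)$. It computes $\phi^{-1}(\theta_{x,y})=xy^*$, hence the
inner product of the dual module and the compact operators in the image of $\phi$. -/
theorem φ_map_mul_star_map (x y : E.carrier) :
    E.φ ⟨R.map x * star (R.map y), R.map_mul_star_map_mem x y⟩ = E.theta x y := by
  refine Subtype.ext (ContinuousLinearMap.ext fun z => R.map_injective ?_)
  rw [theta_apply, R.map_act, R.map_rsmul, ← R.star_map_mul_map, ← mul_assoc]

/-- Two realizations of the same degree give a unitary isomorphism. -/
def unitary (R : Realization σ E k) (R' : Realization σ X k) : Unitary E X where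
  toEquiv := (LinearEquiv.ofInjective R.map R.map_injective).trans
    ((LinearEquiv.ofEq _ _ (R.range_map.trans R'.range_map.symm)).trans
      (LinearEquiv.ofInjective R'.map R'.map_injective).symm)
  inner_map x y := Subtype.ext (by
    rw [← R.star_map_mul_map, ← R'.star_map_mul_map]
    simp)
  map_act b x := R'.map_injective (by
    rw [R'.map_act]
    have h := R.map_act b x
    simpa using h)

theorem map_unitary (R : Realization σ E k) (R' : Realization σ X k) (x : E.carrier) :
    R'.map ((R.unitary R').toEquiv x) = R.map x := by
  simp [unitary]

/-! ### Interior tensor products as products in `A` -/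

/-- The multiplication map on the algebraic tensor product. -/
def preTensorMap : (preTensor E.toHilbertModule X).carrier →ₗ[ℂ] A :=
  TensorProduct.lift ((LinearMap.mul ℂ A).compl₁₂ R.map R'.map)

theorem preTensorMap_tmul (x : E.carrier) (y : X.carrier) :
    preTensorMap R R' (x ⊗ₜ y : E.carrier ⊗[ℂ] X.carrier) = R.map x * R'.map y := rfl

/-- On elementary tensors this is $(xy)^*(x'y')=y^*(x^*x')y'$, where $x^*x'\in A_{(0)}$ acts on $y'$
from the left; sesquilinearity does the rest. -/
theorem star_preTensorMap_mul (z w : E.carrier ⊗[ℂ] X.carrier) :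
    star (preTensorMap R R' z) * preTensorMap R R' w
      = ((tensorInner E.toHilbertModule X z w : fixedPoints σ) : A) := by
  induction z with
  | zero =>
    rw [map_zero, LinearMap.zero_apply]
    erw [map_zero (preTensorMap R R')]
    rw [star_zero, zero_mul]
    rfl
  | add a b ha hb =>
    erw [map_add (preTensorMap R R')]
    rw [star_add, add_mul, ha, hb, map_add, LinearMap.add_apply]
    rfl
  | tmul x y =>
    induction w with
    | zero =>
      rw [map_zero]
      erw [map_zero (preTensorMap R R')]
      rw [mul_zero]
      rfl
    | add a b ha hb =>
      erw [map_add (preTensorMap R R')]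
      rw [mul_add, ha, hb, map_add]
      rfl
    | tmul x' y' =>
      rw [preTensorMap_tmul, preTensorMap_tmul, tensorInner_tmul_tmul, ← R'.star_map_mul_map]
      change _ = _ * R'.map ((X.φ _).1 y')
      rw [R'.map_act, ← R.star_map_mul_map, star_mul]
      simp only [mul_assoc]

theorem norm_preTensorMap (z : (preTensor E.toHilbertModule X).carrier) :
    ‖preTensorMap R R' z‖ = ‖z‖ := by
  have h : ‖preTensorMap R R' z‖ ^ 2 = ‖z‖ ^ 2 := by
    rw [sq, ← CStarRing.norm_star_mul_self, PreHilbertModule.norm_sq_eq]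
    exact congrArg norm (star_preTensorMap_mul R R' z z)
  exact (pow_left_inj₀ (norm_nonneg _) (norm_nonneg _) two_ne_zero).mp h

/-- The multiplication map on the interior tensor product. -/
def tensorMap : (tensorModule E.toHilbertModule X).carrier →L[ℂ] A :=
  (preTensor E.toHilbertModule X).extend
    ((preTensorMap R R').mkContinuous 1 fun z => by rw [norm_preTensorMap, one_mul])

theorem tensorMap_toCompletion (z : (preTensor E.toHilbertModule X).carrier) :
    tensorMap R R' ((preTensor E.toHilbertModule X).toCompletion z) = preTensorMap R R' z :=
  (preTensor E.toHilbertModule X).extend_toCompletion _ z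

theorem tensorMap_tmul (x : E.carrier) (y : X.carrier) :
    tensorMap R R' (tmul E.toHilbertModule X x y) = R.map x * R'.map y :=
  tensorMap_toCompletion R R' _

theorem star_tensorMap_mul (z w : (tensorModule E.toHilbertModule X).carrier) :
    star (tensorMap R R' z) * tensorMap R R' w
      = ((tensorModule E.toHilbertModule X).inner z w : A) := by
  refine (preTensor E.toHilbertModule X).denseRange_toCompletion.induction_on₂
    (p := fun z w => star (tensorMap R R' z) * tensorMap R R' w
      = ((tensorModule E.toHilbertModule X).inner z w : A))
    ?_ (fun z w => ?_) z w
  · have h1 := continuous_subtype_val.comp (tensorModule E.toHilbertModule X).continuous_inner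
    have h2 := (tensorMap R R').continuous
    exact isClosed_eq ((h2.comp continuous_fst).star.mul (h2.comp continuous_snd)) h1
  · rw [tensorMap_toCompletion, tensorMap_toCompletion]
    refine (star_preTensorMap_mul R R' z w).trans ?_
    exact congrArg Subtype.val ((preTensor E.toHilbertModule X).inner_toCompletion z w).symm

theorem tensorMap_act (b : fixedPoints σ)
    (z : (tensorModule E.toHilbertModule X).carrier) :
    tensorMap R R' (ampl E.toHilbertModule X (E.φ b) z) = b * tensorMap R R' z := by
  have h : (tensorMap R R').comp (ampl E.toHilbertModule X (E.φ b))
      = (ContinuousLinearMap.mul ℂ A (b : A)).comp (tensorMap R R') := by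
    refine (preTensor E.toHilbertModule X).ext_completion fun z => ?_
    rw [ContinuousLinearMap.comp_apply, ContinuousLinearMap.comp_apply, ampl_toCompletion,
      tensorMap_toCompletion, tensorMap_toCompletion, ContinuousLinearMap.mul_apply']
    have h : preTensorMap R R' ∘ₗ preAmpl E.toHilbertModule X (E.φ b)
        = LinearMap.mulLeft ℂ (b : A) ∘ₗ preTensorMap R R' := by
      refine TensorProduct.ext' (M := E.carrier) (N := X.carrier) fun x y => ?_
      change R.map ((E.φ b).1 x) * R'.map y = b * (R.map x * R'.map y)
      rw [R.map_act, mul_assoc]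
    exact LinearMap.congr_fun h z
  exact congrArg (fun f => f z) h

/-- The map is isometric on a complete space, so its range is closed; it contains all products, and
fullness makes these span a dense subspace of $A_{(k+l)}$. -/
theorem range_tensorMap (hk : FullAt σ (-k)) :
    LinearMap.range (tensorMap R R').toLinearMap = spectralSubspace σ (k + l) := by
  have hiso : Isometry (tensorMap R R') := by
    refine AddMonoidHomClass.isometry_of_norm _ fun z => ?_
    have h : ‖tensorMap R R' z‖ ^ 2 = ‖z‖ ^ 2 := by
      rw [sq, ← CStarRing.norm_star_mul_self, star_tensorMap_mul,
        (tensorModule E.toHilbertModule X).norm_sq_eq]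
      rfl
    exact (pow_left_inj₀ (norm_nonneg _) (norm_nonneg _) two_ne_zero).mp h
  apply le_antisymm
  · rintro _ ⟨z, rfl⟩
    refine (preTensor E.toHilbertModule X).denseRange_toCompletion.induction_on
      (p := fun z => tensorMap R R' z ∈ spectralSubspace σ (k + l)) z
      ((isClosed_spectralSubspace σ _).preimage (tensorMap R R').continuous) fun z => ?_
    rw [tensorMap_toCompletion]
    change E.carrier ⊗[ℂ] X.carrier at z
    induction z with
    | zero => exact (map_zero (preTensorMap R R')).symm ▸ zero_mem _
    | add a b ha hb => exact (map_add (preTensorMap R R') a b).symm ▸ add_mem ha hb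
    | tmul x y => exact mul_mem_spectralSubspace (R.map_mem x) (R'.map_mem y)
  · refine (hk.le_closedProd l).trans fun w hw => ?_
    refine map_mem_of_mem_closedProd (ContinuousLinearMap.id ℂ A) ?_ (fun x hx y hy => ?_) hw
    · exact hiso.isClosedEmbedding.isClosed_range
    · obtain ⟨x, rfl⟩ := R.exists_map_eq hx
      obtain ⟨y, rfl⟩ := R'.exists_map_eq hy
      exact ⟨_, tensorMap_tmul R R' x y⟩

/-- The interior tensor product, realized by multiplication. -/
def tensor (hk : FullAt σ (-k)) : Realization σ (Correspondence.tensor E X) (k + l) where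
  map := (tensorMap R R').toLinearMap
  range_map := range_tensorMap R R' hk
  star_map_mul_map := star_tensorMap_mul R R'
  map_act := tensorMap_act R R'

/-! ### Duals, tensor powers, and the operators $S_\xi$ as multiplications -/

/-- The realization of the dual module, by `λ_ξ ↦ ξ*`. -/
def dual (h : E.IsPimsnerPair) : Realization σ (E.dual h) (-k) where
  map :=
    { toFun := fun l => star (R.map (E.ofDual l))
      map_add' := fun l m =>
        (congrArg star (map_add R.map (E.ofDual l) (E.ofDual m))).trans (star_add _ _)
      map_smul' := fun c l => (congrArg star (map_smul R.map (star c) (E.ofDual l))).trans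
        (by rw [star_smul, star_star]; rfl) }
  range_map := by
    ext y
    constructor
    · rintro ⟨l, rfl⟩
      exact star_mem_spectralSubspace (R.map_mem _)
    · intro hy
      have := star_mem_spectralSubspace hy
      rw [neg_neg] at this
      obtain ⟨x, hx⟩ := R.exists_map_eq this
      refine ⟨E.toDual x, ?_⟩
      change star (R.map x) = y
      rw [hx, star_star]
  star_map_mul_map l m := by
    -- For $l=\lambda_\xi$ and $m=\lambda_\eta$:
    -- $\phi^{-1}(\theta_{\xi,\eta})=\xi\eta^*=(\xi^*)^*\eta^*$.
    have : leftInner E h (E.ofDual l) (E.ofDual m)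
        = ⟨R.map (E.ofDual l) * star (R.map (E.ofDual m)), R.map_mul_star_map_mem _ _⟩ :=
      h.injective (by rw [φ_leftInner, φ_map_mul_star_map])
    change star (star (R.map (E.ofDual l))) * star (R.map (E.ofDual m))
      = ((leftInner E h (E.ofDual l) (E.ofDual m) : fixedPoints σ) : A)
    rw [this, star_star]
  map_act b l := by
    change star (R.map (E.rsmul (E.ofDual l) (star b))) = b * star (R.map (E.ofDual l))
    rw [R.map_rsmul, star_mul]
    congr 1
    exact star_star (b : A)

theorem dual_map_toDual (h : E.IsPimsnerPair) (x : E.carrier) :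
    (R.dual h).map (E.toDual x) = star (R.map x) := rfl

/-- The realization of a tensor power with `n + 1` factors. -/
def tpowSucc (hk : FullAt σ (-k)) : (n : ℕ) → Realization σ (E.tpowSucc n) ((n + 1 : ℕ) * k)
  | 0 => R.cast (by simp)
  | n + 1 => (R.tensor (tpowSucc hk n) hk).cast (by push_cast; ring)

/-- The realization of a tensor power. -/
def tpow (hk : FullAt σ (-k)) : (n : ℕ) → Realization σ (E.tpow n) (n * k)
  | 0 => (self σ).cast (by simp)
  | n + 1 => R.tpowSucc hk n

/-- Right multiplication of $x$ by an element of $A_{(0)}$ in degree zero and the tensor $x\otimes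
y$ in higher degrees both become the product in `A`. -/
theorem tpow_map_raise (hk : FullAt σ (-k)) (x : E.carrier) (n : ℕ) (y : (E.tpow n).carrier) :
    (R.tpow hk (n + 1)).map (E.raise x n y) = R.map x * (R.tpow hk n).map y := by
  cases n with
  | zero => exact R.map_rsmul x y
  | succ n => exact tensorMap_tmul R (R.tpowSucc hk n) x y

/-- The lowering operator is the adjoint of the raising operator, so no computation with tensors is
needed. -/
theorem tpow_map_lower (hk : FullAt σ (-k)) (x : E.carrier) (n : ℕ)
    (y : (E.tpow (n + 1)).carrier) :
    (R.tpow hk n).map (E.lower x n y) = star (R.map x) * (R.tpow hk (n + 1)).map y :=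
  map_of_isAdjoint _ _ (isAdjoint_raise E x n) (R.map_mem x) (by push_cast; ring)
    (R.tpow_map_raise hk x n) y

theorem tpowSucc_map_tprodSucc (hk : FullAt σ (-k)) (n : ℕ) (x : Fin (n + 1) → E.carrier) :
    (R.tpowSucc hk n).map (E.tprodSucc n x) = prodSucc n fun i => R.map (x i) := by
  induction n with
  | zero => rfl
  | succ n ih =>
    refine (tensorMap_tmul R (R.tpowSucc hk n) (x 0) _).trans ?_
    rw [ih]
    rfl

theorem tpow_map_tprod (hk : FullAt σ (-k)) {n : ℕ} (hn : 0 < n) (x : Fin n → E.carrier) :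
    (R.tpow hk n).map (E.tprod n x) = prod n fun i => R.map (x i) := by
  obtain ⟨n, rfl⟩ := Nat.exists_eq_succ_of_ne_zero hn.ne'
  exact R.tpowSucc_map_tprodSucc hk n x

/-- The realization of the modules `E^(n)`, `n ∈ ℤ`. -/
def zpow (h : E.IsPimsnerPair) (hk : FullAt σ (-k)) (hk' : FullAt σ k) :
    (n : ℤ) → Realization σ (E.zpow h n) (n * k)
  | Int.ofNat n => R.tpow hk n
  -- The dual is realized in degree $-k$, so its tensor powers need fullness at $-(-k)=k$.
  | Int.negSucc n => ((R.dual h).tpow (by rwa [neg_neg]) (n + 1)).cast (by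
      rw [Int.negSucc_eq]
      push_cast
      ring)

/-- The aim of the realizations: the cases in the definition of $S_\xi$ merge into one
multiplication. In negative degrees $S_\xi$ is the lowering operator of $E^*$ at $\lambda_\xi$,
hence multiplication by $(\xi^*)^*=\xi$. -/
theorem zpow_map_shift (h : E.IsPimsnerPair) (hk : FullAt σ (-k)) (hk' : FullAt σ k)
    (x : E.carrier) (n : ℤ) (y : (E.zpow h n).carrier) :
    (R.zpow h hk hk' (n + 1)).map (E.shift h x n y) = R.map x * (R.zpow h hk hk' n).map y :=
  match n with
  | Int.ofNat n => R.tpow_map_raise hk x n y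
  -- Degree $-1$ is mapped to $E^{(0)}=A_{(0)}$, the zeroth power of both $E$ and $E^*$, with the
  -- same realization.
  | Int.negSucc 0 => by
    have := (R.dual h).tpow_map_lower (by rwa [neg_neg]) (E.toDual x) 0 y
    rwa [dual_map_toDual, star_star] at this
  | Int.negSucc (n + 1) => by
    have := (R.dual h).tpow_map_lower (by rwa [neg_neg]) (E.toDual x) (n + 1) y
    rwa [dual_map_toDual, star_star] at this

end Realization
end CircleAction

/-! ### Separability, and the condition $(\ast)$ -/

namespace CircleAction

open HilbertModule Filter Topology Correspondence TopologicalSpace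

variable {A : Type u} [NonUnitalCStarAlgebra A] {σ : Circle →* (A ≃⋆ₐ[ℂ] A)}

theorem FullAt.isFull {k : ℤ} (h : FullAt σ k) : (spectralModule σ k).IsFull := by
  intro b
  rw [closure_subtype]
  have hb := h b.2
  refine map_mem_of_mem_closedProd (ContinuousLinearMap.id ℂ A)
    (K := ((Submodule.span ℂ (Set.range fun p : (spectralModule σ k).carrier ×
      (spectralModule σ k).carrier => (spectralModule σ k).inner p.1 p.2)).map
        (fixedPoints σ).toNonUnitalSubalgebra.toSubmodule.subtype).topologicalClosure)
    (Submodule.isClosed_topologicalClosure _) (fun x hx y hy => ?_) hb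
  refine Submodule.le_topologicalClosure _ ⟨(spectralModule σ k).inner
    (⟨star x, by simpa using star_mem_spectralSubspace hx⟩ : spectralSubspace σ k)
    (⟨y, hy⟩ : spectralSubspace σ k), Submodule.subset_span ⟨(_, _), rfl⟩, ?_⟩
  change star (star x) * y = x * y
  rw [star_star]

/-- Each $\xi\cdot A_{(0)}$ is a continuous image of a separable space, and countably many of these
have dense span. -/
theorem isSeparable_spectralSubspace_of_isCountablyGenerated {k : ℤ}
    [SeparableSpace (fixedPoints σ)] (h : (spectralModule σ k).IsCountablyGenerated) :
    IsSeparable (spectralSubspace σ k : Set A) := by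
  obtain ⟨s, hs, hd⟩ := h
  have h1 : IsSeparable {x | ∃ ξ ∈ s, ∃ b : fixedPoints σ, x = (spectralModule σ k).rsmul ξ b} := by
    have e : {x | ∃ ξ ∈ s, ∃ b : fixedPoints σ, x = (spectralModule σ k).rsmul ξ b}
        = ⋃ ξ : s, Set.range ((spectralModule σ k).rsmulL ξ.1) := by
      ext x
      simp [rsmulL_apply, eq_comm]
    rw [e]
    have := hs.to_subtype
    exact .iUnion fun ξ => isSeparable_range ((spectralModule σ k).rsmulL ξ.1).continuous
  have h2 := (h1.span (R := ℂ)).closure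
  rw [hd.closure_eq] at h2
  have h3 := h2.image (f := (spectralSubspace σ k).subtypeL)
    (spectralSubspace σ k).subtypeL.continuous
  exact h3.mono fun x hx => ⟨⟨x, hx⟩, trivial, rfl⟩

/-- Separability passes to products and closed spans. It replaces countable generation because it is
easier to carry to $A_{(d)}$. -/
theorem isSeparable_spectralSubspace_add {k l : ℤ} (hk : FullAt σ (-k))
    (h : IsSeparable (spectralSubspace σ k : Set A))
    (h' : IsSeparable (spectralSubspace σ l : Set A)) :
    IsSeparable (spectralSubspace σ (k + l) : Set A) := by
  have h1 : IsSeparable (Set.image2 (· * ·) (spectralSubspace σ k : Set A)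
      (spectralSubspace σ l : Set A)) := by
    rw [← Set.image_prod]
    exact (h.prod h').image continuous_mul
  exact (h1.span (R := ℂ)).closure.mono (hk.le_closedProd l)

theorem isSeparable_spectralSubspace_nsmul {k : ℤ} (hk : FullAt σ (-k))
    (h : IsSeparable (spectralSubspace σ k : Set A)) {n : ℕ} (hn : 0 < n) :
    IsSeparable (spectralSubspace σ (n * k) : Set A) := by
  induction n, hn using Nat.le_induction with
  | base => simpa using h
  | succ n _ ih =>
    have := isSeparable_spectralSubspace_add hk h ih
    rwa [show ((n + 1 : ℕ) : ℤ) * k = k + n * k by push_cast; ring]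

namespace Realization

variable {E : Correspondence (fixedPoints σ)} {k : ℤ}

/-- Fullness of $A_{(-k)}$ makes $\phi$ injective and relates its image to the compact operators
through $\phi(xy^*)=\theta_{x,y}$; fullness of $A_{(k)}$ is fullness of $E$; separability gives
countable generation. -/
theorem isPimsnerPair (R : Realization σ E k) [SeparableSpace (fixedPoints σ)]
    (hk : FullAt σ (-k)) (hk' : FullAt σ k)
    (hsep : IsSeparable (spectralSubspace σ k : Set A)) : E.IsPimsnerPair := by
  have hinj : Function.Injective E.φ := by
    rw [injective_iff_map_eq_zero]
    intro b hb
    have h1 : ∀ x ∈ spectralSubspace σ k, (b : A) * x = 0 := fun x hx => by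
      obtain ⟨x, rfl⟩ := R.exists_map_eq hx
      rw [← R.map_act, hb]
      exact map_zero _
    -- As $b$ kills $A_{(k)}$, it kills the closed span of $A_{(k)}A_{(-k)}$, which contains
    -- $A_{(0)}$ and in particular $b^*$.
    have h2 : (b : A) * star (b : A) ∈ (⊥ : Submodule ℂ A) := by
      refine map_mem_of_mem_closedProd (ContinuousLinearMap.mul ℂ A b) (by simp)
        (fun x hx y _ => ?_) (hk (star_mem (s := fixedPoints σ) b.2))
      rw [neg_neg] at hx
      rw [ContinuousLinearMap.mul_apply', ← mul_assoc, h1 x hx, zero_mul]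
      exact zero_mem _
    exact Subtype.ext ((CStarRing.mul_star_self_eq_zero_iff _).mp ((Submodule.mem_bot ℂ).mp h2))
  have hφ := NonUnitalStarAlgHom.isometry E.φ hinj
  refine ⟨inferInstance, ?_, ?_, hinj, ?_⟩
  · obtain ⟨t, htsub, ht, htd⟩ := hsep.exists_countable_dense_subset
    refine ⟨R.map ⁻¹' t, ht.preimage_of_injOn R.map_injective.injOn, fun x => ?_⟩
    -- The generated submodule consists of combinations of $\xi\cdot b$, so $\xi$ itself has to be
    -- recovered with an approximate unit acting from the right.
    have h1 : R.map ⁻¹' t ⊆ closure (Submodule.span ℂ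
        {x | ∃ ξ ∈ R.map ⁻¹' t, ∃ b : fixedPoints σ, x = E.rsmul ξ b} : Set E.carrier) := by
      intro ξ hξ
      rw [R.isometry_map.isEmbedding.isInducing.closure_eq_preimage_closure_image]
      refine closure_mono ?_ (mem_closure_mul_right (R.map_mem ξ))
      rintro _ ⟨b, hb, rfl⟩
      exact ⟨_, Submodule.subset_span ⟨ξ, hξ, ⟨b, hb⟩, rfl⟩, R.map_rsmul ξ ⟨b, hb⟩⟩
    refine closure_minimal h1 isClosed_closure ?_
    rw [R.isometry_map.isEmbedding.isInducing.closure_eq_preimage_closure_image,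
      Set.image_preimage_eq_inter_range]
    have h2 : t ∩ Set.range R.map = t := by
      refine Set.inter_eq_left.mpr fun y hy => ?_
      exact R.exists_map_eq (htsub hy)
    rw [h2]
    exact htd (R.map_mem x)
  · have := hk'.isFull
    unfold IsFull at this ⊢
    have e : (Set.range fun p : (spectralModule σ k).carrier × (spectralModule σ k).carrier =>
        (spectralModule σ k).inner p.1 p.2)
        = Set.range fun p : E.carrier × E.carrier => E.inner p.1 p.2 := by
      ext b
      constructor
      · rintro ⟨⟨x, y⟩, rfl⟩
        obtain ⟨x', hx⟩ := R.exists_map_eq x.2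
        obtain ⟨y', hy⟩ := R.exists_map_eq y.2
        refine ⟨(x', y'), Subtype.ext ?_⟩
        rw [← R.star_map_mul_map, hx, hy]
        rfl
      · rintro ⟨⟨x, y⟩, rfl⟩
        exact ⟨((⟨_, R.map_mem x⟩ : spectralSubspace σ k),
          (⟨_, R.map_mem y⟩ : spectralSubspace σ k)),
          Subtype.ext (R.star_map_mul_map x y)⟩
    rwa [← e]
  · let L : fixedPoints σ →L[ℂ] E.Adjointable :=
      ⟨{ toFun := E.φ, map_add' := map_add E.φ, map_smul' := map_smul E.φ }, hφ.continuous⟩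
    have hL : ∀ b, L b = E.φ b := fun _ => rfl
    have hcl : IsClosed (LinearMap.range L.toLinearMap : Set E.Adjointable) :=
      hφ.isClosedEmbedding.isClosed_range
    apply Set.Subset.antisymm
    -- By fullness of $A_{(-k)}$, $b$ is a limit of sums of elements $xy^*$ with $x,y\in A_{(k)}$,
    -- and $\phi$ sends these to rank one operators.
    · rintro _ ⟨b, rfl⟩
      refine map_mem_of_mem_closure_span L (Submodule.isClosed_topologicalClosure _) ?_
        (hk.isFull b)
      rintro _ ⟨⟨x, y⟩, rfl⟩
      have hx := star_mem_spectralSubspace x.2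
      have hy := star_mem_spectralSubspace y.2
      rw [neg_neg] at hx hy
      obtain ⟨x', hx⟩ := R.exists_map_eq hx
      obtain ⟨y', hy⟩ := R.exists_map_eq hy
      have e : (spectralModule σ (-k)).inner x y
          = ⟨R.map x' * star (R.map y'), R.map_mul_star_map_mem x' y'⟩ := by
        refine Subtype.ext ?_
        change star x.1 * y.1 = R.map x' * star (R.map y')
        rw [hx, hy, star_star]
      change E.φ ((spectralModule σ (-k)).inner x y) ∈ E.compacts
      rw [e, R.φ_map_mul_star_map]
      exact E.theta_mem_compacts _ _
    -- The image of $\phi$ is closed since $\phi$ is isometric, and it contains every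
    -- $\theta_{x,y}$.
    · refine Submodule.topologicalClosure_minimal _ (t := LinearMap.range L.toLinearMap) ?_ hcl
      rw [Submodule.span_le]
      rintro _ ⟨⟨x, y⟩, rfl⟩
      exact ⟨_, R.φ_map_mul_star_map x y⟩

end Realization
end CircleAction

/-! ### Summands of the Hilbert module direct sum -/

namespace HilbertModule

variable {B : Type u} [NonUnitalCStarAlgebra B] (F : ℤ → HilbertModule B)

/-- The inclusion of a summand of the direct sum, as a linear map. -/
def directSumOfₗ (n : ℤ) : (F n).carrier →ₗ[ℂ] (directSum F).carrier :=
  (preSum F).toCompletion.toLinearMap ∘ₗ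
    (DFinsupp.lsingle (R := ℂ) (M := fun n => (F n).carrier) n :
      (F n).carrier →ₗ[ℂ] (preSum F).carrier)

theorem inner_directSumOf (n : ℤ) (x y : (F n).carrier) :
    (directSum F).inner (directSumOf F n x) (directSumOf F n y) = (F n).inner x y := by
  classical
  refine ((preSum F).inner_toCompletion _ _).trans ?_
  change sumInner F (DFinsupp.single n x) (DFinsupp.single n y) = _
  rw [sumInner_eq_left F _ _ {n} DFinsupp.support_single_subset, Finset.sum_singleton,
    DFinsupp.single_eq_same, DFinsupp.single_eq_same]

theorem inner_directSumOf_of_ne {m n : ℤ} (h : m ≠ n) (x : (F m).carrier) (y : (F n).carrier) :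
    (directSum F).inner (directSumOf F m x) (directSumOf F n y) = 0 := by
  classical
  refine ((preSum F).inner_toCompletion _ _).trans ?_
  change sumInner F (DFinsupp.single m x) (DFinsupp.single n y) = _
  rw [sumInner_eq_left F _ _ {m} DFinsupp.support_single_subset, Finset.sum_singleton,
    DFinsupp.single_eq_of_ne h, (F m).inner_zero_right]

theorem norm_directSumOf (n : ℤ) (x : (F n).carrier) : ‖directSumOf F n x‖ = ‖x‖ := by
  have h : ‖directSumOf F n x‖ ^ 2 = ‖x‖ ^ 2 := by
    rw [(directSum F).norm_sq_eq, inner_directSumOf, (F n).norm_sq_eq]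
  exact (pow_left_inj₀ (norm_nonneg _) (norm_nonneg _) two_ne_zero).mp h

variable {F}

theorem directSum_induction {p : (directSum F).carrier → Prop} (hcl : IsClosed {x | p x})
    (hof : ∀ n x, p (directSumOf F n x)) (h0 : p 0) (hadd : ∀ x y, p x → p y → p (x + y))
    (x : (directSum F).carrier) : p x := by
  refine (preSum F).denseRange_toCompletion.induction_on x hcl fun x => ?_
  change Π₀ n, (F n).carrier at x
  classical
  induction x using DFinsupp.induction with
  | h0 => exact (map_zero (preSum F).toCompletion).symm ▸ h0
  | ha n x f _ _ hf =>
    exact (map_add (preSum F).toCompletion (DFinsupp.single n x : Π₀ n, (F n).carrier) f).symm ▸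
      hadd _ _ (hof n x) hf

theorem directSum_ext {x y : (directSum F).carrier}
    (h : ∀ n z, (directSum F).inner (directSumOf F n z) x
      = (directSum F).inner (directSumOf F n z) y) : x = y := by
  refine (directSum F).ext_inner fun z => directSum_induction
    (p := fun z => (directSum F).inner z x = (directSum F).inner z y) ?_ h ?_ ?_ z
  · have := (directSum F).continuous_inner
    exact isClosed_eq (this.comp (continuous_id.prodMk continuous_const))
      (this.comp (continuous_id.prodMk continuous_const))
  · rw [inner_zero_left, inner_zero_left]
  · intro z w hz hw
    rw [inner_add_left, inner_add_left, hz, hw]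

theorem directSum_op_eq_zero {T : (directSum F).Adjointable}
    (h : ∀ n x, T.1 (directSumOf F n x) = 0) : T = 0 := by
  refine Subtype.ext (ContinuousLinearMap.ext fun x => directSum_induction
    (p := fun x => T.1 x = 0) (isClosed_eq T.1.continuous continuous_const) h (map_zero _)
    (fun x y hx hy => ?_) x)
  rw [map_add, hx, hy, add_zero]

end HilbertModule

/-! ### Norms of homogeneous components, and removal of a linear factor -/

namespace CircleAction

variable {A : Type u} [NonUnitalCStarAlgebra A] {σ : Circle →* (A ≃⋆ₐ[ℂ] A)}

theorem exists_circle_primitiveRoot {N : ℕ} (hN : N ≠ 0) :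
    ∃ ζ : Circle, IsPrimitiveRoot (ζ : ℂ) N := by
  refine ⟨Circle.exp (2 * Real.pi / N), ?_⟩
  rw [Circle.coe_exp]
  convert Complex.isPrimitiveRoot_exp N hN using 2
  push_cast
  ring

/-- A geometric sum whose ratio is an $N$-th root of unity, different from $1$ because $0<|m|<N$. -/
theorem sum_zpow_primitiveRoot {N : ℕ} {ζ : ℂ} (hζ : IsPrimitiveRoot ζ N) {m : ℤ} (hm : m ≠ 0)
    (hmN : m.natAbs < N) : ∑ j ∈ Finset.range N, (ζ ^ m) ^ j = 0 := by
  have h1 : ζ ^ m ≠ 1 := fun h => by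
    have := (hζ.zpow_eq_one_iff_dvd m).mp h
    exact hm (Int.eq_zero_of_dvd_of_natAbs_lt_natAbs this (by simpa using hmN))
  have h2 := mul_geom_sum (ζ ^ m) N
  rw [← zpow_natCast (ζ ^ m), ← zpow_mul, mul_comm m, zpow_mul, zpow_natCast, hζ.pow_eq_one,
    one_zpow, sub_self] at h2
  exact (mul_eq_zero.mp h2).resolve_left (sub_ne_zero.mpr h1)

/-- The homogeneous components of a finite sum have at most the norm of the sum. -/
theorem norm_component_le {s : Finset ℤ} {e : ℤ → ℤ} (he : Function.Injective e) {a : ℤ → A}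
    (ha : ∀ n, a n ∈ spectralSubspace σ (e n)) {n₀ : ℤ} (hn₀ : n₀ ∈ s) :
    ‖a n₀‖ ≤ ‖∑ n ∈ s, a n‖ := by
  -- Any $N$ above all $|e(n_0)-e(n)|$ would do: the characters that occur are then distinct on the
  -- $N$-th roots of unity.
  set N : ℕ := ∑ n ∈ s, (e n₀ - e n).natAbs + 1 with hN
  have hN0 : N ≠ 0 := Nat.succ_ne_zero _
  obtain ⟨ζ, hζ⟩ := exists_circle_primitiveRoot hN0
  -- A discrete Fourier coefficient: $\sigma_z$ multiplies $a_n$ by $z^{-e(n)}$, so summing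
  -- $z^{e(n_0)}\sigma_z$ over the $N$-th roots of unity leaves $N$ copies of $a_{n_0}$.
  have key : ∑ j ∈ Finset.range N, ((ζ : ℂ) ^ e n₀) ^ j • σ (ζ ^ j) (∑ n ∈ s, a n)
      = (N : ℂ) • a n₀ := by
    have h1 : ∀ n ∈ s, ∑ j ∈ Finset.range N, ((ζ : ℂ) ^ e n₀) ^ j • σ (ζ ^ j) (a n)
        = (∑ j ∈ Finset.range N, ((ζ : ℂ) ^ (e n₀ - e n)) ^ j) • a n := fun n _ => by
      rw [Finset.sum_smul]
      refine Finset.sum_congr rfl fun j _ => ?_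
      rw [ha n, smul_smul]
      congr 1
      rw [Circle.coe_zpow, Circle.coe_pow, sub_eq_add_neg, zpow_add₀ ζ.coe_ne_zero, mul_pow,
        ← zpow_natCast ((ζ : ℂ) ^ (-e n)), ← zpow_mul, ← zpow_natCast (ζ : ℂ), ← zpow_mul,
        mul_comm (j : ℤ)]
    simp_rw [map_sum, Finset.smul_sum]
    rw [Finset.sum_comm, Finset.sum_congr rfl h1, Finset.sum_eq_single_of_mem n₀ hn₀]
    · simp
    · intro n hn hne
      rw [sum_zpow_primitiveRoot hζ (sub_ne_zero.mpr fun h => hne (he h).symm), zero_smul]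
      rw [hN, Nat.lt_succ_iff]
      exact Finset.single_le_sum (f := fun n => (e n₀ - e n).natAbs) (fun _ _ => Nat.zero_le _) hn
  have h2 : (N : ℝ) * ‖a n₀‖ ≤ N * ‖∑ n ∈ s, a n‖ := by
    calc (N : ℝ) * ‖a n₀‖ = ‖(N : ℂ) • a n₀‖ := by rw [norm_smul, Complex.norm_natCast]
      _ ≤ ∑ j ∈ Finset.range N, ‖∑ n ∈ s, a n‖ := by
          rw [← key]
          refine norm_sum_le_of_le _ fun j _ => ?_
          rw [norm_smul, norm_pow, norm_zpow, Circle.norm_coe, one_zpow, one_pow, one_mul]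
          exact (NonUnitalStarAlgHom.norm_map (σ (ζ ^ j)) (σ (ζ ^ j)).injective _).le
      _ = _ := by simp
  exact le_of_mul_le_mul_left h2 (by positivity)

/-- If $t/s>1$, its powers would outgrow every linear function of the exponent $2^j$. -/
theorem le_of_pow_two_pow_le {s t M : ℝ} (hs : 0 ≤ s)
    (h : ∀ j : ℕ, t ^ 2 ^ j ≤ (2 ^ j * M + 1) * s ^ 2 ^ j) : t ≤ s := by
  by_contra! hlt
  -- For $s=0$ the quotient $t/s$ is of no use, but the hypothesis for $j=0$ already gives $t\le0$.
  rcases hs.eq_or_lt with rfl | hs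
  · have := h 0
    simp at this
    linarith
  have hr : 1 < t / s := (one_lt_div hs).mpr hlt
  have h1 : Filter.Tendsto (fun n : ℕ => (n : ℝ) / (t / s) ^ n * M + 1 / (t / s) ^ n)
      Filter.atTop (nhds 0) := by
    have h2 := tendsto_pow_const_div_const_pow_of_one_lt 1 hr
    have h3 := tendsto_pow_const_div_const_pow_of_one_lt 0 hr
    simp only [pow_one, pow_zero] at h2 h3
    simpa using (h2.mul_const M).add h3
  have h2 := h1.comp (tendsto_pow_atTop_atTop_of_one_lt (one_lt_two (α := ℕ)))
  refine absurd (ge_of_tendsto h2 (b := 1) (Filter.Eventually.of_forall fun j => ?_)) (by norm_num)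
  have h3 : 0 < (t / s) ^ 2 ^ j := by positivity
  have h4 := h j
  simp only [Function.comp_apply]
  rw [div_mul_eq_mul_div, ← add_div, le_div_iff₀ h3, one_mul, div_pow, div_le_iff₀ (by positivity)]
  push_cast
  exact h4

end CircleAction

/-! ### Pairs of an element of `A` and an operator on $E_\infty$ -/

namespace CircleAction

open HilbertModule Correspondence

variable {A : Type u} [NonUnitalCStarAlgebra A] {σ : Circle →* (A ≃⋆ₐ[ℂ] A)}

namespace Realization

variable {E : Correspondence (fixedPoints σ)} {k : ℤ} (R : Realization σ E k)
  (h : E.IsPimsnerPair) (hk : FullAt σ (-k)) (hk' : FullAt σ k)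

/-- The element `x` of `E^(n)`, as an element of `E_∞`. -/
abbrev ofDeg (E : Correspondence (fixedPoints σ)) (h : E.IsPimsnerPair) (n : ℤ)
    (x : (E.zpow h n).carrier) : (E.infinity h).carrier :=
  directSumOf (fun n => (E.zpow h n).toHilbertModule) n x

/-- The pairs of an element `a` of `A_(nk)` and an operator on `E_∞` that acts as the left
multiplication by `a`, as expressed by its matrix coefficients. -/
def homog (n : ℤ) : Submodule ℂ (A × (E.infinity h).Adjointable) where
  -- Comparing matrix coefficients in `A` avoids identifying summands whose degrees are only
  -- propositionally equal, and it gives conditions that are visibly linear and closed.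
  carrier := {c | c.1 ∈ spectralSubspace σ (n * k) ∧
    ∀ m j (x : (E.zpow h m).carrier) (z : (E.zpow h j).carrier),
      ((E.infinity h).inner (ofDeg E h j z) (c.2.1 (ofDeg E h m x)) : A) =
        if j = n + m then
          star ((R.zpow h hk hk' j).map z) * (c.1 * (R.zpow h hk hk' m).map x) else 0}
  zero_mem' := by
    refine ⟨zero_mem _, fun m j x z => ?_⟩
    change (((E.infinity h).inner _ 0 : fixedPoints σ) : A) = _
    rw [HilbertModule.inner_zero_right]
    simp
  add_mem' := by
    rintro c c' ⟨hc, hT⟩ ⟨hc', hT'⟩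
    refine ⟨add_mem hc hc', fun m j x z => ?_⟩
    change (((E.infinity h).inner _ (c.2.1 _ + c'.2.1 _) : fixedPoints σ) : A) = _
    rw [(E.infinity h).inner_add_right]
    refine (congrArg₂ (· + ·) (hT m j x z) (hT' m j x z)).trans ?_
    split_ifs
    · rw [Prod.fst_add, add_mul, mul_add]
    · exact add_zero _
  smul_mem' := by
    rintro t c ⟨hc, hT⟩
    refine ⟨Submodule.smul_mem _ t hc, fun m j x z => ?_⟩
    change (((E.infinity h).inner _ (t • c.2.1 _) : fixedPoints σ) : A) = _
    rw [(E.infinity h).inner_smul_right]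
    refine (congrArg (t • ·) (hT m j x z)).trans ?_
    split_ifs
    · rw [Prod.smul_fst, smul_mul_assoc, mul_smul_comm]
    · exact smul_zero _

/-- Closedness makes the pairs of degree zero a C*-algebra, on which injective $*$-homomorphisms are
isometric. -/
theorem isClosed_homog (n : ℤ) :
    IsClosed (R.homog h hk hk' n : Set (A × (E.infinity h).Adjointable)) := by
  refine ((isClosed_spectralSubspace σ _).preimage continuous_fst).inter ?_
  change IsClosed {c : A × (E.infinity h).Adjointable | ∀ m j
    (x : (E.zpow h m).carrier) (z : (E.zpow h j).carrier), _ = _}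
  simp only [Set.ofPred_forall]
  refine isClosed_iInter fun m => isClosed_iInter fun j => isClosed_iInter fun x =>
    isClosed_iInter fun z => isClosed_eq ?_ ?_
  · have h1 : Continuous fun c : A × (E.infinity h).Adjointable => c.2.1 (ofDeg E h m x) :=
      (ContinuousLinearMap.apply ℂ _ (ofDeg E h m x)).continuous.comp
        (continuous_subtype_val.comp continuous_snd)
    exact continuous_subtype_val.comp
      ((E.infinity h).continuous_inner.comp (continuous_const.prodMk h1))
  · split_ifs
    · fun_prop
    · exact continuous_const

variable {R h hk hk'}

theorem exists_map_eq_mul {n m j : ℤ} {a : A} (ha : a ∈ spectralSubspace σ (n * k)) (hj : j = n + m)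
    (x : (E.zpow h m).carrier) :
    ∃ y, (R.zpow h hk hk' j).map y = a * (R.zpow h hk hk' m).map x :=
  (R.zpow h hk hk' j).exists_map_eq (by
    rw [hj, add_mul]
    exact mul_mem_spectralSubspace ha ((R.zpow h hk hk' m).map_mem x))

/-- A vector of $E_\infty$ is determined by its inner products with the summands. The target degree
`j` is a variable, so that rearranging sums of degrees moves no vector between summands. -/
theorem apply_of_mem_homog {n : ℤ} {c : A × (E.infinity h).Adjointable}
    (hc : c ∈ R.homog h hk hk' n) {m j : ℤ} (hj : j = n + m) {x : (E.zpow h m).carrier}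
    {y : (E.zpow h j).carrier}
    (hy : (R.zpow h hk hk' j).map y = c.1 * (R.zpow h hk hk' m).map x) :
    c.2.1 (ofDeg E h m x) = ofDeg E h j y := by
  refine directSum_ext fun i z => Subtype.ext ((hc.2 m i x z).trans ?_)
  split_ifs with hi
  · obtain rfl : i = j := hi.trans hj.symm
    rw [← hy, inner_directSumOf, star_map_mul_map]
  · rw [inner_directSumOf_of_ne _ (by omega)]
    rfl

/-- The target degree is left free here too: $S_\xi$ lands in degree `m + 1`, a product in degree `n
+ (m + i)`. -/
theorem mem_homog_of_apply {n : ℤ} {c : A × (E.infinity h).Adjointable}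
    (hc : c.1 ∈ spectralSubspace σ (n * k))
    (hT : ∀ m (x : (E.zpow h m).carrier), ∃ j, j = n + m ∧ ∃ y : (E.zpow h j).carrier,
      (R.zpow h hk hk' j).map y = c.1 * (R.zpow h hk hk' m).map x ∧
        c.2.1 (ofDeg E h m x) = ofDeg E h j y) :
    c ∈ R.homog h hk hk' n := by
  refine ⟨hc, fun m i x z => ?_⟩
  obtain ⟨j, hj, y, hy, hTy⟩ := hT m x
  rw [hTy]
  split_ifs with hi
  · obtain rfl : i = j := hi.trans hj.symm
    rw [← hy, inner_directSumOf, star_map_mul_map]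
  · rw [inner_directSumOf_of_ne _ (by omega)]
    rfl

theorem mul_mem_homog {n m : ℤ} {c c' : A × (E.infinity h).Adjointable}
    (hc : c ∈ R.homog h hk hk' n) (hc' : c' ∈ R.homog h hk hk' m) :
    c * c' ∈ R.homog h hk hk' (n + m) := by
  refine mem_homog_of_apply ?_ fun i x => ?_
  · rw [add_mul]
    exact mul_mem_spectralSubspace hc.1 hc'.1
  · obtain ⟨z, hz⟩ := exists_map_eq_mul (R := R) (hk := hk) (hk' := hk') hc'.1 rfl x
    obtain ⟨y, hy⟩ := exists_map_eq_mul (R := R) (hk := hk) (hk' := hk') hc.1 rfl z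
    refine ⟨_, (add_assoc n m i).symm, y, ?_, ?_⟩
    · rw [hy, hz, ← mul_assoc]
      rfl
    · change c.2.1 (c'.2.1 _) = _
      rw [apply_of_mem_homog hc' rfl hz, apply_of_mem_homog hc rfl hy]

/-- Taking adjoints transposes the matrix of coefficients, and $j=-n+m$ exactly when $m=n+j$. -/
theorem star_mem_homog {n : ℤ} {c : A × (E.infinity h).Adjointable}
    (hc : c ∈ R.homog h hk hk' n) : star c ∈ R.homog h hk hk' (-n) := by
  refine ⟨?_, fun m j x z => ?_⟩
  · rw [neg_mul]
    exact star_mem_spectralSubspace hc.1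
  · have h1 := inner_star_left (star c.2) (ofDeg E h m x) (ofDeg E h j z)
    rw [star_star, ← (E.infinity h).star_inner] at h1
    have h2 := (congrArg Subtype.val h1).symm.trans (congrArg star (hc.2 j m z x))
    refine h2.trans ?_
    by_cases hj : j = -n + m
    · rw [if_pos hj, if_pos (by omega), star_mul, star_mul, star_star, mul_assoc]
      rfl
    · rw [if_neg hj, if_neg (by omega), star_zero]

theorem mem_homog_S (ξ : E.carrier) : (R.map ξ, S E h ξ) ∈ R.homog h hk hk' 1 :=
  mem_homog_of_apply (by simpa using R.map_mem ξ) fun m x =>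
    ⟨m + 1, add_comm m 1, E.shift h ξ m x, R.zpow_map_shift h hk hk' ξ m x,
      shiftOp_of (F := fun n => (E.zpow h n).toHilbertModule) (isAdjoint_shift E h ξ)
        (norm_shift_le E h ξ) m x⟩

/-- The summands span a dense subspace, so the element of `A` determines the operator. -/
theorem snd_eq_zero_of_mem_homog {n : ℤ} {c : A × (E.infinity h).Adjointable}
    (hc : c ∈ R.homog h hk hk' n) (h0 : c.1 = 0) : c.2 = 0 :=
  directSum_op_eq_zero fun m x => by
    rw [apply_of_mem_homog hc (x := x) (y := 0) rfl (by rw [h0, zero_mul, map_zero])]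
    exact map_zero (directSumOfₗ (fun n => (E.zpow h n).toHilbertModule) (n + m))

/-- A component of a sum of homogeneous pairs is bounded by the operator of the sum. -/
theorem norm_fst_le_norm_sum_snd {s : Finset ℤ} {c : ℤ → A × (E.infinity h).Adjointable}
    (hc : ∀ n, c n ∈ R.homog h hk hk' n) {n₀ : ℤ} (hn₀ : n₀ ∈ s) :
    ‖(c n₀).1‖ ≤ ‖(∑ n ∈ s, c n).2‖ := by
  set a := (c n₀).1
  -- The test vector is $a^*$, in degree $-n_0$; the component of degree $n_0$ sends it to $aa^*$ in
  -- degree zero.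
  obtain ⟨x, hx⟩ := (R.zpow h hk hk' (-n₀)).exists_map_eq (y := star a) (by
    rw [neg_mul]
    exact star_mem_spectralSubspace (hc n₀).1)
  choose y hy using fun n => exists_map_eq_mul (R := R) (hk := hk) (hk' := hk')
    (j := n + -n₀) (hc n).1 rfl x
  have h1 : (∑ n ∈ s, c n).2.1 (ofDeg E h (-n₀) x) = ∑ n ∈ s, ofDeg E h (n + -n₀) (y n) := by
    let ev : (A × (E.infinity h).Adjointable) →+ (E.infinity h).carrier :=
      { toFun := fun c => c.2.1 (ofDeg E h (-n₀) x)
        map_zero' := rfl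
        map_add' := fun _ _ => rfl }
    refine (map_sum ev c s).trans (Finset.sum_congr rfl fun n _ => ?_)
    exact apply_of_mem_homog (hc n) rfl (hy n)
  -- The other components send the test vector to other degrees, which are orthogonal to $aa^*$.
  have h2 : (E.infinity h).inner (ofDeg E h (n₀ + -n₀) (y n₀))
      (∑ n ∈ s, ofDeg E h (n + -n₀) (y n)) = (E.zpow h (n₀ + -n₀)).inner (y n₀) (y n₀) := by
    rw [inner_sum_right, Finset.sum_eq_single_of_mem n₀ hn₀, inner_directSumOf]
    intro n _ hne
    exact inner_directSumOf_of_ne _ (by omega) _ _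
  have hxn : ‖x‖ = ‖a‖ := by rw [← norm_map (R.zpow h hk hk' _), hx, norm_star]
  have hyn : ‖y n₀‖ = ‖a‖ ^ 2 := by
    rw [← norm_map (R.zpow h hk hk' _), hy, hx, CStarRing.norm_self_mul_star, sq]
  have h3 := (E.infinity h).norm_inner_le (ofDeg E h (n₀ + -n₀) (y n₀))
    ((∑ n ∈ s, c n).2.1 (ofDeg E h (-n₀) x))
  rw [h1, h2, ← norm_sq_eq, norm_directSumOf, hyn, ← h1] at h3
  have h4 := (∑ n ∈ s, c n).2.1.le_opNorm (ofDeg E h (-n₀) x)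
  rw [norm_directSumOf, hxn] at h4
  -- The Cauchy–Schwarz bound $\|aa^*\|^2\le\|aa^*\|\,\|T\|\,\|a\|$, from which $\|a\|^3$ is
  -- cancelled.
  have h5 : ‖a‖ ^ 2 * (‖a‖ * ‖a‖) ≤ ‖a‖ ^ 2 * (‖(∑ n ∈ s, c n).2‖ * ‖a‖) := by
    calc _ = (‖a‖ ^ 2) ^ 2 := by ring
      _ ≤ _ := h3.trans (mul_le_mul_of_nonneg_left h4 (by positivity))
  rcases (norm_nonneg a).eq_or_lt with h0 | h0
  · rw [← h0]
    exact norm_nonneg _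
  · exact le_of_mul_le_mul_right (le_of_mul_le_mul_left h5 (by positivity)) h0

/-- The C*-algebra of the pairs of degree zero. -/
def homogZero : NonUnitalStarSubalgebra ℂ (A × (E.infinity h).Adjointable) where
  __ := R.homog h hk hk' 0
  mul_mem' hc hc' := by simpa using mul_mem_homog hc hc'
  star_mem' hc := by simpa using star_mem_homog hc

/-- The first projection is injective on this C*-algebra, hence isometric for the norm of the
product, which is the maximum of the two norms. -/
theorem norm_snd_le_of_mem_homog_zero {c : A × (E.infinity h).Adjointable}
    (hc : c ∈ R.homog h hk hk' 0) : ‖c.2‖ ≤ ‖c.1‖ := by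
  have : IsClosed (homogZero (R := R) (h := h) (hk := hk) (hk' := hk') :
      Set (A × (E.infinity h).Adjointable)) := R.isClosed_homog h hk hk' 0
  let f := (NonUnitalStarAlgHom.fst ℂ A (E.infinity h).Adjointable).comp
    (NonUnitalStarSubalgebraClass.subtype (homogZero (R := R) (h := h) (hk := hk) (hk' := hk')))
  have hf : Function.Injective f := by
    rw [injective_iff_map_eq_zero]
    intro c hc
    exact Subtype.ext (Prod.ext hc (snd_eq_zero_of_mem_homog c.2 hc))
  have h1 := NonUnitalStarAlgHom.norm_map f hf ⟨c, hc⟩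
  have h2 : ‖c.1‖ = ‖c‖ := h1
  rw [h2]
  exact norm_snd_le c

/-- The pair $c^*c$ has degree zero, and the C*-identity holds in both coordinates. -/
theorem norm_snd_le_of_mem_homog {n : ℤ} {c : A × (E.infinity h).Adjointable}
    (hc : c ∈ R.homog h hk hk' n) : ‖c.2‖ ≤ ‖c.1‖ := by
  have h1 := norm_snd_le_of_mem_homog_zero (c := star c * c)
    (by simpa using mul_mem_homog (star_mem_homog hc) hc)
  rw [Prod.fst_mul, Prod.snd_mul, Prod.fst_star, Prod.snd_star, CStarRing.norm_star_mul_self,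
    CStarRing.norm_star_mul_self] at h1
  exact (mul_self_le_mul_self_iff (norm_nonneg _) (norm_nonneg _)).mpr h1

variable (R h hk hk') in
/-- The sums of homogeneous pairs of degrees between `-M` and `M`. -/
def bounded (M : ℕ) : Submodule ℂ (A × (E.infinity h).Adjointable) :=
  ⨆ n ∈ Finset.Icc (-M : ℤ) M, R.homog h hk hk' n

theorem homog_le_bounded {n : ℤ} {M : ℕ} (hn : n.natAbs ≤ M) :
    R.homog h hk hk' n ≤ R.bounded h hk hk' M :=
  le_iSup₂_of_le n (by rw [Finset.mem_Icc]; omega) le_rfl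

theorem bounded_mono {M M' : ℕ} (hM : M ≤ M') : R.bounded h hk hk' M ≤ R.bounded h hk hk' M' :=
  iSup₂_le fun n hn => homog_le_bounded (by rw [Finset.mem_Icc] at hn; omega)

theorem exists_sum_of_mem_bounded {M : ℕ} {c : A × (E.infinity h).Adjointable}
    (hc : c ∈ R.bounded h hk hk' M) : ∃ f : ℤ → A × (E.infinity h).Adjointable,
      (∀ n, f n ∈ R.homog h hk hk' n) ∧ ∑ n ∈ Finset.Icc (-M : ℤ) M, f n = c := by
  obtain ⟨μ, hμ⟩ := (Submodule.mem_iSup_finset_iff_exists_sum _ _).mp hc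
  exact ⟨fun n => μ n, fun n => (μ n).2, hμ⟩

theorem mul_mem_bounded {M M' : ℕ} {c c' : A × (E.infinity h).Adjointable}
    (hc : c ∈ R.bounded h hk hk' M) (hc' : c' ∈ R.bounded h hk hk' M') :
    c * c' ∈ R.bounded h hk hk' (M + M') := by
  obtain ⟨f, hf, rfl⟩ := exists_sum_of_mem_bounded hc
  obtain ⟨f', hf', rfl⟩ := exists_sum_of_mem_bounded hc'
  rw [Finset.sum_mul_sum]
  refine Submodule.sum_mem _ fun n hn => Submodule.sum_mem _ fun n' hn' => ?_
  rw [Finset.mem_Icc] at hn hn'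
  exact homog_le_bounded (by omega) (mul_mem_homog (hf n) (hf' n'))

theorem star_mem_bounded {M : ℕ} {c : A × (E.infinity h).Adjointable}
    (hc : c ∈ R.bounded h hk hk' M) : star c ∈ R.bounded h hk hk' M := by
  obtain ⟨f, hf, rfl⟩ := exists_sum_of_mem_bounded hc
  rw [star_sum]
  refine Submodule.sum_mem _ fun n hn => ?_
  rw [Finset.mem_Icc] at hn
  exact homog_le_bounded (by omega) (star_mem_homog (hf n))

/-- There are $2M+1$ components, each bounded by $\|c_1\|$. As $k\ne0$, different degrees belong to
different characters of the circle, so the components can be separated in `A`. -/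
theorem norm_snd_le_of_mem_bounded {M : ℕ} (hk0 : k ≠ 0) {c : A × (E.infinity h).Adjointable}
    (hc : c ∈ R.bounded h hk hk' M) : ‖c.2‖ ≤ (2 * M + 1) * ‖c.1‖ := by
  obtain ⟨f, hf, rfl⟩ := exists_sum_of_mem_bounded hc
  rw [Prod.snd_sum, Prod.fst_sum]
  refine (norm_sum_le_of_le _ fun n hn => (norm_snd_le_of_mem_homog (hf n)).trans
    (norm_component_le (mul_left_injective₀ hk0) (fun n => (hf n).1) hn)).trans ?_
  rw [Finset.sum_const, nsmul_eq_mul, Int.card_Icc]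
  gcongr
  rw [show ((M : ℤ) + 1 - -M).toNat = 2 * M + 1 by omega]
  push_cast
  rfl

theorem norm_fst_le_of_mem_bounded {M : ℕ} {c : A × (E.infinity h).Adjointable}
    (hc : c ∈ R.bounded h hk hk' M) : ‖c.1‖ ≤ (2 * M + 1) * ‖c.2‖ := by
  obtain ⟨f, hf, rfl⟩ := exists_sum_of_mem_bounded hc
  rw [Prod.fst_sum]
  refine (norm_sum_le_of_le _ fun n hn => norm_fst_le_norm_sum_snd hf hn).trans ?_
  rw [Finset.sum_const, nsmul_eq_mul, Int.card_Icc]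
  gcongr
  rw [show ((M : ℤ) + 1 - -M).toNat = 2 * M + 1 by omega]
  push_cast
  rfl

/-- The witness is $c^{2^j}$, by repeated squaring; for self-adjoint elements the C*-identity makes
each squaring exact in norm. -/
theorem exists_norm_eq_pow {M : ℕ} {c : A × (E.infinity h).Adjointable}
    (hc : c ∈ R.bounded h hk hk' M) (hsa : star c = c) (j : ℕ) :
    ∃ b ∈ R.bounded h hk hk' (2 ^ j * M), star b = b ∧
      ‖b.1‖ = ‖c.1‖ ^ 2 ^ j ∧ ‖b.2‖ = ‖c.2‖ ^ 2 ^ j := by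
  induction j with
  | zero => exact ⟨c, by simpa using hc, hsa, by simp, by simp⟩
  | succ j ih =>
    obtain ⟨b, hb, hbs, h1, h2⟩ := ih
    refine ⟨b * b, ?_, by rw [star_mul, hbs], ?_, ?_⟩
    · have := mul_mem_bounded hb hb
      rwa [← two_mul, ← mul_assoc, ← pow_succ'] at this
    · have := CStarRing.norm_star_mul_self (x := b.1)
      rw [← Prod.fst_star, hbs, h1] at this
      rw [Prod.fst_mul, this, pow_succ, pow_mul, sq]
    · have := CStarRing.norm_star_mul_self (x := b.2)
      rw [← Prod.snd_star, hbs, h2] at this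
      rw [Prod.snd_mul, this, pow_succ, pow_mul, sq]

/-- The crude bounds in both directions are applied to $(c^*c)^{2^j}$; their factor is linear in
$2^j$ and vanishes after taking $2^j$-th roots. -/
theorem norm_snd_eq_of_mem_bounded {M : ℕ} (hk0 : k ≠ 0) {c : A × (E.infinity h).Adjointable}
    (hc : c ∈ R.bounded h hk hk' M) : ‖c.2‖ = ‖c.1‖ := by
  have hcc := mul_mem_bounded (star_mem_bounded hc) hc
  have hpow := exists_norm_eq_pow hcc (by rw [star_mul, star_star])
  have e1 : ‖(star c * c).1‖ = ‖c.1‖ * ‖c.1‖ := CStarRing.norm_star_mul_self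
  have e2 : ‖(star c * c).2‖ = ‖c.2‖ * ‖c.2‖ := CStarRing.norm_star_mul_self
  rw [e1, e2] at hpow
  -- The degrees of $c^*c$ are at most $M+M$, those of its $2^j$-th power at most $2^j(M+M)$, which
  -- leaves room for $2\cdot2^j(M+M)+1$ components.
  have e3 : ∀ j : ℕ, (2 * ((2 ^ j * (M + M) : ℕ) : ℝ) + 1) = 2 ^ j * (4 * M : ℝ) + 1 := fun j => by
    push_cast
    ring
  apply le_antisymm
  · refine (mul_self_le_mul_self_iff (norm_nonneg _) (norm_nonneg _)).mpr
      (le_of_pow_two_pow_le (M := 4 * M) (by positivity) fun j => ?_)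
    obtain ⟨b, hb, -, h1, h2⟩ := hpow j
    have := norm_snd_le_of_mem_bounded hk0 hb
    rwa [h1, h2, e3] at this
  · refine (mul_self_le_mul_self_iff (norm_nonneg _) (norm_nonneg _)).mpr
      (le_of_pow_two_pow_le (M := 4 * M) (by positivity) fun j => ?_)
    obtain ⟨b, hb, -, h1, h2⟩ := hpow j
    have := norm_fst_le_of_mem_bounded hb
    rwa [h1, h2, e3] at this

variable (R h) in
/-- The pairs of `ξ` in `A` and `S_ξ`. -/
def generators : Set (A × (E.infinity h).Adjointable) := Set.range fun ξ => (R.map ξ, S E h ξ)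

theorem norm_snd_eq_of_mem_adjoin (hk : FullAt σ (-k)) (hk' : FullAt σ k) (hk0 : k ≠ 0)
    {c : A × (E.infinity h).Adjointable}
    (hc : c ∈ NonUnitalStarAlgebra.adjoin ℂ (R.generators h)) : ‖c.2‖ = ‖c.1‖ := by
  have : ∃ M, c ∈ R.bounded h hk hk' M := by
    induction hc using NonUnitalStarAlgebra.adjoin_induction with
    | mem c hc =>
      obtain ⟨ξ, rfl⟩ := hc
      exact ⟨1, homog_le_bounded (by simp) (mem_homog_S ξ)⟩
    | zero => exact ⟨0, zero_mem _⟩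
    | add c c' _ _ h1 h2 =>
      obtain ⟨M, hM⟩ := h1
      obtain ⟨M', hM'⟩ := h2
      exact ⟨M + M', add_mem (bounded_mono (Nat.le_add_right _ _) hM)
        (bounded_mono (Nat.le_add_left _ _) hM')⟩
    | mul c c' _ _ h1 h2 =>
      obtain ⟨M, hM⟩ := h1
      obtain ⟨M', hM'⟩ := h2
      exact ⟨M + M', mul_mem_bounded hM hM'⟩
    | smul t c _ h1 =>
      obtain ⟨M, hM⟩ := h1
      exact ⟨M, Submodule.smul_mem _ t hM⟩
    | star c _ h1 =>
      obtain ⟨M, hM⟩ := h1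
      exact ⟨M, star_mem_bounded hM⟩
  obtain ⟨M, hM⟩ := this
  exact norm_snd_eq_of_mem_bounded hk0 hM

end Realization
end CircleAction

/-! ### From isometric projections to isomorphisms of C*-algebras -/

/-- A `*`-homomorphism that is isometric on the `*`-algebra generated by `s` identifies the
C*-algebras generated by `s` and by its image. -/
theorem exists_starAlgEquiv_closure_adjoin {C D : Type u} [NonUnitalCStarAlgebra C]
    [NonUnitalCStarAlgebra D] {s : Set C} (p : C →⋆ₙₐ[ℂ] D)
    (hp : ∀ c ∈ NonUnitalStarAlgebra.adjoin ℂ s, ‖p c‖ = ‖c‖) {T : NonUnitalStarSubalgebra ℂ D}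
    (hT : (NonUnitalStarAlgebra.adjoin ℂ (p '' s)).topologicalClosure = T) :
    ∃ Θ : (NonUnitalStarAlgebra.adjoin ℂ s).topologicalClosure ≃⋆ₐ[ℂ] T,
      ∀ c, (Θ c : D) = p c := by
  subst hT
  set S := (NonUnitalStarAlgebra.adjoin ℂ s).topologicalClosure
  have hpc : Continuous p := (show C →L[ℂ] D from LinearMap.mkContinuous
    { toFun := p, map_add' := map_add p, map_smul' := map_smul p } 1 fun c => by
      rw [one_mul]
      exact NonUnitalStarAlgHom.norm_apply_le p c).continuous
  have hnorm : ∀ c ∈ S, ‖p c‖ = ‖c‖ := fun c hc =>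
    closure_minimal (s := (NonUnitalStarAlgebra.adjoin ℂ s : Set C)) (t := {c | ‖p c‖ = ‖c‖}) hp
      (isClosed_eq hpc.norm continuous_norm) hc
  have hmap : (NonUnitalStarAlgebra.adjoin ℂ s).map p
      = NonUnitalStarAlgebra.adjoin ℂ (p '' s) := NonUnitalStarAlgHom.map_adjoin p s
  have hmem : ∀ c : S, p c ∈ (NonUnitalStarAlgebra.adjoin ℂ (p '' s)).topologicalClosure :=
    fun c => map_mem_closure hpc c.2 fun x hx => by
      have : p x ∈ (NonUnitalStarAlgebra.adjoin ℂ s).map p := ⟨x, hx, rfl⟩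
      rwa [hmap] at this
  let q : S →⋆ₙₐ[ℂ] (NonUnitalStarAlgebra.adjoin ℂ (p '' s)).topologicalClosure :=
    NonUnitalStarAlgHom.codRestrict (p.comp (NonUnitalStarSubalgebraClass.subtype S)) _ hmem
  have hq : ∀ c, (q c : D) = p c := fun _ => rfl
  have hcomplete : CompleteSpace S :=
    (NonUnitalStarSubalgebra.isClosed_topologicalClosure _).completeSpace_coe
  have hiso : Isometry fun c : S => p c := by
    have := AddMonoidHomClass.isometry_of_norm (p.comp (NonUnitalStarSubalgebraClass.subtype S))
      fun c => hnorm c c.2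
    exact this
  refine ⟨StarAlgEquiv.ofBijective q ⟨fun c c' hcc => hiso.injective (congrArg Subtype.val hcc),
    fun y => ?_⟩, fun c => rfl⟩
  -- Surjectivity: the isometric image of a complete space is closed, and it contains the
  -- $*$-algebra generated by the image of `s`.
  have hsub : closure (NonUnitalStarAlgebra.adjoin ℂ (p '' s) : Set D)
      ⊆ Set.range fun c : S => p c := by
    refine closure_minimal ?_ hiso.isClosedEmbedding.isClosed_range
    rw [← hmap]
    rintro _ ⟨c, hc, rfl⟩
    exact ⟨⟨c, NonUnitalStarSubalgebra.le_topologicalClosure _ hc⟩, rfl⟩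
  obtain ⟨c, hc⟩ := hsub y.2
  exact ⟨c, Subtype.ext hc⟩

/-- A `*`-homomorphism that is isometric on the `*`-algebra generated by `s` identifies the
C*-algebra generated by `s` with any C*-algebra that is embedded onto the one generated by its
image. -/
theorem exists_starAlgEquiv_of_range_eq {C D P : Type u} [NonUnitalCStarAlgebra C]
    [NonUnitalCStarAlgebra D] [NonUnitalCStarAlgebra P] {s : Set C} (p : C →⋆ₙₐ[ℂ] D)
    (hp : ∀ c ∈ NonUnitalStarAlgebra.adjoin ℂ s, ‖p c‖ = ‖c‖) (ι : P →⋆ₙₐ[ℂ] D)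
    (hι : Function.Injective ι)
    (hrange : Set.range ι = (NonUnitalStarAlgebra.adjoin ℂ (p '' s)).topologicalClosure) :
    ∃ Θ : (NonUnitalStarAlgebra.adjoin ℂ s).topologicalClosure ≃⋆ₐ[ℂ] P,
      ∀ c, ι (Θ c) = p c := by
  obtain ⟨Θ, hΘ⟩ := exists_starAlgEquiv_closure_adjoin p hp rfl
  have hmem : ∀ x, ι x ∈ (NonUnitalStarAlgebra.adjoin ℂ (p '' s)).topologicalClosure := fun x => by
    have h : ι x ∈ Set.range ι := ⟨x, rfl⟩
    rwa [hrange] at h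
  have hbij : Function.Bijective (NonUnitalStarAlgHom.codRestrict ι _ hmem) := by
    refine ⟨fun x y h => hι (congrArg Subtype.val h), fun y => ?_⟩
    have hy : (y : D) ∈ Set.range ι := by
      rw [hrange]
      exact y.2
    obtain ⟨x, hx⟩ := hy
    exact ⟨x, Subtype.ext hx⟩
  let e := StarAlgEquiv.ofBijective _ hbij
  have he : ∀ x, (e x : D) = ι x := fun _ => rfl
  refine ⟨Θ.trans e.symm, fun c => ?_⟩
  rw [StarAlgEquiv.trans_apply, ← he, StarAlgEquiv.apply_symm_apply, hΘ]

/-- If both projections are isometric on the `*`-algebra generated by a set of pairs, then they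
identify the C*-algebras generated by the two projections of the set. -/
theorem exists_starAlgEquiv_of_pairs {C D P Q : Type u} [NonUnitalCStarAlgebra C]
    [NonUnitalCStarAlgebra D] [NonUnitalCStarAlgebra P] [NonUnitalCStarAlgebra Q] {s : Set (C × D)}
    (hs : ∀ c ∈ NonUnitalStarAlgebra.adjoin ℂ s, ‖c.2‖ = ‖c.1‖)
    (ι : P →⋆ₙₐ[ℂ] C) (hι : Function.Injective ι)
    (hrange : Set.range ι = (NonUnitalStarAlgebra.adjoin ℂ (Prod.fst '' s)).topologicalClosure)
    (κ : Q →⋆ₙₐ[ℂ] D) (hκ : Function.Injective κ)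
    (hrange' : Set.range κ = (NonUnitalStarAlgebra.adjoin ℂ (Prod.snd '' s)).topologicalClosure) :
    ∃ Φ : Q ≃⋆ₐ[ℂ] P, ∀ c ∈ s, ∀ x, κ x = c.2 → ι (Φ x) = c.1 := by
  obtain ⟨Φ, hΦ⟩ := exists_starAlgEquiv_of_range_eq (s := s) (NonUnitalStarAlgHom.fst ℂ C D)
    -- The norm of a pair is the maximum of its two norms; these are equal, so each projection is
    -- isometric.
    (fun c hc => by
      rw [Prod.norm_def, hs c hc, max_self]
      rfl) ι hι hrange
  obtain ⟨Ψ, hΨ⟩ := exists_starAlgEquiv_of_range_eq (s := s) (NonUnitalStarAlgHom.snd ℂ C D)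
    (fun c hc => by
      rw [Prod.norm_def, ← hs c hc, max_self]
      rfl) κ hκ hrange'
  refine ⟨Ψ.symm.trans Φ, fun c hc x hx => ?_⟩
  let g : (NonUnitalStarAlgebra.adjoin ℂ s).topologicalClosure :=
    ⟨c, NonUnitalStarSubalgebra.le_topologicalClosure _ (NonUnitalStarAlgebra.subset_adjoin ℂ _ hc)⟩
  have hg : x = Ψ g := hκ (hx.trans (hΨ g).symm)
  rw [StarAlgEquiv.trans_apply, hg, StarAlgEquiv.symm_apply_apply, hΦ]
  rfl

/-! ### The Pimsner algebra as $A^{1/d}$ -/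

namespace CircleAction

open HilbertModule Correspondence

variable {A : Type u} [NonUnitalCStarAlgebra A] {σ : Circle →* (A ≃⋆ₐ[ℂ] A)}

/-- If `A_(d)` is full on both sides, it generates `A^{1/d}`. -/
theorem topologicalClosure_adjoin_spectralSubspace {d : ℕ} (hk : FullAt σ (-d))
    (hk' : FullAt σ d) :
    (NonUnitalStarAlgebra.adjoin ℂ (spectralSubspace σ d : Set A)).topologicalClosure
      = rootAlgebra σ d := by
  set S := (NonUnitalStarAlgebra.adjoin ℂ (spectralSubspace σ d : Set A)).topologicalClosure
  let K : Submodule ℂ A := S.toNonUnitalSubalgebra.toSubmodule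
  have hcl : IsClosed (K : Set A) := NonUnitalStarSubalgebra.isClosed_topologicalClosure _
  have h1 : ∀ x ∈ spectralSubspace σ d, x ∈ S := fun x hx =>
    NonUnitalStarSubalgebra.le_topologicalClosure _ (NonUnitalStarAlgebra.subset_adjoin ℂ _ hx)
  have h2 : ∀ n : ℕ, spectralSubspace σ (n * d) ≤ K := by
    intro n
    induction n with
    | zero =>
      intro x hx
      -- $A_{(0)}$ is not among the generators: it is reached through the closed span of
      -- $A_{(d)}^*A_{(d)}$.
      refine map_mem_of_mem_closedProd (ContinuousLinearMap.id ℂ A) hcl (fun x hx y hy => ?_)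
        (hk' (by simpa using hx))
      have hx' := star_mem_spectralSubspace hx
      rw [neg_neg] at hx'
      have := star_mem (h1 _ hx')
      rw [star_star] at this
      exact show x * y ∈ S from mul_mem this (h1 y hy)
    | succ n ih =>
      rw [show ((n + 1 : ℕ) : ℤ) * d = d + n * d by push_cast; ring]
      exact fun x hx => map_mem_of_mem_closedProd (ContinuousLinearMap.id ℂ A) hcl
        (fun x hx y hy => show x * y ∈ S from mul_mem (h1 x hx) (ih hy)) (hk.le_closedProd _ hx)
  have h3 : ∀ n : ℤ, spectralSubspace σ (n * d) ≤ K := by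
    intro n
    obtain ⟨n, rfl | rfl⟩ := n.eq_nat_or_neg
    · exact h2 n
    · intro x hx
      have hx' := star_mem_spectralSubspace hx
      rw [neg_mul, neg_neg] at hx'
      have : star (star x) ∈ S := star_mem (show star x ∈ S from h2 n hx')
      rwa [star_star] at this
  apply le_antisymm
  · refine NonUnitalStarSubalgebra.topologicalClosure_minimal _ ?_
      (NonUnitalStarSubalgebra.isClosed_topologicalClosure _)
    refine (NonUnitalStarAlgebra.adjoin_le fun x hx => ?_).trans
      (NonUnitalStarSubalgebra.le_topologicalClosure _)
    exact Submodule.mem_iSup_of_mem (p := fun n : ℤ => spectralSubspace σ (n * d)) 1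
      (by simpa using hx)
  · refine NonUnitalStarSubalgebra.topologicalClosure_minimal _ (fun x hx => ?_) hcl
    exact (iSup_le h3 : (⨆ n : ℤ, spectralSubspace σ (n * d)) ≤ K) hx

/-- The inclusion of the Pimsner algebra in the operators on `E_∞`. -/
def pimsnerIncl {B : Type u} [NonUnitalCStarAlgebra B] (E : Correspondence B)
    (h : E.IsPimsnerPair) : E.PimsnerAlgebra h →⋆ₙₐ[ℂ] (E.infinity h).Adjointable where
  toFun T := (show pimsnerSubalgebra E h from T).1
  map_smul' _ _ := rfl
  map_zero' := rfl
  map_add' _ _ := rfl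
  map_mul' _ _ := rfl
  map_star' _ := rfl

theorem range_pimsnerIncl {B : Type u} [NonUnitalCStarAlgebra B] (E : Correspondence B)
    (h : E.IsPimsnerPair) : Set.range (pimsnerIncl E h)
      = (NonUnitalStarAlgebra.adjoin ℂ (Set.range (S E h))).topologicalClosure :=
  Subtype.range_coe

instance (d : ℕ) : IsClosed (rootAlgebra σ d : Set A) :=
  NonUnitalStarSubalgebra.isClosed_topologicalClosure _

/-- The Pimsner algebra of a correspondence identified with `A_(d)` is `A^{1/d}`. -/
theorem Realization.exists_starAlgEquiv_pimsnerAlgebra {E : Correspondence (fixedPoints σ)} {d : ℕ}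
    (hd : 0 < d) (R : Realization σ E d) (h : E.IsPimsnerPair) (hk : FullAt σ (-d))
    (hk' : FullAt σ d) :
    ∃ Φ : E.PimsnerAlgebra h ≃⋆ₐ[ℂ] rootAlgebra σ d,
      ∀ ξ, (Φ (pimsnerS E h ξ) : A) = R.map ξ := by
  obtain ⟨Φ, hΦ⟩ := exists_starAlgEquiv_of_pairs (s := R.generators h)
    (fun c hc => R.norm_snd_eq_of_mem_adjoin hk hk' (by exact_mod_cast hd.ne') hc)
    (NonUnitalStarSubalgebraClass.subtype (rootAlgebra σ d)) Subtype.val_injective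
    (by
      have hfst : Prod.fst '' R.generators h = spectralSubspace σ d := by
        rw [generators, ← Set.range_comp, ← R.range_map]
        rfl
      rw [hfst, topologicalClosure_adjoin_spectralSubspace hk hk']
      exact Subtype.range_coe)
    (pimsnerIncl E h) Subtype.val_injective
    (by
      have hsnd : Prod.snd '' R.generators h = Set.range (S E h) := by
        rw [generators, ← Set.range_comp]
        rfl
      rw [hsnd, range_pimsnerIncl])
  exact ⟨Φ, fun ξ => hΦ _ ⟨ξ, rfl⟩ _ rfl⟩

end CircleAction

end Modules

end

/-! ### The theorem -/

/-- Let `σ` be a strongly continuous circle action on a C*-algebra `A` with separable fixed-point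
algebra, such that `A_(1)` and `A_(-1)` are full and countably generated, and let `d ≥ 1`. Then
`A_(d)` and the `d`-fold interior tensor power of `A_(1)` have Pimsner algebras; multiplication is a
unitary isomorphism `ψ` from the tensor power to `A_(d)`, which induces an isomorphism of the Pimsner
algebras; and the Pimsner algebra of `A_(d)` is isomorphic to `A^{1/d}` by `S_ξ ↦ ξ`. -/
theorem theoremt {A : Type u} [NonUnitalCStarAlgebra A] (σ : Circle →* (A ≃⋆ₐ[ℂ] A))
    (hσ : ∀ a : A, Continuous fun z : Circle => σ z a)
    (hsep : TopologicalSpace.SeparableSpace (CircleAction.fixedPoints σ))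
    (hfull : (CircleAction.spectralModule σ 1).IsFull)
    (hcount : (CircleAction.spectralModule σ 1).IsCountablyGenerated)
    (hfull' : (CircleAction.spectralModule σ (-1)).IsFull)
    (hcount' : (CircleAction.spectralModule σ (-1)).IsCountablyGenerated)
    (d : ℕ) (hd : 0 < d) :
    ∃ (h : (CircleAction.spectralCorrespondence σ d).IsPimsnerPair)
      (h' : ((CircleAction.spectralCorrespondence σ 1).tpow d).IsPimsnerPair)
      (ψ : Correspondence.Unitary ((CircleAction.spectralCorrespondence σ 1).tpow d)
        (CircleAction.spectralCorrespondence σ d)),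
      (∀ x : Fin d → (CircleAction.spectralCorrespondence σ 1).carrier,
        CircleAction.incl σ d
            (ψ.toEquiv (Correspondence.tprod (CircleAction.spectralCorrespondence σ 1) d x))
          = CircleAction.prod d fun i => CircleAction.incl σ 1 (x i)) ∧
      (∃ Θ : ((CircleAction.spectralCorrespondence σ 1).tpow d).PimsnerAlgebra h'
          ≃⋆ₐ[ℂ] (CircleAction.spectralCorrespondence σ d).PimsnerAlgebra h,
        ∀ ζ, Θ (Correspondence.pimsnerS _ h' ζ)
          = Correspondence.pimsnerS _ h (ψ.toEquiv ζ)) ∧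
      (∃ Φ : (CircleAction.spectralCorrespondence σ d).PimsnerAlgebra h
          ≃⋆ₐ[ℂ] CircleAction.rootAlgebra σ d,
        ∀ ξ : (CircleAction.spectralCorrespondence σ d).carrier,
          ((Φ (Correspondence.pimsnerS (CircleAction.spectralCorrespondence σ d) h ξ) :
            CircleAction.rootAlgebra σ d) : A) = CircleAction.incl σ d ξ) := by
  have h1 : CircleAction.FullAt σ d := by
    simpa using (CircleAction.fullAt_of_isFull hfull).nsmul d
  have h2 : CircleAction.FullAt σ (-d) := by
    simpa using (CircleAction.fullAt_of_isFull hfull').nsmul d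
  have h3 : TopologicalSpace.IsSeparable (CircleAction.spectralSubspace σ d : Set A) := by
    simpa using CircleAction.isSeparable_spectralSubspace_nsmul
      (CircleAction.fullAt_of_isFull hfull')
      (CircleAction.isSeparable_spectralSubspace_of_isCountablyGenerated hcount) hd
  let R := CircleAction.Realization.spectral σ d
  -- The tensor power is realized in degree $d\cdot1=d$, the same as $A_{(d)}$, so all that follows
  -- applies to both.
  let R' := ((CircleAction.Realization.spectral σ 1).tpow
    (CircleAction.fullAt_of_isFull hfull') d).cast (mul_one (d : ℤ))
  have h := R.isPimsnerPair h2 h1 h3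
  have h' := R'.isPimsnerPair h2 h1 h3
  obtain ⟨Φ, hΦ⟩ := R.exists_starAlgEquiv_pimsnerAlgebra hd h h2 h1
  obtain ⟨Φ', hΦ'⟩ := R'.exists_starAlgEquiv_pimsnerAlgebra hd h' h2 h1
  refine ⟨h, h', R'.unitary R, fun x => ?_, ⟨Φ'.trans Φ.symm, fun ζ => ?_⟩, Φ, hΦ⟩
  · refine (R'.map_unitary R _).trans ?_
    exact (CircleAction.Realization.spectral σ 1).tpow_map_tprod _ hd x
  -- The isomorphism of the Pimsner algebras passes through $A^{1/d}$, where $S_\zeta$ and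
  -- $S_{\psi(\zeta)}$ have the same image because $\psi$ is compatible with the two realizations.
  · have hζ : Φ' (Correspondence.pimsnerS _ h' ζ)
        = Φ (Correspondence.pimsnerS _ h ((R'.unitary R).toEquiv ζ)) :=
      Subtype.ext (by rw [hΦ, hΦ', R'.map_unitary R])
    exact (congrArg Φ.symm hζ).trans (Φ.symm_apply_apply _)
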